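/- Theorem. A compact metric graph consists of finitely many vertices and finitely many edges of positive finite length, is connected, and carries the geodesic metric $d$ (length of a shortest path). It has Euclidean edges if it has no loops and no multiple edges and the geodesic distance between the end points of every edge equals the length of the edge. A Euclidean cycle is a metric graph with Euclidean edges whose combinatorial graph is a cycle; its length is its total edge length. Let $\Gamma$ be a compact metric graph with Euclidean edges which is a $k$-step 1-sum of metric graphs with Euclidean edges $\Gamma_1,\dots,\Gamma_k$; that is, $\Gamma=\Gamma_1\cup\dots\cup\Gamma_k$, each $\Gamma_i$ carries the metric induced by $d$, and for every $i\ge 2$ there is a point $v_i$ with $(\Gamma_1\cup\dots\cup\Gamma_{i-1})\cap\Gamma_i=\{v_i\}$ and $d(x,y)=d(x,v_i)+d(v_i,y)$ for all $x\in\Gamma_1\cup\dots\cup\Gamma_{i-1}$, $y\in\Gamma_i$. Suppose that one of the pieces $\Gamma_i$ is a Euclidean cycle and that another one is either a Euclidean cycle of a different length or a single edge. Let $d_R$ be the resistance metric of $\Gamma$: $d_R(s,t)=\mathrm{Var}(Z(s)-Z(t))$, where $Z=Z_\mu+\sum_e Z_e$ is a sum of independent centred Gaussian processes; $Z_\mu$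 has on the vertices the law $N(0,L^{-1})$ and is interpolated linearly along the edges, where, for a fixed vertex $v_0$, $L$ is the graph Laplacian with conductance $1/d(u,v)$ for adjacent vertices $u,v$, with $1$ added to the diagonal entry at $v_0$; and $Z_e$ is a Brownian bridge on the edge $e$ and vanishes on the other edges. Let $\widetilde d$ be either $d$ or $d_R$, let $r$ be a continuous function on $[0,\infty)$, and let $X$ be a Gaussian random field on $\Gamma$ with covariance function $\rho(s,t)=r(\widetilde d(s,t))$, where $\rho$ is not constant on $\Gamma\times\Gamma$. Then $X$ is not Markov of order 1. Here $X$ is Markov of order 1 if it is continuous in $L_2(\Omega)$ and, for every open $S\subset\Gamma$, the $\sigma$-algebras $\mathcal F_+(\overline S)$ and $\mathcal F_+(\Gamma\setminus S)$ are conditionally independent given $\sigma(X(s):s\in\partial S)$, where $\mathcal F_+(A)=\bigcap_{\varepsilon>0}\sigma(X(s):s\in\Gamma,\ d(s,z)<\varepsilon\text{ for some }z\in A)$. -/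

import Mathlib

open MeasureTheory ProbabilityTheory
open scoped Topology ENNReal

/-! ### Compact metric graphs -/

/-- `PathLength len curve x y L`: there is a path from `x` to `y` of total length `L` which is a
finite concatenation of segments of the curves `curve e : [0, len e] → Γ`, the segment between the
parameters `a` and `b` having length `|a - b|`. -/
inductive PathLength {Γ : Type*} {m : ℕ} (len : Fin m → ℝ) (curve : Fin m → ℝ → Γ) :
    Γ → Γ → ℝ → Prop
  | refl (x : Γ) : PathLength len curve x x 0
  | step (e : Fin m) (a b : ℝ) (ha : a ∈ Set.Icc 0 (len e)) (hb : b ∈ Set.Icc 0 (len e))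
      (z : Γ) (L : ℝ) (h : PathLength len curve (curve e b) z L) :
      PathLength len curve (curve e a) z (|a - b| + L)

/-- The structure of a compact connected metric graph on the metric space `Γ`: finitely many
vertices and finitely many edges; each edge is a curve of positive finite length, parametrized by
arc length on `[0, len e]` and joining two vertices; the open edges are pairwise disjoint simple
arcs which contain no vertex; vertices and edges cover `Γ`; and the metric of `Γ` is the geodesic
metric, that is, `dist x y` is the length of a shortest path from `x` to `y` (so `Γ` is connected).
The values of `curve e` outside `[0, len e]` are irrelevant. Loops and multiple edges are allowed
here. -/
structure MetricGraph (Γ : Type*) [MetricSpace Γ] where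
  vertices : Finset Γ
  numEdges : ℕ
  len : Fin numEdges → ℝ
  len_pos : ∀ e, 0 < len e
  curve : Fin numEdges → ℝ → Γ
  curve_zero_mem : ∀ e, curve e 0 ∈ vertices
  curve_len_mem : ∀ e, curve e (len e) ∈ vertices
  curve_interior : ∀ e, ∀ t ∈ Set.Ioo 0 (len e), curve e t ∉ vertices
  curve_inj : ∀ e e', ∀ t ∈ Set.Ioo 0 (len e), ∀ t' ∈ Set.Ioo 0 (len e'),
    curve e t = curve e' t' → e = e' ∧ t = t'
  cover : ∀ x : Γ, x ∈ vertices ∨ ∃ e, ∃ t ∈ Set.Ioo 0 (len e), curve e t = x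
  geodesic : ∀ x y : Γ, IsLeast {L : ℝ | PathLength len curve x y L} (dist x y)

namespace MetricGraph

variable {Γ : Type*} [MetricSpace Γ] (G : MetricGraph Γ)

/-- The closed edge `e` as a subset of `Γ`. -/
def edgeSet (e : Fin G.numEdges) : Set Γ := G.curve e '' Set.Icc 0 (G.len e)

/-- The initial vertex of the edge `e`. -/
def src (e : Fin G.numEdges) : Γ := G.curve e 0

/-- The terminal vertex of the edge `e`. -/
def tgt (e : Fin G.numEdges) : Γ := G.curve e (G.len e)

/-- The combinatorial graph on the vertices: two distinct vertices are adjacent if some edge joins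
them. -/
def graph : SimpleGraph G.vertices where
  Adj u v := u ≠ v ∧ ∃ e, s(G.src e, G.tgt e) = s((u : Γ), (v : Γ))
  symm := ⟨fun _ _ h => ⟨h.1.symm, h.2.imp fun _ he => he.trans Sym2.eq_swap⟩⟩
  loopless := ⟨fun _ h => h.1 rfl⟩

/-- A metric graph with Euclidean edges: there are no loops and no multiple edges, and the geodesic
distance between the two end points of an edge is the length of this edge. (Compactness and
connectedness are part of `MetricGraph`.) -/
structure HasEuclideanEdges : Prop where
  no_loop : ∀ e, G.src e ≠ G.tgt e
  no_multiple : ∀ e e', s(G.src e, G.tgt e) = s(G.src e', G.tgt e') → e = e'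
  dist_eq_len : ∀ e, dist (G.src e) (G.tgt e) = G.len e

/-- The total edge length. -/
def totalLength : ℝ := ∑ e, G.len e

/-- A Euclidean cycle: a metric graph with Euclidean edges whose combinatorial graph is a cycle. -/
def IsEuclideanCycle : Prop :=
  G.HasEuclideanEdges ∧ ∃ n : ℕ, 3 ≤ n ∧ Nonempty (G.graph ≃g SimpleGraph.cycleGraph n)

/-- A single edge (with its two end points), as a metric graph with Euclidean edges. -/
def IsSingleEdge : Prop := G.HasEuclideanEdges ∧ G.numEdges = 1

/-! ### The resistance metric

It is the variogram of the centred Gaussian process `Z = Z_μ + ∑ e, Z_e`, where the summands are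
independent, `Z_μ` is `N(0, L⁻¹)` on the vertices and is interpolated linearly along the edges, and
`Z_e` is a Brownian bridge on the edge `e` and vanishes elsewhere. -/

open Classical in
/-- The conductance between two vertices: `1 / d(u, v)` if some edge joins them, `0` otherwise. -/
noncomputable def conductance (u v : G.vertices) : ℝ :=
  if G.graph.Adj u v then 1 / dist (u : Γ) (v : Γ) else 0

open Classical in
/-- The matrix `L`: the weighted graph Laplacian, with `1` added to the diagonal entry at `v₀`. -/
noncomputable def laplacian (v₀ : G.vertices) : Matrix G.vertices G.vertices ℝ :=
  fun u v =>
    if u = v then (if u = v₀ then 1 else 0) + ∑ w, G.conductance u w else -G.conductance u v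

open Classical in
/-- The coefficients of the linear interpolation, `Z_μ(s) = ∑ v, interpWeight s v * Z_μ(v)`: if `s`
is a vertex this is `Z_μ(s)`; if `s` is an interior point of the edge `e` it is
`(1 - d) * Z_μ(src e) + d * Z_μ(tgt e)` with `d = dist s (src e) / dist (src e) (tgt e)`. -/
noncomputable def interpWeight (s : Γ) (v : G.vertices) : ℝ :=
  if s ∈ G.vertices then (if s = v then 1 else 0)
  else ∑ e, if s ∈ G.edgeSet e then
    (1 - dist s (G.src e) / dist (G.src e) (G.tgt e)) * (if G.src e = v then 1 else 0)
      + dist s (G.src e) / dist (G.src e) (G.tgt e) * (if G.tgt e = v then 1 else 0)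
    else 0

open Classical in
/-- The covariance function of `Z_μ`. -/
noncomputable def covVertexPart (v₀ : G.vertices) (s t : Γ) : ℝ :=
  ∑ u, ∑ v, G.interpWeight s u * (G.laplacian v₀)⁻¹ u v * G.interpWeight t v

open Classical in
/-- The covariance function of `Z_e`: that of the Brownian bridge, `min a b - a * b / len e`, at two
points of `e` at distance `a` and `b` from `src e`, and `0` if one of the points is not in `e`. -/
noncomputable def covBridge (e : Fin G.numEdges) (s t : Γ) : ℝ :=
  if s ∈ G.edgeSet e ∧ t ∈ G.edgeSet e then
    min (dist s (G.src e)) (dist t (G.src e))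
      - dist s (G.src e) * dist t (G.src e) / G.len e
  else 0

/-- The covariance function of `Z = Z_μ + ∑ e, Z_e`. -/
noncomputable def covZ (v₀ : G.vertices) (s t : Γ) : ℝ :=
  G.covVertexPart v₀ s t + ∑ e, G.covBridge e s t

/-- The resistance metric `d_R(s, t) = Var(Z(s) - Z(t))`. -/
noncomputable def resistanceDist (v₀ : G.vertices) (s t : Γ) : ℝ :=
  G.covZ v₀ s s + G.covZ v₀ t t - 2 * G.covZ v₀ s t

end MetricGraph

/-- The metric space `Γ` is the `k`-step 1-sum of its subspaces `P 0, …, P (k-1)` (each with the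
induced metric) with intersecting points `v i`, `i ≥ 1`: the subspaces cover `Γ`, for `i ≥ 1` the
union of the preceding ones meets `P i` exactly in `v i`, and the distance between a point of this
union and a point of `P i` is the sum of their distances to `v i`. -/
structure IsKStepOneSum {Γ : Type*} [MetricSpace Γ] {k : ℕ} (P : Fin k → Set Γ)
    (v : Fin k → Γ) : Prop where
  cover : ⋃ i, P i = Set.univ
  inter : ∀ i : Fin k, 0 < (i : ℕ) → (⋃ j : Fin k, ⋃ _ : j < i, P j) ∩ P i = {v i}
  dist_eq : ∀ i : Fin k, ∀ x ∈ ⋃ j : Fin k, ⋃ _ : j < i, P j, ∀ y ∈ P i,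
    dist x y = dist x (v i) + dist (v i) y

/-! ### Random fields and the Markov property of order 1 -/

/-- `𝓒` splits `𝓐` and `𝓑`: they are conditionally independent given `𝓒`. -/
def Splits {Ω : Type*} [MeasurableSpace Ω] (μ : Measure Ω) (𝓒 𝓐 𝓑 : MeasurableSpace Ω) : Prop :=
  ∀ A B : Set Ω, MeasurableSet[𝓐] A → MeasurableSet[𝓑] B →
    μ⟦A ∩ B | 𝓒⟧ =ᵐ[μ] fun ω => (μ⟦A | 𝓒⟧) ω * (μ⟦B | 𝓒⟧) ω

/-- The σ-algebra `𝓕(S) = σ(u(s) : s ∈ S)`. -/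
@[reducible] def fieldSigma {Γ Ω : Type*} (u : Γ → Ω → ℝ) (S : Set Γ) : MeasurableSpace Ω :=
  ⨆ s ∈ S, MeasurableSpace.comap (u s) (borel ℝ)

/-- The σ-algebra `𝓕₊(S) = ⋂ ε > 0, 𝓕(S_ε)`, where `S_ε` is the open `ε`-neighbourhood of `S`. -/
@[reducible] def fieldSigmaPlus {Γ Ω : Type*} [MetricSpace Γ] (u : Γ → Ω → ℝ) (S : Set Γ) :
    MeasurableSpace Ω :=
  ⨅ ε : ℝ, ⨅ _ : 0 < ε, fieldSigma u (Metric.thickening ε S)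

/-- The random field `u` is Markov of order 1: it is continuous in `L²(Ω)` (differentiable of
order 0), and for every open set `S` the σ-algebra generated by the values of `u` on the boundary of
`S` splits `𝓕₊(closure of S)` and `𝓕₊(Γ \ S)`. -/
def IsMarkovOrderOne {Γ Ω : Type*} [MetricSpace Γ] [MeasurableSpace Ω] (μ : Measure Ω)
    (u : Γ → Ω → ℝ) : Prop :=
  (∀ s : Γ, Filter.Tendsto (fun t => eLpNorm (u t - u s) 2 μ) (𝓝 s) (𝓝 0)) ∧
  ∀ S : Set Γ, IsOpen S →
    Splits μ (fieldSigma u (frontier S)) (fieldSigmaPlus u (closure S)) (fieldSigmaPlus u Sᶜ)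

/-! ### Conditional independence and covariances -/

section Prob

variable {Ω : Type*} {mΩ : MeasurableSpace Ω} {μ : Measure Ω} [IsProbabilityMeasure μ]

/-! For a Gaussian field the Markov property is a statement about covariances. If an open set has
boundary {a, b}, the residual of X s, for s in the closure of the set, after regression on X a and X
b is uncorrelated with X t for every t outside the set (`IsMarkovOrderOne.cov_eq`). Applied to the
arcs of a curve along which the covariance is a function ψ of arc length, this gives ψ(x)(ψ(0) +
ψ(2s)) = ψ(s)(ψ(x+s) + ψ(x-s)) for small s (`MarkovKernel.exists_recurrence`). So ψ is rigid: its
values on a grid follow from the first three, and in the interior it solves ψ'' = mψ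
(`MarkovKernel.exists_ode`). The aim is always to show that r is constant near 0: then nearby points
of an edge are perfectly correlated, and connectedness makes the covariance constant
(`IsMarkovOrderOne.cov_const`), which is excluded.

Geodesic metric: every piece of a 1-sum has a gate map (`IsKStepOneSum.exists_isGate`), so open
subsets of Γ cut the cycle into arcs and the single edge at one interior point. On a cycle of length
ℓ the kernel returns to its initial value at ℓ. A single edge forces r(2s)r(0) = r(s)², so the
kernel of the cycle is geometric on a grid and closing up makes the ratio 1
(`MarkovKernel.flat_of_multiplicative`). Two cycles share the kernel at small distances, so the
kernel of the longer one takes its initial value again at the length of the shorter one; perfect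
correlation of distinct points then forces flatness (`MarkovKernel.flat_of_length_lt`).

Resistance metric: on an edge it equals |x-y| - K|x-y|², where K = 1/len - R/len² and R is the
effective resistance between the ends (`HasEuclideanEdges.exists_resistanceDist_curve`). Explicit
potentials give K = 1/ℓ on an edge inside a cycle of length ℓ, and K = 0 on an edge that meets a
single-edge piece in its interior. Hence r satisfies two second order equations with different K
near 0, and these are compatible only if r' = 0 (`MarkovKernel.flat_of_ne`). -/

lemma condExp_eq_zero_of_setIntegral {m : MeasurableSpace Ω} (hm : m ≤ mΩ) {f : Ω → ℝ}
    (hf : Integrable f μ) (h : ∀ A, MeasurableSet[m] A → ∫ ω in A, f ω ∂μ = 0) :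
    μ[f|m] =ᵐ[μ] 0 := by
  refine (ae_eq_condExp_of_forall_setIntegral_eq hm hf
    (fun s _ _ => integrableOn_zero) (fun s hs _ => ?_)
    stronglyMeasurable_zero.aestronglyMeasurable).symm
  rw [h s hs]
  simp

lemma integral_mul_eq_zero_of_condExp {m : MeasurableSpace Ω} (hm : m ≤ mΩ) {f g : Ω → ℝ}
    (hf : Integrable f μ) (hg : StronglyMeasurable[m] g) (hfg : Integrable (f * g) μ)
    (h : ∀ A, MeasurableSet[m] A → ∫ ω in A, f ω ∂μ = 0) : ∫ ω, f ω * g ω ∂μ = 0 := by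
  have h1 := condExp_mul_of_stronglyMeasurable_right hg hfg hf
  have h2 := condExp_eq_zero_of_setIntegral hm hf h
  have h3 : μ[f * g|m] =ᵐ[μ] 0 := by
    filter_upwards [h1, h2] with ω h1 h2
    rw [h1, Pi.mul_apply, h2]; simp
  calc ∫ ω, f ω * g ω ∂μ = ∫ ω, (μ[f * g|m]) ω ∂μ := (integral_condExp hm).symm
    _ = 0 := by rw [integral_congr_ae h3]; simp

end Prob

/-- If `𝓒` splits `𝓐` and `𝓑`, then the residual of an `𝓐`-measurable variable given `𝓒` is
orthogonal to the `𝓑`-measurable variables. -/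
lemma Splits.integral_residual_mul {Ω : Type*} {𝓒 𝓐 𝓑 mΩ : MeasurableSpace Ω} {μ : Measure Ω}
    [IsProbabilityMeasure μ] (h : Splits μ 𝓒 𝓐 𝓑)
    (hC : 𝓒 ≤ mΩ) (hA : 𝓐 ≤ mΩ) (hB : 𝓑 ≤ mΩ) {f g W : Ω → ℝ}
    (hf : StronglyMeasurable[𝓐] f) (hg : StronglyMeasurable[𝓑] g) (hfi : Integrable f μ)
    (hW : μ[f|𝓒] =ᵐ[μ] W) (hi : Integrable ((f - W) * g) μ) :
    ∫ ω, (f ω - W ω) * g ω ∂μ = 0 := by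
  -- It suffices to integrate the residual over B in 𝓑. With p = P(B|𝓒), splitting makes 1_B - p
  -- orthogonal to 𝓐 and hence to f, while p f and 1_B W have the same integral, both being that of
  -- p E[f|𝓒].
  have hWi : Integrable W μ := integrable_condExp.congr hW
  refine integral_mul_eq_zero_of_condExp hB (f := f - W) (hfi.sub hWi) hg hi fun B hBm => ?_
  set p : Ω → ℝ := μ⟦B|𝓒⟧ with hp
  have hBi : Integrable (B.indicator fun _ => (1 : ℝ)) μ :=
    (integrable_const 1).indicator (hB _ hBm)
  have hpb : ∀ᵐ ω ∂μ, ‖p ω‖ ≤ 1 := by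
    have h0 : 0 ≤ᵐ[μ] p := condExp_nonneg (Filter.Eventually.of_forall fun ω =>
      Set.indicator_nonneg (fun _ _ => zero_le_one) ω)
    have h1 : p ≤ᵐ[μ] μ[fun _ => (1 : ℝ)|𝓒] := condExp_mono hBi (integrable_const 1)
      (Filter.Eventually.of_forall fun ω => by
        by_cases hω : ω ∈ B <;> simp [hω])
    rw [condExp_const hC] at h1
    filter_upwards [h0, h1] with ω h0 h1
    rw [Real.norm_eq_abs, abs_le]
    exact ⟨by linarith [show (0 : ℝ) ≤ p ω from h0], h1⟩
  have hpm : StronglyMeasurable[𝓒] p := stronglyMeasurable_condExp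
  have hpm' : AEStronglyMeasurable p μ := (hpm.mono hC).aestronglyMeasurable
  -- `η = 1_B - p` integrates to zero over the sets of `𝓐`
  have key : ∫ ω, ((B.indicator (fun _ => (1 : ℝ)) - p) ω) * f ω ∂μ = 0 := by
    refine integral_mul_eq_zero_of_condExp hA (hBi.sub integrable_condExp) hf ?_ ?_
    · have h1 : Integrable (p * f) μ := hfi.bdd_mul hpm' hpb
      have h2 : Integrable ((B.indicator fun _ => (1 : ℝ)) * f) μ := by
        refine hfi.bdd_mul (c := 1) hBi.aestronglyMeasurable
          (Filter.Eventually.of_forall fun ω => ?_)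
        by_cases hω : ω ∈ B <;> simp [hω]
      have : (B.indicator (fun _ => (1 : ℝ)) - p) * f
          = (B.indicator fun _ => (1 : ℝ)) * f - p * f := by ring
      rw [this]; exact h2.sub h1
    · intro A hAm
      have hAi : Integrable (A.indicator fun _ => (1 : ℝ)) μ :=
        (integrable_const 1).indicator (hA _ hAm)
      have e1 : ∫ ω in A, p ω ∂μ = ∫ ω, (μ⟦A ∩ B|𝓒⟧) ω ∂μ := by
        have h3 := condExp_stronglyMeasurable_mul_of_bound hC hpm hAi 1 hpb
        calc ∫ ω in A, p ω ∂μ = ∫ ω, (p * A.indicator fun _ => (1 : ℝ)) ω ∂μ := by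
              rw [← integral_indicator (hA _ hAm)]
              congr 1; ext ω; by_cases hω : ω ∈ A <;> simp [hω]
          _ = ∫ ω, (μ[p * A.indicator fun _ => (1 : ℝ)|𝓒]) ω ∂μ := (integral_condExp hC).symm
          _ = _ := by
              refine integral_congr_ae ?_
              filter_upwards [h3, h A B hAm hBm] with ω h3 h4
              rw [h3, h4, mul_comm]; rfl
      rw [integral_sub' hBi.integrableOn integrable_condExp.integrableOn, e1, integral_condExp hC,
        setIntegral_indicator (hB _ hBm), integral_indicator ((hA _ hAm).inter (hB _ hBm)), sub_self]
  have e2 : ∫ ω, B.indicator (fun _ => (1 : ℝ)) ω * f ω ∂μ = ∫ ω in B, f ω ∂μ := by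
    rw [← integral_indicator (hB _ hBm)]
    congr 1; ext ω; by_cases hω : ω ∈ B <;> simp [hω]
  have e3 : ∫ ω, p ω * f ω ∂μ = ∫ ω in B, W ω ∂μ := by
    have h5 := condExp_stronglyMeasurable_mul_of_bound hC hpm hfi 1 hpb
    have h6 : Integrable (p * μ[f|𝓒]) μ := integrable_condExp.bdd_mul hpm' hpb
    have h6' : Integrable ((B.indicator fun _ => (1 : ℝ)) * μ[f|𝓒]) μ := by
      refine integrable_condExp.bdd_mul (c := 1) hBi.aestronglyMeasurable
        (Filter.Eventually.of_forall fun ω => ?_)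
      by_cases hω : ω ∈ B <;> simp [hω]
    have h7 := condExp_mul_of_stronglyMeasurable_right (m := 𝓒)
      (stronglyMeasurable_condExp (f := f) (μ := μ)) h6' hBi
    calc ∫ ω, p ω * f ω ∂μ = ∫ ω, (μ[p * f|𝓒]) ω ∂μ := (integral_condExp hC).symm
      _ = ∫ ω, (p * μ[f|𝓒]) ω ∂μ := integral_congr_ae h5
      _ = ∫ ω, (μ[(B.indicator fun _ => (1 : ℝ)) * μ[f|𝓒]|𝓒]) ω ∂μ := (integral_congr_ae h7).symm
      _ = ∫ ω, ((B.indicator fun _ => (1 : ℝ)) * μ[f|𝓒]) ω ∂μ := integral_condExp hC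
      _ = ∫ ω in B, (μ[f|𝓒]) ω ∂μ := by
        rw [← integral_indicator (hB _ hBm)]
        congr 1; ext ω; by_cases hω : ω ∈ B <;> simp [hω]
      _ = ∫ ω in B, W ω ∂μ := setIntegral_congr_ae (hB _ hBm) (by
        filter_upwards [hW] with ω h _ using h)
  have e4 : ∫ ω, ((B.indicator (fun _ => (1 : ℝ)) - p) ω) * f ω ∂μ
      = (∫ ω in B, f ω ∂μ) - ∫ ω in B, W ω ∂μ := by
    rw [← e2, ← e3, ← integral_sub]
    · congr 1; ext ω; simp [sub_mul]
    · refine hfi.bdd_mul (c := 1) hBi.aestronglyMeasurable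
          (Filter.Eventually.of_forall fun ω => ?_)
      by_cases hω : ω ∈ B <;> simp [hω]
    · exact hfi.bdd_mul hpm' hpb
  rw [integral_sub' hfi.integrableOn hWi.integrableOn, ← e4, key]

/-- The Cauchy-Schwarz inequality for covariances. -/
lemma sq_covariance_le {Ω : Type*} {mΩ : MeasurableSpace Ω} {μ : Measure Ω}
    [IsProbabilityMeasure μ] {U V : Ω → ℝ} (hU : MemLp U 2 μ) (hV : MemLp V 2 μ) :
    cov[U, V; μ] ^ 2 ≤ Var[U; μ] * Var[V; μ] := by
  have h : ∀ x : ℝ, 0 ≤ Var[U; μ] * (x * x) + 2 * cov[U, V; μ] * x + Var[V; μ] := by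
    intro x
    have h0 := variance_nonneg (x • U + V) μ
    have hxU := hU.const_smul x
    rw [← covariance_self (hxU.add hV).aemeasurable, covariance_add_left hxU hV (hxU.add hV),
      covariance_add_right hxU hxU hV, covariance_add_right hV hxU hV, covariance_smul_left,
      covariance_smul_left, covariance_smul_right, covariance_smul_right, covariance_comm V U,
      covariance_self hU.aemeasurable, covariance_self hV.aemeasurable] at h0
    linarith
  have hd := discrim_le_zero h
  rw [discrim] at hd
  linarith

lemma measurable_fieldSigma {Γ Ω : Type*} {X : Γ → Ω → ℝ} {S : Set Γ} {s : Γ} (hs : s ∈ S) :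
    Measurable[fieldSigma X S] (X s) := by
  have h : MeasurableSpace.comap (X s) (borel ℝ) ≤ fieldSigma X S :=
    le_iSup₂ (f := fun s (_ : s ∈ S) => MeasurableSpace.comap (X s) (borel ℝ)) s hs
  rw [measurable_iff_comap_le]
  exact h

lemma ProbabilityTheory.IsGaussianProcess.memLp_two {Γ Ω : Type*} [MeasurableSpace Ω]
    {μ : Measure Ω} {X : Γ → Ω → ℝ} (hX : IsGaussianProcess X μ) (s : Γ) : MemLp (X s) 2 μ :=
  (hX.hasGaussianLaw_eval s).memLp_two

/-! ### The Markov property in terms of covariances -/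

section Field

variable {Γ : Type*} {Ω : Type*} [MeasurableSpace Ω] {μ : Measure Ω} [IsProbabilityMeasure μ]
  {X : Γ → Ω → ℝ}

lemma fieldSigma_le (hXm : ∀ s, Measurable (X s)) (S : Set Γ) :
    fieldSigma X S ≤ ‹MeasurableSpace Ω› := by
  refine iSup₂_le fun s _ => ?_
  rw [← BorelSpace.measurable_eq (α := ℝ)]
  exact (hXm s).comap_le

lemma cov_comb (hX : IsGaussianProcess X μ) (s a b t : Γ) (α β : ℝ) :
    cov[fun ω => X s ω - (α * X a ω + β * X b ω), X t; μ]
      = cov[X s, X t; μ] - (α * cov[X a, X t; μ] + β * cov[X b, X t; μ]) := by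
  have h := hX.memLp_two
  have e : (fun ω => X s ω - (α * X a ω + β * X b ω)) = X s - (α • X a + β • X b) := rfl
  rw [e, covariance_sub_left (h s) (((h a).const_smul α).add ((h b).const_smul β)) (h t),
    covariance_add_left ((h a).const_smul α) ((h b).const_smul β) (h t),
    covariance_smul_left, covariance_smul_left]

lemma cov_sq_le (hX : IsGaussianProcess X μ) (s t : Γ) :
    cov[X s, X t; μ] ^ 2 ≤ cov[X s, X s; μ] * cov[X t, X t; μ] := by
  rw [covariance_self (hX.memLp_two s).aemeasurable, covariance_self (hX.memLp_two t).aemeasurable]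
  exact sq_covariance_le (hX.memLp_two s) (hX.memLp_two t)

/-- Two perfectly correlated values of the field have the same covariances. -/
lemma cov_eq_of_perfect (hX : IsGaussianProcess X μ) {a b : Γ}
    (h1 : cov[X a, X a; μ] = cov[X a, X b; μ]) (h2 : cov[X b, X b; μ] = cov[X a, X b; μ]) (t : Γ) :
    cov[X a, X t; μ] = cov[X b, X t; μ] := by
  have h := hX.memLp_two
  have hv : cov[X a - X b, X a - X b; μ] = 0 := by
    rw [covariance_sub_sub (h a) (h b) (h a) (h b), covariance_comm (X b) (X a), h1, h2]; ring
  have hab := (h a).sub (h b)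
  rw [covariance_self hab.aemeasurable] at hv
  have hc := sq_covariance_le hab (h t)
  rw [hv, zero_mul, covariance_sub_left (h a) (h b) (h t)] at hc
  linarith [pow_eq_zero_iff two_ne_zero |>.1 (le_antisymm hc (sq_nonneg _))]

/-- The residual and the values on F form one Gaussian family, so zero covariance is independence.
This is the one place where joint Gaussianity is used, beyond square integrability. -/
lemma indep_comb_fieldSigma (hX : IsGaussianProcess X μ) (hXm : ∀ s, Measurable (X s))
    {F : Set Γ} {s a b : Γ} {α β : ℝ}
    (h : ∀ z ∈ F, cov[X s, X z; μ] = α * cov[X a, X z; μ] + β * cov[X b, X z; μ]) :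
    Indep (MeasurableSpace.comap (fun ω => X s ω - (α * X a ω + β * X b ω)) inferInstance)
      (fieldSigma X F) μ := by
  classical
  set Y : Unit → Ω → ℝ := fun _ ω => X s ω - (α * X a ω + β * X b ω)
  set Z : F → Ω → ℝ := fun z => X z
  have hG : IsGaussianProcess (Sum.elim Y Z) μ := by
    refine hX.of_isGaussianProcess fun i => ?_
    rcases i with u | z
    · refine ⟨{s, a, b}, ContinuousLinearMap.proj (R := ℝ) ⟨s, by simp⟩
        - (α • ContinuousLinearMap.proj ⟨a, by simp⟩ + β • ContinuousLinearMap.proj ⟨b, by simp⟩),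
        fun ω => ?_⟩
      simp [Y]
    · exact ⟨{z.1}, ContinuousLinearMap.proj (R := ℝ) ⟨z.1, by simp⟩, fun ω => by simp [Z]⟩
  have hYm : ∀ u, Measurable (Y u) := fun _ =>
    (hXm s).sub (((hXm a).const_mul α).add ((hXm b).const_mul β))
  have hI := hG.indepFun_of_covariance_eq_zero (fun u => (hYm u).aemeasurable)
    (fun z => (hXm z).aemeasurable) (fun u z => by
      rw [cov_comb hX, h z z.2, sub_self])
  have hev : Measurable fun f : Unit → ℝ => f () := by fun_prop
  have hI' := hI.comp hev measurable_id
  rw [IndepFun_iff_Indep] at hI'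
  refine indep_of_indep_of_le_right hI' ?_
  refine iSup₂_le fun z hz => ?_
  rw [← BorelSpace.measurable_eq (α := ℝ)]
  have : X z = (fun f : F → ℝ => f ⟨z, hz⟩) ∘ (id ∘ fun ω t => Z t ω) := rfl
  rw [this, ← MeasurableSpace.comap_comp]
  exact MeasurableSpace.comap_mono (measurable_pi_apply _).comap_le

/-- The covariance form of the Markov property for an open set with at most two boundary points. -/
lemma IsMarkovOrderOne.cov_eq [MetricSpace Γ] (hM : IsMarkovOrderOne μ X)
    (hX : IsGaussianProcess X μ) (hXm : ∀ s, Measurable (X s)) {S : Set Γ} (hS : IsOpen S)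
    {a b s t : Γ} (hF : frontier S = {a, b}) (hs : s ∈ closure S) (ht : t ∉ S) {α β : ℝ}
    (ha : cov[X s, X a; μ] = α * cov[X a, X a; μ] + β * cov[X b, X a; μ])
    (hb : cov[X s, X b; μ] = α * cov[X a, X b; μ] + β * cov[X b, X b; μ]) :
    cov[X s, X t; μ] = α * cov[X a, X t; μ] + β * cov[X b, X t; μ] := by
  have hL := hX.memLp_two
  have plus_le : ∀ T : Set Γ, fieldSigmaPlus X T ≤ ‹MeasurableSpace Ω› := fun T =>
    (iInf₂_le 1 one_pos).trans (fieldSigma_le hXm _)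
  have plus_meas : ∀ (T : Set Γ) (z : Γ), z ∈ T → StronglyMeasurable[fieldSigmaPlus X T] (X z) := by
    intro T z hz
    refine Measurable.stronglyMeasurable ?_
    rw [measurable_iff_comap_le]
    refine le_iInf₂ fun ε hε => ?_
    rw [← measurable_iff_comap_le]
    exact measurable_fieldSigma (Metric.self_subset_thickening hε _ hz)
  -- The residual Y is independent of the boundary σ-algebra, so the conditional expectation of X s
  -- is the regression plus the mean c of Y; the field need not be centred.
  set Y : Ω → ℝ := fun ω => X s ω - (α * X a ω + β * X b ω) with hY
  have hYL : MemLp Y 2 μ := (hL s).sub (((hL a).const_mul α).add ((hL b).const_mul β))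
  set c : ℝ := ∫ ω, Y ω ∂μ with hc
  have hCle := fieldSigma_le hXm (frontier S)
  have hind : Indep (MeasurableSpace.comap Y inferInstance) (fieldSigma X (frontier S)) μ := by
    refine indep_comb_fieldSigma hX hXm fun z hz => ?_
    rw [hF] at hz
    rcases hz with rfl | rfl
    · exact ha
    · exact hb
  have hYm : Measurable Y := (hXm s).sub (((hXm a).const_mul α).add ((hXm b).const_mul β))
  have hcY : μ[Y|fieldSigma X (frontier S)] =ᵐ[μ] fun _ => c :=
    condExp_indep_eq hYm.comap_le hCle (comap_measurable Y).stronglyMeasurable hind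
  have hlin : StronglyMeasurable[fieldSigma X (frontier S)] fun ω => α * X a ω + β * X b ω := by
    have hXa : Measurable[fieldSigma X (frontier S)] (X a) :=
      measurable_fieldSigma (by rw [hF]; simp)
    have hXb : Measurable[fieldSigma X (frontier S)] (X b) :=
      measurable_fieldSigma (by rw [hF]; simp)
    exact ((hXa.const_mul α).add (hXb.const_mul β)).stronglyMeasurable
  have hlinL : MemLp (fun ω => α * X a ω + β * X b ω) 2 μ :=
    ((hL a).const_mul α).add ((hL b).const_mul β)
  have hW : μ[X s|fieldSigma X (frontier S)] =ᵐ[μ] fun ω => c + (α * X a ω + β * X b ω) := by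
    have e : X s = Y + fun ω => α * X a ω + β * X b ω := by ext ω; simp [hY]
    have h1 := condExp_add (hYL.integrable one_le_two) (hlinL.integrable one_le_two)
      (fieldSigma X (frontier S))
    rw [condExp_of_stronglyMeasurable hCle hlin (hlinL.integrable one_le_two)] at h1
    rw [e]
    filter_upwards [h1, hcY] with ω h1 h2
    rw [h1, Pi.add_apply, h2]
  have hfW : (X s - fun ω => c + (α * X a ω + β * X b ω)) = fun ω => Y ω - c := by
    ext ω; simp [hY]; ring
  have h0 := Splits.integral_residual_mul (hM.2 S hS) hCle (plus_le _) (plus_le _)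
    (plus_meas _ s hs) (plus_meas _ t ht) ((hL s).integrable one_le_two) hW (by
      rw [hfW]; exact (hYL.sub (memLp_const c)).integrable_mul (hL t))
  have h1 : ∫ ω, (Y ω - c) * X t ω ∂μ = 0 := by
    rw [← h0]; congr 1; ext ω
    show (X s ω - (α * X a ω + β * X b ω) - c) * X t ω = _
    ring
  have h2 : cov[Y, X t; μ] = 0 := by
    rw [covariance_eq_sub hYL (hL t)]
    have : ∫ ω, (Y ω - c) * X t ω ∂μ = ∫ ω, (Y * X t) ω ∂μ - c * ∫ ω, X t ω ∂μ := by
      rw [← integral_const_mul, ← integral_sub (hYL.integrable_mul (hL t))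
        (((hL t).integrable one_le_two).const_mul c)]
      congr 1; ext ω; simp; ring
    rw [← this, h1]
  rw [hY, cov_comb hX] at h2
  linarith

/-- The covariances of a field which is continuous in `L²` are continuous. -/
lemma IsMarkovOrderOne.continuous_cov [MetricSpace Γ] (hM : IsMarkovOrderOne μ X)
    (hX : IsGaussianProcess X μ) (u : Γ) : Continuous fun s => cov[X s, X u; μ] := by
  have hL := hX.memLp_two
  rw [continuous_iff_continuousAt]
  intro s
  rw [ContinuousAt, tendsto_iff_norm_sub_tendsto_zero]
  have h1 : Filter.Tendsto (fun t => (eLpNorm (X t - X s) 2 μ).toReal * √Var[X u; μ]) (𝓝 s)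
      (𝓝 0) := by
    have := ((ENNReal.tendsto_toReal ENNReal.zero_ne_top).comp (hM.1 s)).mul_const (√Var[X u; μ])
    simpa using! this
  refine squeeze_zero (fun _ => norm_nonneg _) (fun t => ?_) h1
  rw [← covariance_sub_left (hL t) (hL s) (hL u), Real.norm_eq_abs]
  have hts := (hL t).sub (hL s)
  have h2 : √Var[X t - X s; μ] ≤ (eLpNorm (X t - X s) 2 μ).toReal := ?_
  · refine le_trans ?_ (mul_le_mul_of_nonneg_right h2 (Real.sqrt_nonneg _))
    rw [← Real.sqrt_mul (variance_nonneg _ _)]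
    exact Real.abs_le_sqrt (sq_covariance_le hts (hL u))
  refine Real.sqrt_le_iff.2 ⟨ENNReal.toReal_nonneg, ?_⟩
  refine (variance_le_expectation_sq hts.aestronglyMeasurable).trans (le_of_eq ?_)
  rw [hts.eLpNorm_eq_integral_rpow_norm two_ne_zero ENNReal.ofNat_ne_top, ENNReal.toReal_ofReal
    (by positivity)]
  have : (0 : ℝ) ≤ ∫ ω, (X t - X s) ω ^ 2 ∂μ := integral_nonneg fun ω => sq_nonneg _
  simp only [ENNReal.toReal_ofNat, Real.rpow_ofNat, Real.norm_eq_abs, sq_abs]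
  rw [← Real.rpow_natCast, ← Real.rpow_mul (by simpa using this)]
  simp

end Field

/-! ### Markov kernels on an interval -/

/-- `ψ` is, on `[0, b]`, the covariance of a stationary process along a curve which has the Markov
property with respect to the arcs of the curve: `rel` expresses that the values at the positions `u`
and `t` are uncorrelated given the values at the positions `0` and `u + v ≤ t`. -/
structure MarkovKernel (ψ : ℝ → ℝ) (b : ℝ) : Prop where
  pos : 0 < b
  cont : ContinuousOn ψ (Set.Icc 0 b)
  zero_pos : 0 < ψ 0
  perfect : ∀ p ∈ Set.Icc 0 b, ψ p = ψ 0 → ∀ x ∈ Set.Icc 0 b, ψ |x - p| = ψ x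
  rel : ∀ u v t α β : ℝ, 0 < u → 0 < v → u + v ≤ t → t ≤ b → ψ u = α * ψ 0 + β * ψ (u + v) →
    ψ v = α * ψ (u + v) + β * ψ 0 → ψ (t - u) = α * ψ t + β * ψ (t - u - v)

namespace MarkovKernel

variable {ψ : ℝ → ℝ} {b : ℝ}

lemma exists_pos_near (h : MarkovKernel ψ b) :
    ∃ δ > 0, δ ≤ b ∧ ∀ x ∈ Set.Icc 0 δ, 0 < ψ x := by
  have h1 : ContinuousWithinAt ψ (Set.Icc 0 b) 0 := h.cont 0 ⟨le_rfl, h.pos.le⟩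
  have h2 := h1.eventually (lt_mem_nhds h.zero_pos)
  obtain ⟨ε, hε, hb⟩ := Metric.mem_nhdsWithin_iff.1 h2
  refine ⟨min (ε / 2) b, lt_min (by linarith) h.pos, min_le_right _ _, fun x hx => ?_⟩
  have hx1 := hx.2.trans (min_le_left _ _)
  refine hb ⟨?_, hx.1, hx.2.trans (min_le_right _ _)⟩
  rw [Metric.mem_ball, Real.dist_eq, sub_zero, abs_of_nonneg hx.1]
  linarith

/-- If the values at some positive distance are perfectly correlated, then so are the values at all
small distances. -/
lemma flat_of_eq (h : MarkovKernel ψ b) {p : ℝ} (hp : 0 < p) (hpb : 2 * p ≤ b) (hψ : ψ p = ψ 0) :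
    ∃ ε > 0, ∀ x ∈ Set.Icc 0 ε, ψ x = ψ 0 := by
  obtain ⟨δ, hδ, _, hpos⟩ := h.exists_pos_near
  have hper := h.perfect p ⟨hp.le, by linarith⟩ hψ
  refine ⟨min δ (p / 2), lt_min hδ (by linarith), fun u hu => ?_⟩
  rcases hu.1.eq_or_lt with rfl | hu0
  · rfl
  have huδ := hu.2.trans (min_le_left _ _)
  have hup := hu.2.trans (min_le_right _ _)
  have h0 := h.zero_pos
  -- Perfect correlation at distance p makes ψ symmetric and p-periodic here, so position u
  -- regresses on 0 and p with weights ψ u / ψ 0 and 0. Tested at t = u + p, `rel` says ψ(0)² =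
  -- ψ(u)², and positivity near 0 rules out the negative sign.
  have e1 : ψ (p - u) = ψ u := by
    have := hper u ⟨hu.1, by linarith⟩
    rwa [abs_of_nonpos (by linarith), neg_sub] at this
  have e2 : ψ (u + p) = ψ u := by
    have := hper (u + p) ⟨by linarith, by linarith⟩
    rw [add_sub_cancel_right, abs_of_pos hu0] at this
    exact this.symm
  have h1 := h.rel u (p - u) (u + p) (ψ u / ψ 0) 0 hu0 (by linarith) (by linarith) (by linarith)
    (by field_simp; ring) (by rw [add_sub_cancel, hψ, e1]; field_simp; ring)
  rw [add_sub_cancel_left, hψ, e2, zero_mul, add_zero, eq_comm, div_mul_eq_mul_div,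
    div_eq_iff h0.ne'] at h1
  nlinarith [hpos u ⟨hu.1, huδ⟩]

/-- The three term recurrence for a Markov kernel. -/
lemma exists_recurrence (h : MarkovKernel ψ b) : ∃ δ > 0, δ ≤ b ∧ (∀ x ∈ Set.Icc 0 δ, 0 < ψ x) ∧
    ∀ s, 0 ≤ s → 2 * s ≤ δ → ∀ x, s ≤ x → x + s ≤ b →
      ψ x * (ψ 0 + ψ (2 * s)) = ψ s * (ψ (x + s) + ψ (x - s)) := by
  obtain ⟨δ, hδ, hδb, hpos⟩ := h.exists_pos_near
  refine ⟨δ, hδ, hδb, hpos, fun s hs hsδ x hsx hxb => ?_⟩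
  rcases hs.eq_or_lt with rfl | hs0
  · simp; ring
  have h1 := hpos (2 * s) ⟨by linarith, hsδ⟩
  have h0 := h.zero_pos
  have hne : ψ 0 + ψ (2 * s) ≠ 0 := by positivity
  -- By symmetry the midpoint of an arc of length 2s has equal regression weights on the two ends;
  -- this α solves both normal equations.
  set α := ψ s / (ψ 0 + ψ (2 * s)) with hα
  have h2 := h.rel s s (x + s) α α hs0 hs0 (by linarith) hxb
    (by rw [← two_mul, hα]; field_simp) (by rw [← two_mul, hα]; field_simp; ring)
  rw [show x + s - s = x by ring] at h2
  rw [h2, hα]; field_simp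

/-- On a closed curve, a kernel which is multiplicative at small distances is flat. -/
lemma flat_of_multiplicative (h : MarkovKernel ψ b) (hb : ψ b = ψ 0)
    (hmul : ∃ ε > 0, ∀ s ∈ Set.Icc 0 ε, ψ (2 * s) * ψ 0 = ψ s ^ 2) :
    ∃ ε > 0, ∀ x ∈ Set.Icc 0 ε, ψ x = ψ 0 := by
  obtain ⟨δ, hδ, hδb, hpos, hrec⟩ := h.exists_recurrence
  obtain ⟨ε, hε, hm⟩ := hmul
  -- The step s = b / N must reach b exactly, so that the closing condition can be read off on the
  -- grid, and be small enough for the recurrence and for hm.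
  obtain ⟨N, hN⟩ := exists_nat_gt (b / min (δ / 2) ε)
  have hmin : 0 < min (δ / 2) ε := lt_min (by linarith) hε
  have hb0 := h.pos
  have hN0 : (0 : ℝ) < N := (div_pos hb0 hmin).trans hN
  set s := b / N with hs
  have hs0 : 0 < s := div_pos hb0 hN0
  have hNs : N * s = b := by rw [hs]; field_simp
  have hsmin : s ≤ min (δ / 2) ε := by
    rw [hs, div_le_iff₀ hN0]; rw [div_lt_iff₀ hmin] at hN; linarith
  have hsδ : 2 * s ≤ δ := by linarith [hsmin.trans (min_le_left _ _)]
  have hsε := hsmin.trans (min_le_right _ _)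
  have h0 := h.zero_pos
  have hψs : 0 < ψ s := hpos s ⟨hs0.le, by linarith⟩
  have h2s := hm s ⟨hs0.le, hsε⟩
  set ρ := ψ s / ψ 0 with hρ
  have hρ0 : 0 < ρ := div_pos hψs h0
  have hψρ : ψ s = ρ * ψ 0 := by rw [hρ]; field_simp
  have h2ρ : ψ (2 * s) = ρ ^ 2 * ψ 0 := by
    rw [hρ]; field_simp; linarith
  -- The recurrence has order two, so two consecutive values are carried along. At n + 1 = N it
  -- gives ρ ^ N = 1.
  have key : ∀ n : ℕ, (n + 1 : ℝ) * s ≤ b →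
      ψ (n * s) = ρ ^ n * ψ 0 ∧ ψ ((n + 1 : ℝ) * s) = ρ ^ (n + 1) * ψ 0 := by
    intro n
    induction n with
    | zero => intro _; simp [hψρ]
    | succ n ih =>
      intro hn
      push_cast at hn ⊢
      have hn0 : (0 : ℝ) ≤ n := n.cast_nonneg
      obtain ⟨i1, i2⟩ := ih (by nlinarith)
      refine ⟨i2, ?_⟩
      have hr := hrec s hs0.le hsδ ((n + 1 : ℝ) * s) (by nlinarith) (by linarith)
      rw [show (n + 1 : ℝ) * s + s = (n + 1 + 1) * s by ring,
        show (n + 1 : ℝ) * s - s = n * s by ring, i1, i2, h2ρ, hψρ] at hr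
      have : ρ * ψ 0 * (ψ ((n + 1 + 1 : ℝ) * s)) = ρ * ψ 0 * (ρ ^ (n + 1 + 1) * ψ 0) := by
        linear_combination -hr
      exact mul_left_cancel₀ (by positivity) this
  obtain ⟨M, rfl⟩ : ∃ M, N = M + 1 := ⟨N - 1, by
    have : 0 < N := by exact_mod_cast hN0
    omega⟩
  push_cast at hNs
  have hM := (key M hNs.le).2
  rw [hNs, hb] at hM
  have hρ1 : ρ ^ (M + 1) = 1 := by
    have : (ρ ^ (M + 1) - 1) * ψ 0 = 0 := by linarith
    rcases mul_eq_zero.1 this with h | h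
    · linarith
    · exact absurd h h0.ne'
  have hρe : ρ = 1 := (pow_eq_one_iff_of_nonneg hρ0.le (Nat.succ_ne_zero M)).1 hρ1
  exact h.flat_of_eq hs0 (hsδ.trans hδb) (by rw [hψρ, hρe, one_mul])

/-- Markov kernels on closed curves of different lengths which agree at small distances are flat. -/
lemma flat_of_length_lt {ψ' : ℝ → ℝ} {b' : ℝ} (h : MarkovKernel ψ b) (h' : MarkovKernel ψ' b')
    (hbb : b < b') (hb : ψ b = ψ 0) (hb' : ∀ x ∈ Set.Icc 0 b', ψ' (b' - x) = ψ' x)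
    (heq : ∃ ε > 0, ∀ x ∈ Set.Icc 0 ε, ψ x = ψ' x) :
    ∃ ε > 0, ∀ x ∈ Set.Icc 0 ε, ψ' x = ψ' 0 := by
  obtain ⟨δ, hδ, hδb, hpos, hrec⟩ := h.exists_recurrence
  obtain ⟨δ', hδ', hδb', hpos', hrec'⟩ := h'.exists_recurrence
  obtain ⟨ε, hε, he⟩ := heq
  have hmin : 0 < min (δ / 2) (min (δ' / 2) (ε / 2)) :=
    lt_min (by linarith) (lt_min (by linarith) (by linarith))
  -- The grid divides the shorter length b. Both kernels obey the same recurrence on it, because its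
  -- coefficients involve only the common values at 0, s and 2s.
  obtain ⟨N, hN⟩ := exists_nat_gt (b / min (δ / 2) (min (δ' / 2) (ε / 2)))
  have hb0 := h.pos
  have hN0 : (0 : ℝ) < N := (div_pos hb0 hmin).trans hN
  set s := b / N with hs
  have hs0 : 0 < s := div_pos hb0 hN0
  have hNs : N * s = b := by rw [hs]; field_simp
  have hsmin : s ≤ min (δ / 2) (min (δ' / 2) (ε / 2)) := by
    rw [hs, div_le_iff₀ hN0]; rw [div_lt_iff₀ hmin] at hN; linarith
  have hsδ : 2 * s ≤ δ := by linarith [hsmin.trans (min_le_left _ _)]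
  have hsδ' : 2 * s ≤ δ' := by
    linarith [(hsmin.trans (min_le_right _ _)).trans (min_le_left _ _)]
  have hsε : 2 * s ≤ ε := by
    linarith [(hsmin.trans (min_le_right _ _)).trans (min_le_right _ _)]
  have hψs : 0 < ψ s := hpos s ⟨hs0.le, by linarith⟩
  have e0 := he 0 ⟨le_rfl, hε.le⟩
  have es := he s ⟨hs0.le, by linarith⟩
  have e2 := he (2 * s) ⟨by linarith, hsε⟩
  have key : ∀ n : ℕ, (n + 1 : ℝ) * s ≤ b →
      ψ' (n * s) = ψ (n * s) ∧ ψ' ((n + 1 : ℝ) * s) = ψ ((n + 1 : ℝ) * s) := by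
    intro n
    induction n with
    | zero => intro _; simp [e0, es]
    | succ n ih =>
      intro hn
      push_cast at hn ⊢
      have hn0 : (0 : ℝ) ≤ n := n.cast_nonneg
      obtain ⟨i1, i2⟩ := ih (by nlinarith)
      refine ⟨i2, ?_⟩
      have hr := hrec s hs0.le hsδ ((n + 1 : ℝ) * s) (by nlinarith) (by linarith)
      have hr' := hrec' s hs0.le hsδ' ((n + 1 : ℝ) * s) (by nlinarith) (by linarith)
      rw [show (n + 1 : ℝ) * s + s = (n + 1 + 1) * s by ring,
        show (n + 1 : ℝ) * s - s = n * s by ring] at hr hr'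
      rw [i1, i2, ← e0, ← es, ← e2, hr] at hr'
      linarith [mul_left_cancel₀ hψs.ne' hr']
  obtain ⟨M, rfl⟩ : ∃ M, N = M + 1 := ⟨N - 1, by
    have : 0 < N := by exact_mod_cast hN0
    omega⟩
  push_cast at hNs
  have hM := (key M hNs.le).2
  rw [hNs, hb, e0] at hM
  -- `flat_of_eq` needs a distance of at most b' / 2: either b or its mirror image b' - b qualifies.
  rcases le_total (2 * b) b' with hc | hc
  · exact h'.flat_of_eq hb0 hc hM
  · exact h'.flat_of_eq (p := b' - b) (by linarith) (by linarith)
      (by rw [hb' b ⟨hb0.le, hbb.le⟩, hM])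

/-- A Markov kernel satisfies a linear differential equation of second order. -/
lemma exists_ode (h : MarkovKernel ψ b) {x₁ : ℝ} (hx₁ : 0 < x₁) : ∃ (m : ℝ) (D : ℝ → ℝ),
    ∀ x ∈ Set.Ioo x₁ (b - x₁), HasDerivAt ψ (D x) x ∧ HasDerivAt D (m * ψ x) x := by
  obtain ⟨δ, hδ, hδb, hpos, hrec⟩ := h.exists_recurrence
  -- Integrating the recurrence over s in [0, η] expresses φ x as a constant times its integral over
  -- [x - η, x + η], so continuity improves to differentiability. The second derivative involves x ±
  -- 2η and the recurrence with step 2η, hence the bounds δ / 4 and x₁ / 2.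
  set η := min (δ / 4) (x₁ / 2) with hη
  have hη0 : 0 < η := lt_min (by linarith) (by linarith)
  have hηδ : 4 * η ≤ δ := by linarith [min_le_left (δ / 4) (x₁ / 2)]
  have hηx : 2 * η ≤ x₁ := by linarith [min_le_right (δ / 4) (x₁ / 2)]
  -- The extension by constants is continuous on the whole line, so its primitive P is
  -- differentiable everywhere.
  set φ : ℝ → ℝ := Set.IccExtend h.pos.le (Set.domRestrict (Set.Icc 0 b) ψ) with hφ
  have hφc : Continuous φ := (continuousOn_iff_continuous_domRestrict.1 h.cont).Icc_extend'
  have hφψ : ∀ x ∈ Set.Icc 0 b, φ x = ψ x := fun x hx => by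
    rw [hφ, Set.IccExtend_of_mem _ _ hx]; rfl
  set c : ℝ → ℝ := fun s => (φ 0 + φ (2 * s)) / φ s with hc
  have hφpos : ∀ s ∈ Set.Icc 0 δ, 0 < φ s := fun s hs => by
    rw [hφψ s ⟨hs.1, hs.2.trans hδb⟩]; exact hpos s hs
  have hcc : ContinuousOn c (Set.Icc 0 η) := by
    refine ContinuousOn.div (by fun_prop) hφc.continuousOn fun s hs => ?_
    exact (hφpos s ⟨hs.1, by linarith [hs.2]⟩).ne'
  have hcpos : ∀ s ∈ Set.Icc 0 η, 0 < c s := fun s hs => div_pos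
    (add_pos (hφpos 0 ⟨le_rfl, hδ.le⟩) (hφpos _ ⟨by linarith [hs.1], by linarith [hs.2]⟩))
    (hφpos s ⟨hs.1, by linarith [hs.2]⟩)
  have hrec' : ∀ s, 0 ≤ s → 2 * s ≤ δ → ∀ x, s ≤ x → x + s ≤ b →
      φ (x + s) + φ (x - s) = c s * φ x := by
    intro s hs hsδ x hsx hxb
    have hp := hφpos s ⟨hs, by linarith⟩
    have := hrec s hs hsδ x hsx hxb
    rw [hc]
    simp only
    rw [hφψ 0 ⟨le_rfl, h.pos.le⟩, hφψ (2 * s) ⟨by linarith, by linarith⟩,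
      hφψ x ⟨by linarith, by linarith⟩, hφψ (x + s) ⟨by linarith, by linarith⟩,
      hφψ (x - s) ⟨by linarith, by linarith⟩]
    rw [hφψ s ⟨hs, by linarith⟩] at hp ⊢
    rw [div_mul_eq_mul_div, eq_div_iff hp.ne']
    linear_combination -this
  set C := ∫ s in (0 : ℝ)..η, c s with hC
  have hC0 : 0 < C := by
    refine intervalIntegral.intervalIntegral_pos_of_pos_on ?_ (fun s hs => hcpos s ⟨hs.1.le, hs.2.le⟩)
      hη0
    exact ContinuousOn.intervalIntegrable (by rwa [Set.uIcc_of_le hη0.le])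
  set P : ℝ → ℝ := fun x => ∫ y in (0 : ℝ)..x, φ y with hP
  have hPd : ∀ x, HasDerivAt P (φ x) x := fun x =>
    intervalIntegral.integral_hasDerivAt_right (hφc.intervalIntegrable _ _)
      hφc.stronglyMeasurable.stronglyMeasurableAtFilter hφc.continuousAt
  have hint : ∀ x, η ≤ x → x + η ≤ b → φ x = (P (x + η) - P (x - η)) / C := by
    intro x hx1 hx2
    rw [eq_div_iff hC0.ne', hC, mul_comm, ← intervalIntegral.integral_mul_const]
    have : ∫ s in (0 : ℝ)..η, c s * φ x = ∫ s in (0 : ℝ)..η, (φ (x + s) + φ (x - s)) := by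
      refine intervalIntegral.integral_congr fun s hs => ?_
      rw [Set.uIcc_of_le hη0.le] at hs
      exact (hrec' s hs.1 (by linarith [hs.2]) x (by linarith [hs.2]) (by linarith [hs.2])).symm
    rw [this, intervalIntegral.integral_add, intervalIntegral.integral_comp_add_left,
      intervalIntegral.integral_comp_sub_left, add_zero, sub_zero, hP]
    · simp only
      rw [add_comm, intervalIntegral.integral_add_adjacent_intervals,
        ← intervalIntegral.integral_add_adjacent_intervals (a := 0) (b := x - η) (c := x + η)]
      · ring
      all_goals exact hφc.intervalIntegrable _ _
    all_goals exact (Continuous.intervalIntegrable (by fun_prop) _ _)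
  have hd1 : ∀ x ∈ Set.Ioo η (b - η), HasDerivAt φ ((φ (x + η) - φ (x - η)) / C) x := by
    intro x hx
    have h1 : HasDerivAt (fun x => (P (x + η) - P (x - η)) / C)
        ((φ (x + η) - φ (x - η)) / C) x :=
      (((hPd (x + η)).comp_add_const x η).sub ((hPd (x - η)).comp_sub_const x η)).div_const C
    refine h1.congr_of_eventuallyEq ?_
    filter_upwards [Ioo_mem_nhds hx.1 hx.2] with y hy
    exact hint y hy.1.le (by linarith [hy.2])
  -- Applying the derivative formula twice gives C² φ''(x) = φ(x + 2η) - 2φ(x) + φ(x - 2η) = (c(2η)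
  -- - 2) φ(x).
  refine ⟨(c (2 * η) - 2) / C ^ 2, fun x => (φ (x + η) - φ (x - η)) / C, fun x hx => ⟨?_, ?_⟩⟩
  · refine (hd1 x ⟨by linarith [hx.1], by linarith [hx.2]⟩).congr_of_eventuallyEq ?_
    filter_upwards [Ioo_mem_nhds hx.1 hx.2] with y hy
    exact (hφψ y ⟨by linarith [hy.1], by linarith [hy.2]⟩).symm
  · have h1 := hd1 (x + η) ⟨by linarith [hx.1], by linarith [hx.2]⟩
    have h2 := hd1 (x - η) ⟨by linarith [hx.1], by linarith [hx.2]⟩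
    have h3 := ((h1.comp_add_const x η).sub (h2.comp_sub_const x η)).div_const C
    refine h3.congr_deriv ?_
    have hr := hrec' (2 * η) (by linarith) (by linarith) x (by linarith [hx.1]) (by linarith [hx.2])
    rw [← hφψ x ⟨by linarith [hx.1], by linarith [hx.2]⟩,
      show x + η + η = x + 2 * η by ring, show x - η - η = x - 2 * η by ring,
      show x + η - η = x by ring, show x - η + η = x by ring]
    field_simp
    linear_combination hr

/-- The differential equation after the substitution `x = s - K * s ^ 2`. -/
lemma exists_ode_subst (h : MarkovKernel ψ b) {K : ℝ} (hK : 0 ≤ K) {f : ℝ → ℝ}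
    (hf : ∀ s ∈ Set.Icc 0 b, ψ s = f (s - K * s ^ 2)) :
    ∃ x₂ > 0, ∀ x₁ > 0, ∃ (m : ℝ) (F F' : ℝ → ℝ), ∀ x ∈ Set.Ioo x₁ x₂,
      HasDerivAt f (F x) x ∧ HasDerivAt F (F' x) x ∧
        (1 - 4 * K * x) * F' x = m * f x + 2 * K * F x := by
  have hb := h.pos
  -- The second bound keeps 1 - 4Kx positive; the first keeps the preimage η x ≤ 2x of x below b /
  -- 2.
  refine ⟨min (b / 4) (1 / (4 * (K + 1))), lt_min (by linarith) (by positivity), fun x₁ hx₁ => ?_⟩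
  obtain ⟨m, D, hD⟩ := h.exists_ode (x₁ := min x₁ (b / 2)) (lt_min hx₁ (by linarith))
  set σ : ℝ → ℝ := fun x => √(1 - 4 * K * x) with hσ
  -- The root of s - K s² = x that vanishes at x = 0, rationalized so that K = 0 needs no separate
  -- case.
  set η : ℝ → ℝ := fun x => 2 * x / (1 + σ x) with hη
  have hx_lt : ∀ x, x < min (b / 4) (1 / (4 * (K + 1))) → 0 < x → 0 < 1 - 4 * K * x := by
    intro x hx hx0
    have := hx.trans_le (min_le_right _ _)
    rw [lt_div_iff₀ (by positivity)] at this
    nlinarith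
  have hσ2 : ∀ x, 0 < 1 - 4 * K * x → σ x ^ 2 = 1 - 4 * K * x := fun x hx => Real.sq_sqrt hx.le
  have hσpos : ∀ x, 0 < 1 - 4 * K * x → 0 < σ x := fun x hx => Real.sqrt_pos.2 hx
  have hσd : ∀ x, 0 < 1 - 4 * K * x → HasDerivAt σ (-2 * K / σ x) x := by
    intro x hx
    have h1 : HasDerivAt (fun x => 1 - 4 * K * x) (-(4 * K * 1)) x :=
      ((hasDerivAt_id x).const_mul (4 * K)).const_sub 1
    have h2 := h1.sqrt hx.ne'
    refine h2.congr_deriv ?_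
    have hp : 0 < √(1 - 4 * K * x) := hσpos x hx
    simp only [hσ]
    field_simp
    ring
  have hηd : ∀ x, 0 < 1 - 4 * K * x → HasDerivAt η (1 / σ x) x := by
    intro x hx
    have hp := hσpos x hx
    have h1 := ((hasDerivAt_id x).const_mul 2).div ((hσd x hx).const_add 1) (by positivity)
    refine h1.congr_deriv ?_
    have h2 := hσ2 x hx
    simp only [id]
    field_simp
    linear_combination h2
  have hηx : ∀ x, 0 < 1 - 4 * K * x → η x - K * η x ^ 2 = x := by
    intro x hx
    have hp := hσpos x hx
    have h2 := hσ2 x hx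
    simp only [hη]
    field_simp
    linear_combination (-x) * h2
  have hηlow : ∀ x, 0 < x → 0 < 1 - 4 * K * x → x ≤ η x := by
    intro x hx0 hx
    have hp := hσpos x hx
    have h2 := hσ2 x hx
    have h3 : σ x ≤ 1 := by nlinarith [mul_nonneg hK hx0.le]
    simp only [hη]
    rw [le_div_iff₀ (by positivity)]
    nlinarith
  have hηup : ∀ x, 0 < x → 0 < 1 - 4 * K * x → η x ≤ 2 * x := by
    intro x hx0 hx
    have hp := hσpos x hx
    simp only [hη]
    rw [div_le_iff₀ (by positivity)]
    nlinarith
  have hηmem : ∀ x ∈ Set.Ioo x₁ (min (b / 4) (1 / (4 * (K + 1)))),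
      η x ∈ Set.Ioo (min x₁ (b / 2)) (b - min x₁ (b / 2)) := by
    intro x hx
    have hx0 : 0 < x := hx₁.trans hx.1
    have hx' := hx_lt x hx.2 hx0
    have := hηlow x hx0 hx'
    have := hηup x hx0 hx'
    have := hx.2.trans_le (min_le_left _ _)
    have := min_le_left x₁ (b / 2)
    have := min_le_right x₁ (b / 2)
    exact ⟨by linarith [hx.1], by linarith⟩
  have hfψ : ∀ x ∈ Set.Ioo x₁ (min (b / 4) (1 / (4 * (K + 1)))), f x = ψ (η x) := by
    intro x hx
    have hx0 : 0 < x := hx₁.trans hx.1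
    have hx' := hx_lt x hx.2 hx0
    have hm := hηmem x hx
    have hmin : 0 < min x₁ (b / 2) := lt_min hx₁ (by linarith)
    rw [hf _ ⟨by linarith [hm.1], by linarith [hm.2]⟩, hηx x hx']
  refine ⟨m, fun x => D (η x) * (1 / σ x),
    fun x => m * ψ (η x) * (1 / σ x) * (1 / σ x) + D (η x) * (2 * K / σ x ^ 3), fun x hx => ?_⟩
  have hx0 : 0 < x := hx₁.trans hx.1
  have hx' := hx_lt x hx.2 hx0
  have hp := hσpos x hx'
  obtain ⟨d1, d2⟩ := hD (η x) (hηmem x hx)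
  refine ⟨?_, ?_, ?_⟩
  · refine (d1.comp x (hηd x hx')).congr_of_eventuallyEq ?_
    filter_upwards [Ioo_mem_nhds hx.1 hx.2] with y hy
    exact hfψ y hy
  · have h1 := (d2.comp x (hηd x hx')).mul ((hσd x hx').inv hp.ne')
    have e : (fun x => D (η x) * (1 / σ x)) = D ∘ η * σ⁻¹ := by
      ext y; simp
    rw [e]
    refine h1.congr_deriv ?_
    simp only [Function.comp_apply, Pi.inv_apply]
    field_simp
  · rw [← hσ2 x hx', hfψ x hx]
    field_simp

/-- Markov kernels along two curves on which the metric has different curvature constants are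
flat. -/
lemma flat_of_ne {ψ' : ℝ → ℝ} {b' : ℝ} (h : MarkovKernel ψ b) (h' : MarkovKernel ψ' b')
    {K K' : ℝ} (hK : 0 ≤ K) (hK' : 0 ≤ K') (hne : K ≠ K') {f : ℝ → ℝ}
    (hfc : ContinuousOn f (Set.Ici 0))
    (hf : ∀ s ∈ Set.Icc 0 b, ψ s = f (s - K * s ^ 2))
    (hf' : ∀ s ∈ Set.Icc 0 b', ψ' s = f (s - K' * s ^ 2)) :
    ∃ ε > 0, ∀ x ∈ Set.Icc 0 ε, f x = f 0 := by
  obtain ⟨z, hz, H⟩ := h.exists_ode_subst hK hf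
  obtain ⟨z', hz', H'⟩ := h'.exists_ode_subst hK' hf'
  have hf0 : 0 < f 0 := by
    have := hf 0 ⟨le_rfl, h.pos.le⟩
    rw [show (0 : ℝ) - K * 0 ^ 2 = 0 by ring] at this
    rw [← this]; exact h.zero_pos
  obtain ⟨ε, hε, hfpos⟩ : ∃ ε > 0, ∀ x ∈ Set.Ico 0 ε, 0 < f x := by
    have h2 := (hfc 0 Set.self_mem_Ici).eventually (lt_mem_nhds hf0)
    obtain ⟨ε, hε, hb⟩ := Metric.mem_nhdsWithin_iff.1 h2
    refine ⟨ε, hε, fun x hx => hb ⟨?_, hx.1⟩⟩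
    rw [Metric.mem_ball, Real.dist_eq, sub_zero, abs_of_nonneg hx.1]
    exact hx.2
  set y := min ε (min z z') with hy
  have hy0 : 0 < y := lt_min hε (lt_min hz hz')
  have hyε : y ≤ ε := min_le_left _ _
  have hyz : y ≤ z := (min_le_right _ _).trans (min_le_left _ _)
  have hyz' : y ≤ z' := (min_le_right _ _).trans (min_le_right _ _)
  have hder : ∀ x ∈ Set.Ioo 0 y, HasDerivAt f 0 x := by
    intro x₀ hx₀
    obtain ⟨m, F, F1, hF⟩ := H (x₀ / 2) (by linarith [hx₀.1])
    obtain ⟨m', G, G1, hG⟩ := H' (x₀ / 2) (by linarith [hx₀.1])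
    have hFG : ∀ x ∈ Set.Ioo (x₀ / 2) y, F x = G x := fun x hx =>
      (hF x ⟨hx.1, hx.2.trans_le hyz⟩).1.unique (hG x ⟨hx.1, hx.2.trans_le hyz'⟩).1
    have hFG1 : ∀ x ∈ Set.Ioo (x₀ / 2) y, F1 x = G1 x := by
      intro x hx
      refine (hF x ⟨hx.1, hx.2.trans_le hyz⟩).2.1.unique ?_
      refine (hG x ⟨hx.1, hx.2.trans_le hyz'⟩).2.1.congr_of_eventuallyEq ?_
      filter_upwards [Ioo_mem_nhds hx.1 hx.2] with w hw using hFG w hw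
    -- Elimination between the two equations gives 4x f'' + 2f' = -c f and f'' = M f, hence f' =
    -- -(c/2 + 2Mx) f. Differentiating this and cancelling f > 0 makes (c/2 + 2Mx)² equal to 3M on
    -- an interval, so M = 0 and then c = 0.
    set c := (m' - m) / (K' - K) with hc
    have hKK : K' - K ≠ 0 := sub_ne_zero.2 hne.symm
    have hcK : c * (K' - K) = m' - m := by rw [hc]; field_simp
    have e1 : ∀ x ∈ Set.Ioo (x₀ / 2) y, 4 * x * F1 x + 2 * F x = -c * f x := by
      intro x hx
      have h1 := (hF x ⟨hx.1, hx.2.trans_le hyz⟩).2.2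
      have h2 := (hG x ⟨hx.1, hx.2.trans_le hyz'⟩).2.2
      rw [← hFG x hx, ← hFG1 x hx] at h2
      refine mul_left_cancel₀ hKK ?_
      linear_combination h1 - h2 + f x * hcK
    set M := m - K * c with hM
    have e2 : ∀ x ∈ Set.Ioo (x₀ / 2) y, F1 x = M * f x := by
      intro x hx
      have h1 := (hF x ⟨hx.1, hx.2.trans_le hyz⟩).2.2
      rw [hM]
      linear_combination h1 + K * e1 x hx
    have e3 : ∀ x ∈ Set.Ioo (x₀ / 2) y, F x = -(c / 2 + 2 * M * x) * f x := by
      intro x hx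
      linear_combination (e1 x hx - 4 * x * e2 x hx) / 2
    have e4 : ∀ x ∈ Set.Ioo (x₀ / 2) y, (c / 2 + 2 * M * x) ^ 2 = 3 * M := by
      intro x hx
      have h1 : HasDerivAt (fun x => -(c / 2 + 2 * M * x) * f x)
          (-(2 * M * 1) * f x + -(c / 2 + 2 * M * x) * F x) x :=
        ((((hasDerivAt_id x).const_mul (2 * M)).const_add (c / 2)).neg).mul
          (hF x ⟨hx.1, hx.2.trans_le hyz⟩).1
      have h2 : HasDerivAt F (-(2 * M * 1) * f x + -(c / 2 + 2 * M * x) * F x) x := by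
        refine h1.congr_of_eventuallyEq ?_
        filter_upwards [Ioo_mem_nhds hx.1 hx.2] with w hw using e3 w hw
      have h3 := (hF x ⟨hx.1, hx.2.trans_le hyz⟩).2.1.unique h2
      rw [e2 x hx, e3 x hx] at h3
      have hfx : f x ≠ 0 :=
        (hfpos x ⟨by linarith [hx.1, hx₀.1], hx.2.trans_le hyε⟩).ne'
      refine mul_right_cancel₀ hfx ?_
      linear_combination -h3
    have hM0 : M = 0 := by
      set d := (y - x₀) / 2 with hd
      have hd0 : 0 < d := by rw [hd]; linarith [hx₀.2]
      have a0 := e4 x₀ ⟨by linarith [hx₀.1], hx₀.2⟩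
      have a1 := e4 (x₀ + d) ⟨by linarith [hx₀.1], by rw [hd]; linarith [hx₀.2]⟩
      have a2 := e4 (x₀ + d / 2) ⟨by linarith [hx₀.1], by rw [hd]; linarith [hx₀.2]⟩
      -- Second difference of the squared affine function at x₀, x₀ + d/2 and x₀ + d.
      have h2 : M ^ 2 * d ^ 2 = 0 := by linear_combination a0 / 2 + a1 / 2 - a2
      rcases mul_eq_zero.1 h2 with h3 | h3
      · exact pow_eq_zero_iff two_ne_zero |>.1 h3
      · exact absurd (pow_eq_zero_iff two_ne_zero |>.1 h3) hd0.ne'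
    have hx₀' : x₀ ∈ Set.Ioo (x₀ / 2) y := ⟨by linarith [hx₀.1], hx₀.2⟩
    have hF0 : F x₀ = 0 := by
      have a0 := e4 x₀ hx₀'
      rw [hM0] at a0
      have : c / 2 + 2 * 0 * x₀ = 0 := pow_eq_zero_iff two_ne_zero |>.1 (by linarith)
      rw [e3 x₀ hx₀', hM0, this]; ring
    rw [← hF0]
    exact (hF x₀ ⟨hx₀'.1, hx₀.2.trans_le hyz⟩).1
  refine ⟨y / 2, by linarith, fun x hx => ?_⟩
  rcases hx.1.eq_or_lt with rfl | hx0
  · rfl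
  obtain ⟨w, _, hw⟩ := exists_hasDerivAt_eq_slope f (fun _ => 0) hx0
    (hfc.mono fun w hw => hw.1) fun w hw => hder w ⟨hw.1, by linarith [hw.2, hx.2]⟩
  rw [eq_comm, div_eq_zero_iff] at hw
  rcases hw with hw | hw <;> linarith

end MarkovKernel

/-! ### Edges of a metric graph -/

namespace MetricGraph

variable {Γ : Type*} [MetricSpace Γ] (G : MetricGraph Γ)

lemma dist_curve_le (e : Fin G.numEdges) {a b : ℝ} (ha : a ∈ Set.Icc 0 (G.len e))
    (hb : b ∈ Set.Icc 0 (G.len e)) : dist (G.curve e a) (G.curve e b) ≤ |a - b| := by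
  have := PathLength.step (len := G.len) (curve := G.curve) e a b ha hb _ 0 (.refl _)
  rw [add_zero] at this
  exact (G.geodesic _ _).2 this

/-- The upper bounds for the three subarcs add up to the distance of the ends of the edge, so none
of them can be strict. -/
lemma HasEuclideanEdges.dist_curve {G : MetricGraph Γ} (hG : G.HasEuclideanEdges)
    (e : Fin G.numEdges) {a b : ℝ} (ha : a ∈ Set.Icc 0 (G.len e)) (hb : b ∈ Set.Icc 0 (G.len e)) :
    dist (G.curve e a) (G.curve e b) = |a - b| := by
  refine le_antisymm (G.dist_curve_le e ha hb) ?_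
  wlog hab : a ≤ b generalizing a b
  · rw [dist_comm, abs_sub_comm]; exact this hb ha (le_of_not_ge hab)
  have hl := (G.len_pos e).le
  have h1 := G.dist_curve_le e ⟨le_rfl, hl⟩ ha
  have h2 := G.dist_curve_le e hb ⟨hl, le_rfl⟩
  have h3 := hG.dist_eq_len e
  have h4 := dist_triangle4 (G.curve e 0) (G.curve e a) (G.curve e b) (G.curve e (G.len e))
  rw [src, tgt] at h3
  rw [abs_of_nonpos (by linarith [ha.1])] at h1
  rw [abs_of_nonpos (by linarith [hb.2])] at h2
  rw [abs_of_nonpos (by linarith)]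
  linarith

lemma continuousOn_curve (e : Fin G.numEdges) :
    ContinuousOn (G.curve e) (Set.Icc 0 (G.len e)) := by
  refine LipschitzOnWith.continuousOn (K := 1) (LipschitzOnWith.of_dist_le_mul fun x hx y hy => ?_)
  rw [NNReal.coe_one, one_mul, Real.dist_eq]
  exact G.dist_curve_le e hx hy

lemma HasEuclideanEdges.injOn_curve {G : MetricGraph Γ} (hG : G.HasEuclideanEdges)
    (e : Fin G.numEdges) : Set.InjOn (G.curve e) (Set.Icc 0 (G.len e)) := fun x hx y hy h => by
  have := hG.dist_curve e hx hy
  rw [h, dist_self, eq_comm, abs_eq_zero, sub_eq_zero] at this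
  exact this

/-- The edge `e` without its end points. -/
def openEdge (e : Fin G.numEdges) : Set Γ := G.curve e '' Set.Ioo 0 (G.len e)

lemma openEdge_subset (e : Fin G.numEdges) : G.openEdge e ⊆ G.edgeSet e :=
  Set.image_mono Set.Ioo_subset_Icc_self

lemma isCompact_edgeSet (e : Fin G.numEdges) : IsCompact (G.edgeSet e) :=
  isCompact_Icc.image_of_continuousOn (G.continuousOn_curve e)

lemma notMem_vertices_of_mem_openEdge {e : Fin G.numEdges} {x : Γ} (hx : x ∈ G.openEdge e) :
    x ∉ G.vertices := by
  obtain ⟨t, ht, rfl⟩ := hx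
  exact G.curve_interior e t ht

lemma mem_openEdge_of_mem_edgeSet {e : Fin G.numEdges} {x : Γ} (hx : x ∈ G.edgeSet e)
    (hv : x ∉ G.vertices) : x ∈ G.openEdge e := by
  obtain ⟨t, ht, rfl⟩ := hx
  rcases ht.1.eq_or_lt with rfl | h0
  · exact absurd (G.curve_zero_mem e) hv
  rcases ht.2.eq_or_lt with rfl | h1
  · exact absurd (G.curve_len_mem e) hv
  exact ⟨t, ⟨h0, h1⟩, rfl⟩

lemma eq_of_mem_openEdge {e e' : Fin G.numEdges} {x : Γ} (hx : x ∈ G.openEdge e)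
    (hx' : x ∈ G.openEdge e') : e = e' := by
  obtain ⟨t, ht, rfl⟩ := hx
  obtain ⟨t', ht', h⟩ := hx'
  exact (G.curve_inj e e' t ht t' ht' h.symm).1

lemma eq_of_mem_openEdge_edgeSet {e e' : Fin G.numEdges} {x : Γ} (hx : x ∈ G.openEdge e)
    (hx' : x ∈ G.edgeSet e') : e = e' :=
  G.eq_of_mem_openEdge hx
    (G.mem_openEdge_of_mem_edgeSet hx' (G.notMem_vertices_of_mem_openEdge hx))

lemma exists_mem_openEdge {x : Γ} (hx : x ∉ G.vertices) : ∃ e, x ∈ G.openEdge e := by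
  rcases G.cover x with h | ⟨e, t, ht, rfl⟩
  · exact absurd h hx
  · exact ⟨e, t, ht, rfl⟩

/-- The complement consists of finitely many vertices and finitely many compact edges. -/
lemma isOpen_openEdge (e : Fin G.numEdges) : IsOpen (G.openEdge e) := by
  rw [← isClosed_compl_iff]
  have h : (G.openEdge e)ᶜ = (G.vertices : Set Γ) ∪ ⋃ e' ∈ {e' | e' ≠ e}, G.edgeSet e' := by
    ext x
    simp only [Set.mem_compl_iff, Set.mem_union, Finset.mem_coe, Set.mem_iUnion, exists_prop,
      Set.mem_ofPred_eq]
    constructor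
    · intro hx
      by_cases hv : x ∈ G.vertices
      · exact Or.inl hv
      obtain ⟨e', he'⟩ := G.exists_mem_openEdge hv
      exact Or.inr ⟨e', fun h => hx (h ▸ he'), G.openEdge_subset e' he'⟩
    · rintro (hx | ⟨e', hne, hx⟩) h
      · exact G.notMem_vertices_of_mem_openEdge h hx
      · exact hne (G.eq_of_mem_openEdge_edgeSet h hx).symm
  rw [h]
  exact G.vertices.finite_toSet.isClosed.union
    ((Set.toFinite _).isClosed_biUnion fun e' _ => (G.isCompact_edgeSet e').isClosed)

/-- A function which is constant on every edge is constant. -/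
lemma eq_of_forall_edge {α : Type*} {F : Γ → α} (h : ∀ e, ∀ a ∈ Set.Icc 0 (G.len e),
    ∀ b ∈ Set.Icc 0 (G.len e), F (G.curve e a) = F (G.curve e b)) (x y : Γ) : F x = F y := by
  have key : ∀ {x y : Γ} {L : ℝ}, PathLength G.len G.curve x y L → F x = F y := by
    intro x y L hL
    induction hL with
    | refl x => rfl
    | step e a b ha hb z L _ ih => rw [h e a ha b hb, ih]
  exact key (G.geodesic x y).1

variable {G}

/-- On a Euclidean edge the distance to the source is the parameter, so the arc is the open edge
intersected with the preimage of an interval. -/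
lemma HasEuclideanEdges.isOpen_arc (hG : G.HasEuclideanEdges) (e : Fin G.numEdges) {y z : ℝ}
    (hy : 0 ≤ y) (hz : z ≤ G.len e) : IsOpen (G.curve e '' Set.Ioo y z) := by
  have hl := (G.len_pos e).le
  have : G.curve e '' Set.Ioo y z
      = G.openEdge e ∩ (fun x => dist x (G.src e)) ⁻¹' Set.Ioo y z := by
    have hd : ∀ t ∈ Set.Icc 0 (G.len e), dist (G.curve e t) (G.src e) = t := fun t ht => by
      rw [src, hG.dist_curve e ht ⟨le_rfl, hl⟩, sub_zero, abs_of_nonneg ht.1]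
    ext x
    constructor
    · rintro ⟨t, ht, rfl⟩
      refine ⟨⟨t, ⟨hy.trans_lt ht.1, ht.2.trans_le hz⟩, rfl⟩, ?_⟩
      rwa [Set.mem_preimage, hd t ⟨(hy.trans_lt ht.1).le, (ht.2.trans_le hz).le⟩]
    · rintro ⟨⟨t, ht, rfl⟩, h⟩
      rw [Set.mem_preimage, hd t ⟨ht.1.le, ht.2.le⟩] at h
      exact ⟨t, h, rfl⟩
  rw [this]
  exact (G.isOpen_openEdge e).inter (isOpen_Ioo.preimage (by fun_prop))

lemma closure_arc (e : Fin G.numEdges) {y z : ℝ} (hy : 0 ≤ y) (hyz : y < z) (hz : z ≤ G.len e) :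
    closure (G.curve e '' Set.Ioo y z) = G.curve e '' Set.Icc y z := by
  have hsub : Set.Icc y z ⊆ Set.Icc 0 (G.len e) := Set.Icc_subset_Icc hy hz
  have hc := (G.continuousOn_curve e).mono hsub
  refine Set.Subset.antisymm ?_ ?_
  · exact closure_minimal (Set.image_mono Set.Ioo_subset_Icc_self)
      (isCompact_Icc.image_of_continuousOn hc).isClosed
  · rw [← closure_Ioo hyz.ne] at hc ⊢
    exact hc.image_closure

lemma HasEuclideanEdges.frontier_arc (hG : G.HasEuclideanEdges) (e : Fin G.numEdges) {y z : ℝ}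
    (hy : 0 ≤ y) (hyz : y < z) (hz : z ≤ G.len e) :
    frontier (G.curve e '' Set.Ioo y z) = {G.curve e y, G.curve e z} := by
  have hsub : Set.Icc y z ⊆ Set.Icc 0 (G.len e) := Set.Icc_subset_Icc hy hz
  rw [frontier, closure_arc e hy hyz hz, (hG.isOpen_arc e hy hz).interior_eq,
    ← ((hG.injOn_curve e).mono hsub).image_sdiff_subset Set.Ioo_subset_Icc_self,
    Set.Icc_sdiff_Ioo_same hyz.le, Set.image_pair]

/-- A function which is locally constant along an open edge and continuous on the closed edge is
constant on the edge. -/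
lemma eq_on_edge {α : Type*} [TopologicalSpace α] [T2Space α] {F : Γ → α} (e : Fin G.numEdges)
    (hF : ContinuousOn F (G.edgeSet e))
    (h : ∀ x ∈ Set.Ioo 0 (G.len e), ∀ᶠ y in 𝓝[Set.Ioo 0 (G.len e)] x,
      F (G.curve e y) = F (G.curve e x)) {a b : ℝ} (ha : a ∈ Set.Icc 0 (G.len e))
    (hb : b ∈ Set.Icc 0 (G.len e)) : F (G.curve e a) = F (G.curve e b) := by
  have h1 : ∀ x ∈ Set.Ioo 0 (G.len e), ∀ y ∈ Set.Ioo 0 (G.len e),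
      F (G.curve e x) = F (G.curve e y) := fun x hx y hy =>
    isPreconnected_Ioo.induction₂ (fun x y => F (G.curve e x) = F (G.curve e y))
      (fun x hx => (h x hx).mono fun y hy => hy.symm) (fun _ _ _ _ _ _ => Eq.trans)
      (fun _ _ _ _ => Eq.symm) hx hy
  have hl := G.len_pos e
  have hm : G.len e / 2 ∈ Set.Ioo 0 (G.len e) := ⟨by linarith, by linarith⟩
  have h2 : Set.EqOn (F ∘ G.curve e) (fun _ => F (G.curve e (G.len e / 2)))
      (Set.Icc 0 (G.len e)) :=
    Set.EqOn.of_subset_closure (fun x hx => h1 x hx _ hm)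
      (hF.comp (G.continuousOn_curve e) (Set.mapsTo_image _ _)) continuousOn_const
      Set.Ioo_subset_Icc_self (by rw [closure_Ioo hl.ne])
  exact (h2 ha).trans (h2 hb).symm

end MetricGraph

/-! ### Covariances along an edge, and constancy of flat covariances -/

section Field

variable {Γ : Type*} [MetricSpace Γ] {Ω : Type*} [MeasurableSpace Ω] {μ : Measure Ω}
  [IsProbabilityMeasure μ] {X : Γ → Ω → ℝ}

/-- The covariance along a curve whose arcs are cut out by open sets is a Markov kernel. -/
lemma IsMarkovOrderOne.markovKernel (hM : IsMarkovOrderOne μ X)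
    (hX : IsGaussianProcess X μ) (hXm : ∀ s, Measurable (X s)) {γ ψ : ℝ → _} {b : ℝ} (hb : 0 < b)
    (hγ : ContinuousOn γ (Set.Icc 0 b))
    (hcov : ∀ x ∈ Set.Icc 0 b, ∀ y ∈ Set.Icc 0 b, cov[X (γ x), X (γ y); μ] = ψ |x - y|)
    (h0 : 0 < ψ 0)
    (hS : ∀ w t, 0 < w → w ≤ t → t ≤ b → ∃ S, IsOpen S ∧ frontier S = {γ 0, γ w} ∧ γ t ∉ S ∧
      ∀ u ∈ Set.Ioo 0 w, γ u ∈ S) : MarkovKernel ψ b where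
  pos := hb
  zero_pos := h0
  cont := by
    have h := (hM.continuous_cov hX (γ 0)).comp_continuousOn hγ
    refine h.congr fun x hx => ?_
    rw [Function.comp_apply, hcov x hx 0 ⟨le_rfl, hb.le⟩, sub_zero, abs_of_nonneg hx.1]
  perfect := by
    intro p hp hψ x hx
    have hz : (0 : ℝ) ∈ Set.Icc 0 b := ⟨le_rfl, hb.le⟩
    have h1 := cov_eq_of_perfect hX (a := γ 0) (b := γ p)
      (by rw [hcov _ hz _ hz, hcov _ hz _ hp, sub_self, abs_zero, zero_sub, abs_neg,
            abs_of_nonneg hp.1, hψ])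
      (by rw [hcov _ hp _ hp, hcov _ hz _ hp, sub_self, abs_zero, zero_sub, abs_neg,
            abs_of_nonneg hp.1, hψ]) (γ x)
    rw [hcov _ hz _ hx, hcov _ hp _ hx, zero_sub, abs_neg, abs_of_nonneg hx.1, abs_sub_comm] at h1
    exact h1.symm
  rel := by
    intro u v t α β hu hv ht htb h1 h2
    obtain ⟨S, hSo, hSf, htS, huS⟩ := hS (u + v) t (by linarith) ht htb
    have mz : (0 : ℝ) ∈ Set.Icc 0 b := ⟨le_rfl, hb.le⟩
    have mu : u ∈ Set.Icc 0 b := ⟨hu.le, by linarith⟩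
    have mw : u + v ∈ Set.Icc 0 b := ⟨by linarith, by linarith⟩
    have mt : t ∈ Set.Icc 0 b := ⟨by linarith, by linarith⟩
    have e1 : |u - (u + v)| = v := by rw [sub_add_cancel_left, abs_neg, abs_of_pos hv]
    have e2 : |u + v - 0| = u + v := by rw [sub_zero, abs_of_pos (by linarith)]
    have e3 : |0 - (u + v)| = u + v := by rw [zero_sub, abs_neg, abs_of_pos (by linarith)]
    have e4 : |u - t| = t - u := by rw [abs_of_nonpos (by linarith)]; ring
    have e5 : |0 - t| = t := by rw [zero_sub, abs_neg, abs_of_pos (by linarith)]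
    have e6 : |u + v - t| = t - u - v := by rw [abs_of_nonpos (by linarith)]; ring
    have h := hM.cov_eq hX hXm hSo hSf (subset_closure (huS u ⟨hu, by linarith⟩)) htS
      (α := α) (β := β)
      (by rw [hcov _ mu _ mz, hcov _ mz _ mz, hcov _ mw _ mz, e2, sub_zero, sub_zero, abs_zero,
            abs_of_pos hu, h1])
      (by rw [hcov _ mu _ mw, hcov _ mz _ mw, hcov _ mw _ mw, e1, e3, sub_self, abs_zero, h2])
    rwa [hcov _ mu _ mt, hcov _ mz _ mt, hcov _ mw _ mt, e4, e5, e6] at h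

/-- The covariance along an edge is a Markov kernel. -/
lemma IsMarkovOrderOne.markovKernel_edge (hM : IsMarkovOrderOne μ X)
    (hX : IsGaussianProcess X μ) (hXm : ∀ s, Measurable (X s)) {G : MetricGraph Γ}
    (hG : G.HasEuclideanEdges) {d : Γ → Γ → ℝ} {r : ℝ → ℝ}
    (hcov : ∀ s t : Γ, cov[X s, X t; μ] = r (d s t)) (h0 : 0 < r 0)
    {e : Fin G.numEdges} {K : ℝ} (hK : ∀ x ∈ Set.Ioo 0 (G.len e), ∀ y ∈ Set.Ioo 0 (G.len e),
      d (G.curve e x) (G.curve e y) = |x - y| - K * |x - y| ^ 2) :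
    MarkovKernel (fun x => r (x - K * x ^ 2)) (G.len e / 2) := by
  have hl := G.len_pos e
  have hm : ∀ x ∈ Set.Icc 0 (G.len e / 2), x + G.len e / 4 ∈ Set.Ioo 0 (G.len e) := fun x hx =>
    ⟨by linarith [hx.1], by linarith [hx.2]⟩
  -- Only the middle half of the edge is used: hK says nothing at the vertices.
  refine hM.markovKernel hX hXm (γ := fun x => G.curve e (x + G.len e / 4)) (by linarith) ?_ ?_
    (by simpa using h0) ?_
  · exact (G.continuousOn_curve e).comp (by fun_prop)
      fun x hx => Set.Ioo_subset_Icc_self (hm x hx)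
  · intro x hx y hy
    rw [hcov, hK _ (hm x hx) _ (hm y hy), add_sub_add_right_eq_sub]
  · intro w t hw hwt ht
    refine ⟨G.curve e '' Set.Ioo (G.len e / 4) (w + G.len e / 4),
      hG.isOpen_arc e (by linarith) (by linarith), ?_, ?_, ?_⟩
    · rw [hG.frontier_arc e (by linarith) (by linarith) (by linarith), zero_add]
    · rintro ⟨z, hz, hzt⟩
      have := hG.injOn_curve e ⟨by linarith [hz.1], by linarith [hz.2]⟩
        ⟨by linarith, by linarith⟩ hzt
      linarith [hz.2]
    · intro u hu
      exact ⟨_, ⟨by linarith [hu.1], by linarith [hu.2]⟩, rfl⟩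

/-- If the covariance is flat at small distances, then it is constant. -/
lemma IsMarkovOrderOne.cov_const (hM : IsMarkovOrderOne μ X) (hX : IsGaussianProcess X μ)
    (G : MetricGraph Γ) {d : Γ → Γ → ℝ} {r : ℝ → ℝ}
    (hcov : ∀ s t : Γ, cov[X s, X t; μ] = r (d s t)) (hself : ∀ s, d s s = 0)
    (hK : ∀ e, ∃ K : ℝ, ∀ x ∈ Set.Ioo 0 (G.len e), ∀ y ∈ Set.Ioo 0 (G.len e),
      d (G.curve e x) (G.curve e y) = |x - y| - K * |x - y| ^ 2)
    (hflat : ∃ ε > 0, ∀ x ∈ Set.Icc 0 ε, r x = r 0) :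
    ∃ c : ℝ, ∀ s t : Γ, cov[X s, X t; μ] = c := by
  obtain ⟨ε, hε, hr⟩ := hflat
  have h1 : ∀ u s s' : Γ, cov[X s, X u; μ] = cov[X s', X u; μ] := by
    intro u
    refine G.eq_of_forall_edge fun e a ha b hb =>
      G.eq_on_edge (F := fun s => cov[X s, X u; μ]) e (hM.continuous_cov hX u).continuousOn ?_ ha hb
    intro x hx
    obtain ⟨K, hK⟩ := hK e
    have hcont : Filter.Tendsto (fun y => |y - x| - K * |y - x| ^ 2) (𝓝 x) (𝓝 0) := by
      have : Continuous fun y => |y - x| - K * |y - x| ^ 2 := by fun_prop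
      simpa using this.tendsto x
    have hcont2 : Filter.Tendsto (fun y => K * |y - x|) (𝓝 x) (𝓝 0) := by
      have : Continuous fun y => K * |y - x| := by fun_prop
      simpa using this.tendsto x
    -- The first condition keeps |y - x| - K|y - x|² below ε, the second makes it nonnegative, so
    -- the covariance of the two points equals the variance.
    filter_upwards [nhdsWithin_le_nhds (hcont.eventually (Iio_mem_nhds hε)),
      nhdsWithin_le_nhds (hcont2.eventually (Iio_mem_nhds one_pos)), self_mem_nhdsWithin]
      with y hy1 hy2 hy
    have hd : cov[X (G.curve e y), X (G.curve e x); μ] = r 0 := by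
      rw [hcov, hK y hy x hx]
      refine hr _ ⟨?_, hy1.le⟩
      nlinarith [abs_nonneg (y - x)]
    exact cov_eq_of_perfect hX (by rw [hd, hcov, hself]) (by rw [hd, hcov, hself]) u
  rcases isEmpty_or_nonempty Γ with h | ⟨⟨x₀⟩⟩
  · exact ⟨0, fun s => h.elim s⟩
  · refine ⟨cov[X x₀, X x₀; μ], fun s t => ?_⟩
    rw [h1 t s x₀, covariance_comm, h1 x₀ t x₀]

end Field

/-! ### Gates -/

section Gate

variable {Γ : Type*} [MetricSpace Γ]

/-- `π` maps every point to its gate in `P`: the points of `P` are their own gates, and a shortest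
path between two points with different gates passes through the gates. -/
structure IsGate (P : Set Γ) (π : Γ → Γ) : Prop where
  mem : ∀ x, π x ∈ P
  self : ∀ x ∈ P, π x = x
  dist_eq : ∀ x y, π x ≠ π y → dist x y = dist x (π x) + dist (π x) (π y) + dist (π y) y

namespace IsGate

variable {P : Set Γ} {π : Γ → Γ}

lemma dist_le (h : IsGate P π) (x y : Γ) : dist (π x) (π y) ≤ dist x y := by
  by_cases hxy : π x = π y
  · rw [hxy, dist_self]; exact dist_nonneg
  · rw [h.dist_eq x y hxy]
    linarith [dist_nonneg (x := x) (y := π x), dist_nonneg (x := π y) (y := y)]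

lemma continuous (h : IsGate P π) : Continuous π := by
  refine LipschitzWith.continuous (K := 1) (LipschitzWith.of_dist_le_mul fun x y => ?_)
  rw [NNReal.coe_one, one_mul]
  exact h.dist_le x y

lemma isClosed (h : IsGate P π) : IsClosed P := by
  have : P = {x | π x = x} := by
    ext x; exact ⟨h.self x, fun hx => hx ▸ h.mem x⟩
  rw [this]
  exact isClosed_eq h.continuous continuous_id

/-- If the gates differed, a shortest path from x to y would pass through the gate of x and be at
least as long as dist x (π x). -/
lemma eq_of_dist_lt (h : IsGate P π) {x y : Γ} (hxy : dist x y < dist x (π x)) : π y = π x := by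
  by_contra hne
  have := h.dist_eq x y (Ne.symm hne)
  linarith [dist_nonneg (x := π x) (y := π y), dist_nonneg (x := π y) (y := y)]

lemma eventually_eq (h : IsGate P π) {x : Γ} (hx : x ∉ P) : ∀ᶠ y in 𝓝 x, π y = π x := by
  have hpos : 0 < dist x (π x) := dist_pos.2 fun e => hx (e ▸ h.mem x)
  filter_upwards [Metric.ball_mem_nhds x hpos] with y hy
  exact h.eq_of_dist_lt (by rwa [dist_comm])

/-- The boundary of the set of the points whose gate lies in a relatively open subset of `P`. -/
lemma frontier_preimage (h : IsGate P π) {W : Set Γ} (hW : IsOpen W) :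
    frontier (π ⁻¹' W) = closure (W ∩ P) \ W := by
  rw [frontier, (hW.preimage h.continuous).interior_eq]
  have hsub : W ∩ P ⊆ π ⁻¹' W := fun x hx => by
    rw [Set.mem_preimage, h.self x hx.2]; exact hx.1
  ext x
  constructor
  · rintro ⟨hx, hxW⟩
    -- Off P the gate is locally constant, so the preimage has no boundary point there.
    have hxP : x ∈ P := by
      by_contra hxP
      obtain ⟨y, hy, hyW⟩ := mem_closure_iff_nhds.1 hx _ (h.eventually_eq hxP)
      exact hxW (by rw [Set.mem_preimage] at hyW ⊢; rwa [← show π y = π x from hy])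
    refine ⟨?_, fun hw => hxW (by rw [Set.mem_preimage, h.self x hxP]; exact hw)⟩
    have h1 : π x ∈ closure (W ∩ P) :=
      map_mem_closure h.continuous hx fun y hy => ⟨hy, h.mem y⟩
    rwa [h.self x hxP] at h1
  · rintro ⟨hx, hxW⟩
    have hxP : x ∈ P := h.isClosed.closure_subset_iff.2 Set.inter_subset_right hx
    refine ⟨closure_mono hsub hx, ?_⟩
    rw [Set.mem_preimage, h.self x hxP]; exact hxW

end IsGate

/-- Every piece of a 1-sum has gates. -/
lemma IsKStepOneSum.exists_isGate {k : ℕ} {P : Fin k → Set Γ} {v : Fin k → Γ}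
    (h : IsKStepOneSum P v) (i : Fin k) : ∃ π, IsGate (P i) π := by
  set U : ℕ → Set Γ := fun n => ⋃ j : Fin k, ⋃ _ : (j : ℕ) < n, P j with hU
  have hmem : ∀ {n : ℕ} {x : Γ}, x ∈ U n ↔ ∃ j : Fin k, (j : ℕ) < n ∧ x ∈ P j := by
    intro n x; simp [hU]
  have hUj : ∀ j : Fin k, (⋃ l : Fin k, ⋃ _ : l < j, P l) = U j := fun j => rfl
  have hv : ∀ j : Fin k, 0 < (j : ℕ) → v j ∈ U j ∧ v j ∈ P j := by
    intro j hj
    have : v j ∈ U j ∩ P j := by rw [← hUj, h.inter j hj]; rfl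
    exact this
  -- Induction on the number of pieces: everything attached before P i has the gate v i, and each
  -- later piece is collapsed to the gate of its attaching point. Away from U n the map is
  -- irrelevant.
  have key : ∀ n, (i : ℕ) < n → n ≤ k → ∃ π : Γ → Γ, (∀ x ∈ U n, π x ∈ P i) ∧
      (∀ x ∈ P i, π x = x) ∧ ∀ x ∈ U n, ∀ y ∈ U n, π x ≠ π y →
        dist x y = dist x (π x) + dist (π x) (π y) + dist (π y) y := by
    classical
    intro n hn
    induction n, hn using Nat.le_induction with
    | base =>
      intro _
      have hlt : ∀ x ∈ U (i + 1), x ∉ P i → x ∈ U i ∧ v i ∈ P i := by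
        intro x hx hxi
        obtain ⟨j, hj, hxj⟩ := hmem.1 hx
        have hji : (j : ℕ) ≠ i := fun e => hxi (Fin.ext e ▸ hxj)
        exact ⟨hmem.2 ⟨j, by omega, hxj⟩, (hv i (by omega)).2⟩
      -- For i = 0 the set U (i + 1) is P i itself, and the default v i is never taken on it.
      refine ⟨fun x => if x ∈ P i then x else v i, ?_, ?_, ?_⟩
      · intro x hx
        by_cases hxi : x ∈ P i
        · simp [hxi]
        · simpa [hxi] using (hlt x hx hxi).2
      · intro x hx; simp [hx]
      · intro x hx y hy hne
        by_cases hxi : x ∈ P i <;> by_cases hyi : y ∈ P i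
        · simp [hxi, hyi]
        · have := h.dist_eq i y (hlt y hy hyi).1 x hxi
          simp only [hxi, hyi, if_true, if_false, dist_self, zero_add]
          rw [dist_comm x y, this, dist_comm y, dist_comm x]; ring
        · have := h.dist_eq i x (hlt x hx hxi).1 y hyi
          simp [hxi, hyi, this]
        · simp [hxi, hyi] at hne
    | succ n hn ih =>
      intro hnk
      obtain ⟨π, h1, h2, h3⟩ := ih (by omega)
      set j : Fin k := ⟨n, by omega⟩ with hj
      have hvj := hv j (show 0 < n by omega)
      have hPU : P i ⊆ U n := fun x hx => hmem.2 ⟨i, by omega, hx⟩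
      have hnew : ∀ x ∈ U (n + 1), x ∉ U n → x ∈ P j := by
        intro x hx hxn
        obtain ⟨l, hl, hxl⟩ := hmem.1 hx
        have : (l : ℕ) = n := by
          by_contra hne
          exact hxn (hmem.2 ⟨l, by omega, hxl⟩)
        have : l = j := Fin.ext this
        rwa [← this]
      have hcross : ∀ x ∈ U n, ∀ y ∈ P j, π x ≠ π (v j) →
          dist x y = dist x (π x) + dist (π x) (π (v j)) + dist (π (v j)) y := by
        intro x hx y hy hne
        have e1 := h.dist_eq j x hx y hy
        have e2 := h.dist_eq j (π (v j)) (hPU (h1 _ hvj.1)) y hy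
        have e3 := h3 x hx (v j) hvj.1 hne
        linarith
      refine ⟨fun x => if x ∈ U n then π x else π (v j), ?_, ?_, ?_⟩
      · intro x hx
        by_cases hxn : x ∈ U n
        · simpa [hxn] using h1 x hxn
        · simpa [hxn] using h1 _ hvj.1
      · intro x hx
        simpa [hPU hx] using h2 x hx
      · intro x hx y hy hne
        by_cases hxn : x ∈ U n <;> by_cases hyn : y ∈ U n <;>
          simp only [hxn, hyn, if_true, if_false] at hne ⊢
        · exact h3 x hxn y hyn hne
        · exact hcross x hxn y (hnew y hy hyn) hne
        · have := hcross y hyn x (hnew x hx hxn) hne.symm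
          rw [dist_comm x y, this, dist_comm (π (v j)) (π y), dist_comm y (π y),
            dist_comm (π (v j)) x]; ring
        · exact absurd rfl hne
  obtain ⟨π, h1, h2, h3⟩ := key k i.2 le_rfl
  have huniv : ∀ x, x ∈ U k := by
    intro x
    have : x ∈ ⋃ j, P j := by rw [h.cover]; trivial
    obtain ⟨j, hj⟩ := Set.mem_iUnion.1 this
    exact hmem.2 ⟨j, j.2, hj⟩
  exact ⟨π, fun x => h1 x (huniv x), h2, fun x y => h3 x (huniv x) y (huniv y)⟩

end Gate

/-! ### The norm of the circle -/

lemma AddCircle.norm_coe_le_abs {p : ℝ} (hp : 0 < p) (x : ℝ) : ‖(x : AddCircle p)‖ ≤ |x| := by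
  rw [AddCircle.norm_eq' p hp]
  have h := round_le (p⁻¹ * x) 0
  rw [Int.cast_zero, sub_zero] at h
  calc p * |p⁻¹ * x - round (p⁻¹ * x)| ≤ p * |p⁻¹ * x| := by gcongr
    _ = |x| := by rw [abs_mul, abs_of_pos (inv_pos.2 hp)]; field_simp

lemma AddCircle.norm_coe_eq_of_le {p : ℝ} (hp : 0 < p) {x : ℝ} (hx : |x| ≤ p / 2) :
    ‖(x : AddCircle p)‖ = |x| :=
  (AddCircle.norm_coe_eq_abs_iff p hp.ne').2 (by rwa [abs_of_pos hp])

lemma AddCircle.norm_coe_sub_period {p : ℝ} (x : ℝ) :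
    ‖((p - x : ℝ) : AddCircle p)‖ = ‖(x : AddCircle p)‖ := by
  rw [AddCircle.coe_sub, AddCircle.coe_period, zero_sub, norm_neg]

lemma AddCircle.norm_coe_eq {p : ℝ} (hp : 0 < p) {x : ℝ} (hx0 : 0 ≤ x) (hx : x ≤ p) :
    ‖(x : AddCircle p)‖ = min x (p - x) := by
  rcases le_total x (p / 2) with h | h
  · rw [AddCircle.norm_coe_eq_of_le hp (by rwa [abs_of_nonneg hx0]), abs_of_nonneg hx0,
      min_eq_left (by linarith)]
  · rw [← AddCircle.norm_coe_sub_period, AddCircle.norm_coe_eq_of_le hp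
      (by rw [abs_of_nonneg (by linarith)]; linarith), abs_of_nonneg (by linarith),
      min_eq_right (by linarith)]

lemma AddCircle.norm_coe_abs {p : ℝ} (x : ℝ) :
    ‖((|x| : ℝ) : AddCircle p)‖ = ‖(x : AddCircle p)‖ := by
  rcases abs_cases x with ⟨h, _⟩ | ⟨h, _⟩ <;> rw [h]
  rw [AddCircle.coe_neg, norm_neg]

/-! ### Parametrization of a Euclidean cycle -/

/-- A closed polygon whose points have distances at least those on the circle is isometric to
the circle. -/
lemma dist_eq_norm_of_polygon {Γ : Type*} [MetricSpace Γ] {n : ℕ} {u : ℕ → Γ} {l : ℕ → ℝ}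
    {c : ℕ → ℝ → Γ} (hl : ∀ k, 0 < l k) (hu : u n = u 0) (h0 : ∀ k < n, c k 0 = u k)
    (h1 : ∀ k < n, c k (l k) = u (k + 1))
    (hc : ∀ k < n, ∀ a ∈ Set.Icc 0 (l k), ∀ b ∈ Set.Icc 0 (l k), dist (c k a) (c k b) ≤ |a - b|)
    (hsurj : ∀ x, ∃ k < n, ∃ t ∈ Set.Icc 0 (l k), c k t = x) {p : ℝ} (hp0 : 0 < p)
    (hp : ∑ k ∈ Finset.range n, l k = p) {Θ : Γ → AddCircle p}
    (hΘ : ∀ k < n, ∀ t ∈ Set.Icc 0 (l k),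
      Θ (c k t) = ((∑ j ∈ Finset.range k, l j + t : ℝ) : AddCircle p))
    (hlow : ∀ x y, ‖Θ x - Θ y‖ ≤ dist x y) (x y : Γ) : dist x y = ‖Θ x - Θ y‖ := by
  refine le_antisymm ?_ (hlow x y)
  set S : ℕ → ℝ := fun k => ∑ j ∈ Finset.range k, l j with hS
  have hSs : ∀ k, S (k + 1) = S k + l k := fun k => Finset.sum_range_succ _ _
  have hSm : Monotone S := monotone_nat_of_le_succ fun k => by linarith [hSs k, hl k]
  have hSn : S n = p := hp
  have hS0 : S 0 = 0 := by simp [hS]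
  have hI0 : ∀ k, (0 : ℝ) ∈ Set.Icc 0 (l k) := fun k => ⟨le_rfl, (hl k).le⟩
  have hI1 : ∀ k, l k ∈ Set.Icc 0 (l k) := fun k => ⟨(hl k).le, le_rfl⟩
  have hstep : ∀ k < n, dist (u k) (u (k + 1)) ≤ S (k + 1) - S k := by
    intro k hk
    have := hc k hk _ (hI0 k) _ (hI1 k)
    rwa [h0 k hk, h1 k hk, zero_sub, abs_neg, abs_of_pos (hl k), ← sub_eq_iff_eq_add'.2 (hSs k)]
      at this
  have huu : ∀ i j, i ≤ j → j ≤ n → dist (u i) (u j) ≤ S j - S i := by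
    intro i j hij
    induction j, hij using Nat.le_induction with
    | base => intro _; simp
    | succ j hij ih =>
      intro hj
      linarith [dist_triangle (u i) (u j) (u (j + 1)), ih (by omega), hstep j (by omega)]
  have hfrom : ∀ k < n, ∀ t ∈ Set.Icc 0 (l k), dist (u k) (c k t) ≤ t := by
    intro k hk t ht
    have := hc k hk _ (hI0 k) _ ht
    rwa [h0 k hk, zero_sub, abs_neg, abs_of_nonneg ht.1] at this
  have hto : ∀ k < n, ∀ t ∈ Set.Icc 0 (l k), dist (c k t) (u (k + 1)) ≤ l k - t := by
    intro k hk t ht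
    have := hc k hk _ ht _ (hI1 k)
    rwa [h1 k hk, abs_sub_comm, abs_of_nonneg (by linarith [ht.2])] at this
  -- The coordinates and the sides can be ordered differently only at a corner addressed from both
  -- of its sides; this is the case j < i.
  have hdir : ∀ i < n, ∀ s ∈ Set.Icc 0 (l i), ∀ j < n, ∀ t ∈ Set.Icc 0 (l j), S i + s ≤ S j + t →
      dist (c i s) (c j t) ≤ (S j + t) - (S i + s) := by
    intro i hi s hs j hj t ht hle
    rcases lt_trichotomy i j with hij | rfl | hij
    · linarith [dist_triangle4 (c i s) (u (i + 1)) (u j) (c j t), hto i hi s hs,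
        huu (i + 1) j hij hj.le, hfrom j hj t ht, hSs i]
    · have := hc i hi s hs t ht
      rw [abs_of_nonpos (by linarith)] at this
      linarith
    · have e := hSm hij
      rw [Nat.succ_eq_add_one, hSs] at e
      have es : s = 0 := by linarith [hs.1, ht.2]
      have et : t = l j := by linarith [hs.1, ht.2]
      have e2 : S (j + 1) = S i := by rw [hSs]; linarith [hs.1, ht.2]
      have := huu (j + 1) i hij hi.le
      rw [es, et, h0 i hi, h1 j hj, dist_comm]
      linarith [hSs j]
  -- The way round through the closing corner u n = u 0.
  have hround : ∀ i < n, ∀ s ∈ Set.Icc 0 (l i), ∀ j < n, ∀ t ∈ Set.Icc 0 (l j),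
      dist (c i s) (c j t) ≤ p - ((S j + t) - (S i + s)) := by
    intro i hi s hs j hj t ht
    have a1 := huu 0 i (Nat.zero_le _) hi.le
    have a2 := huu (j + 1) n hj le_rfl
    rw [hu] at a2
    linarith [dist_triangle4 (c j t) (u (j + 1)) (u 0) (c i s), hto j hj t ht, hSs j,
      dist_triangle (u 0) (u i) (c i s), hfrom i hi s hs, dist_comm (c i s) (c j t)]
  obtain ⟨i, hi, s, hs, rfl⟩ := hsurj x
  obtain ⟨j, hj, t, ht, rfl⟩ := hsurj y
  rw [hΘ i hi s hs, hΘ j hj t ht]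
  have hb : ∀ i < n, ∀ s ∈ Set.Icc 0 (l i), 0 ≤ S i + s ∧ S i + s ≤ p := by
    intro i hi s hs
    have a1 := hSm (Nat.zero_le i)
    have a2 := hSm hi
    rw [Nat.succ_eq_add_one, hSs] at a2
    constructor <;> linarith [hs.1, hs.2]
  have bi := hb i hi s hs
  have bj := hb j hj t ht
  have hnorm : ∀ A B : ℝ, 0 ≤ A → A ≤ B → B ≤ p →
      ‖(A : AddCircle p) - (B : AddCircle p)‖ = min (B - A) (p - (B - A)) := by
    intro A B hA hAB hB
    rw [norm_sub_rev, ← AddCircle.coe_sub, AddCircle.norm_coe_eq hp0 (by linarith) (by linarith)]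
  rcases le_total (S i + s) (S j + t) with hle | hle
  · rw [hnorm _ _ bi.1 hle bj.2]
    exact le_min (hdir i hi s hs j hj t ht hle) (hround i hi s hs j hj t ht)
  · rw [norm_sub_rev, hnorm _ _ bj.1 hle bi.2, dist_comm]
    exact le_min (hdir j hj t ht i hi s hs hle) (hround j hj t ht i hi s hs)

namespace MetricGraph

variable {Γ : Type*} [MetricSpace Γ] {G : MetricGraph Γ}

/-- The curve of an edge, traversed starting at the vertex `x`. -/
noncomputable def curveFrom (G : MetricGraph Γ) (e : Fin G.numEdges) (x : Γ) (t : ℝ) : Γ :=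
  open Classical in if G.src e = x then G.curve e t else G.curve e (G.len e - t)

lemma HasEuclideanEdges.curveFrom_ends (hG : G.HasEuclideanEdges) {e : Fin G.numEdges} {x y : Γ}
    (h : s(G.src e, G.tgt e) = s(x, y)) :
    G.curveFrom e x 0 = x ∧ G.curveFrom e x (G.len e) = y := by
  rcases Sym2.eq_iff.1 h with ⟨h1, h2⟩ | ⟨h1, h2⟩
  · simp only [curveFrom, h1, if_true]; exact ⟨h1, h2⟩
  · have : G.src e ≠ x := fun h => hG.no_loop e (h.trans h2.symm)
    simp only [curveFrom, this, if_false, sub_zero, sub_self]; exact ⟨h2, h1⟩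

lemma dist_curveFrom_le (e : Fin G.numEdges) (x : Γ) {a b : ℝ} (ha : a ∈ Set.Icc 0 (G.len e))
    (hb : b ∈ Set.Icc 0 (G.len e)) : dist (G.curveFrom e x a) (G.curveFrom e x b) ≤ |a - b| := by
  rw [curveFrom, curveFrom]
  split_ifs
  · exact G.dist_curve_le e ha hb
  · refine (G.dist_curve_le e ⟨by linarith [ha.2], by linarith [ha.1]⟩
      ⟨by linarith [hb.2], by linarith [hb.1]⟩).trans_eq ?_
    rw [abs_sub_comm]; congr 1; ring

/-- A point of an edge in terms of `curve` and `curveFrom`. -/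
lemma curve_eq_curveFrom (e : Fin G.numEdges) (x : Γ) :
    (∀ t, G.curve e t = G.curveFrom e x t) ∨ (∀ t, G.curve e t = G.curveFrom e x (G.len e - t)) := by
  by_cases h : G.src e = x
  · left; intro t; simp [curveFrom, h]
  · right; intro t; simp [curveFrom, h]

lemma curveFrom_eq_curve (e : Fin G.numEdges) (x : Γ) :
    (∀ t, G.curveFrom e x t = G.curve e t) ∨ (∀ t, G.curveFrom e x t = G.curve e (G.len e - t)) := by
  by_cases h : G.src e = x
  · left; intro t; simp [curveFrom, h]
  · right; intro t; simp [curveFrom, h]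

/-- A Euclidean cycle is isometric to the circle whose circumference is the length of the cycle. -/
lemma IsEuclideanCycle.exists_param (hC : G.IsEuclideanCycle) : 0 < G.totalLength ∧
    ∃ γ : ℝ → Γ, Function.Surjective γ ∧
      ∀ s t, dist (γ s) (γ t) = ‖((s - t : ℝ) : AddCircle G.totalLength)‖ := by
  obtain ⟨hE, n, hn, ⟨φ⟩⟩ := hC
  -- This provides the arithmetic of `Fin (m + 3)`, in which 1 + 1 is not zero.
  obtain ⟨m, rfl⟩ : ∃ m, n = m + 3 := ⟨n - 3, by omega⟩
  have hone : ((1 : Fin (m + 3)) : ℕ) = 1 := rfl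
  set w : Fin (m + 3) → G.vertices := fun i => φ.symm i with hw
  have hwinj : Function.Injective w := φ.symm.injective
  have hadj : ∀ i, G.graph.Adj (w i) (w (i + 1)) := fun i => by
    rw [hw]
    simp only
    rw [φ.symm.map_adj_iff, SimpleGraph.cycleGraph_adj]
    right; simp
  choose E hEe using fun i => (hadj i).2
  -- Distinct sides on one edge would run in opposite directions, which forces 1 + 1 = 0 in `Fin (m
  -- + 3)`. With surjectivity, the sides enumerate the edges once each, so their lengths add up to
  -- the total length.
  have hEinj : Function.Injective E := by
    intro i j hij
    have h1 : s((w i : Γ), (w (i + 1) : Γ)) = s((w j : Γ), (w (j + 1) : Γ)) := by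
      rw [← hEe i, ← hEe j, hij]
    rcases Sym2.eq_iff.1 h1 with ⟨h, _⟩ | ⟨h, h'⟩
    · exact hwinj (Subtype.ext h)
    · have a1 := hwinj (Subtype.ext h)
      have a2 := hwinj (Subtype.ext h')
      rw [a1, add_assoc] at a2
      have a3 : (1 : Fin (m + 3)) + 1 = 0 := by simpa using a2
      have a4 := congrArg Fin.val a3
      simp only [Fin.val_add, hone, Fin.val_zero] at a4
      rw [Nat.mod_eq_of_lt (by omega)] at a4
      omega
  have hEsurj : Function.Surjective E := by
    intro e
    have h1 : G.graph.Adj ⟨G.src e, G.curve_zero_mem e⟩ ⟨G.tgt e, G.curve_len_mem e⟩ :=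
      ⟨fun h => hE.no_loop e (congrArg Subtype.val h), e, rfl⟩
    rw [← φ.map_adj_iff, SimpleGraph.cycleGraph_adj] at h1
    have hwφ : ∀ v, w (φ v) = v := fun v => φ.symm_apply_apply v
    rcases h1 with h1 | h1
    · refine ⟨φ ⟨G.tgt e, G.curve_len_mem e⟩, hE.no_multiple _ _ ?_⟩
      rw [hEe, ← eq_add_of_sub_eq' h1, hwφ, hwφ, Sym2.eq_swap]
    · refine ⟨φ ⟨G.src e, G.curve_zero_mem e⟩, hE.no_multiple _ _ ?_⟩
      rw [hEe, ← eq_add_of_sub_eq' h1, hwφ, hwφ]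
  set ν : ℕ → Fin (m + 3) := fun k => Fin.ofNat (m + 3) k with hν
  have hνs : ∀ k, ν (k + 1) = ν k + 1 := fun k => by
    refine Fin.ext ?_
    simp [hν, Fin.val_add]
  have hνinj : ∀ i < m + 3, ∀ j < m + 3, ν i = ν j → i = j := by
    intro i hi j hj h
    have := congrArg Fin.val h
    simpa [hν, Nat.mod_eq_of_lt hi, Nat.mod_eq_of_lt hj] using this
  have hνsurj : ∀ i : Fin (m + 3), ν i = i := fun i => Fin.ext (by
    simp [hν])
  set l : ℕ → ℝ := fun k => G.len (E (ν k)) with hl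
  set u : ℕ → Γ := fun k => w (ν k) with hu
  set c : ℕ → ℝ → Γ := fun k => G.curveFrom (E (ν k)) (u k) with hc
  have hp : ∑ k ∈ Finset.range (m + 3), l k = G.totalLength := by
    rw [Finset.sum_range, totalLength, ← Equiv.sum_comp (Equiv.ofBijective E ⟨hEinj, hEsurj⟩)]
    refine Finset.sum_congr rfl fun i _ => ?_
    simp only [hl, hνsurj]; rfl
  have hp0 : 0 < G.totalLength := by
    rw [← hp]
    exact Finset.sum_pos (fun k _ => G.len_pos _) ⟨0, by simp⟩
  have hu0 : u (m + 3) = u 0 := by simp [hu, hν]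
  have hends : ∀ k, c k 0 = u k ∧ c k (l k) = u (k + 1) := fun k => by
    refine hE.curveFrom_ends ?_
    rw [hEe]; simp only [hu, hνs]
  set S : ℕ → ℝ := fun k => ∑ j ∈ Finset.range k, l j with hS
  have hSs : ∀ k, S (k + 1) = S k + l k := fun k => Finset.sum_range_succ _ _
  -- the coordinate of a point on the circle is well defined
  have hvert : ∀ k < m + 3, ∀ t ∈ Set.Icc 0 (l k), c k t ∈ G.vertices →
      ∃ j < m + 3, c k t = u j ∧ ((S k + t : ℝ) : AddCircle G.totalLength) = (S j : ℝ) := by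
    intro k hk t ht hv
    have hend : t = 0 ∨ t = l k := by
      by_contra hne
      push Not at hne
      have h1 : t ∈ Set.Ioo 0 (l k) :=
        ⟨lt_of_le_of_ne ht.1 hne.1.symm, lt_of_le_of_ne ht.2 hne.2⟩
      rcases G.curveFrom_eq_curve (E (ν k)) (u k) with h | h
      · exact G.curve_interior _ t h1 (h t ▸ hv)
      · exact G.curve_interior (E (ν k)) (G.len (E (ν k)) - t)
          ⟨by linarith [h1.2], by linarith [h1.1]⟩ (h t ▸ hv)
    rcases hend with rfl | rfl
    · exact ⟨k, hk, (hends k).1, by rw [add_zero]⟩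
    · rcases Nat.lt_or_ge (k + 1) (m + 3) with hk' | hk'
      · exact ⟨k + 1, hk', (hends k).2, by rw [hSs]⟩
      · have hk1 : k + 1 = m + 3 := by omega
        refine ⟨0, by omega, by rw [(hends k).2, hk1, hu0], ?_⟩
        rw [← hSs, hk1]
        simp only [hS, hp, Finset.sum_range_zero, AddCircle.coe_period, AddCircle.coe_zero]
  have hwd : ∀ k < m + 3, ∀ t ∈ Set.Icc 0 (l k), ∀ j < m + 3, ∀ s ∈ Set.Icc 0 (l j),
      c k t = c j s →
      ((S k + t : ℝ) : AddCircle G.totalLength) = ((S j + s : ℝ) : AddCircle G.totalLength) := by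
    intro k hk t ht j hj s hs h
    by_cases hv : c k t ∈ G.vertices
    · obtain ⟨k', hk', e1, e2⟩ := hvert k hk t ht hv
      obtain ⟨j', hj', e3, e4⟩ := hvert j hj s hs (h ▸ hv)
      have : k' = j' := hνinj k' hk' j' hj' (hwinj (Subtype.ext (e1.symm.trans (h.trans e3))))
      rw [e2, e4, this]
    · have hmem : ∀ k < m + 3, ∀ t ∈ Set.Icc 0 (l k), c k t ∈ G.edgeSet (E (ν k)) := by
        intro k hk t ht
        rcases G.curveFrom_eq_curve (E (ν k)) (u k) with h | h
        · exact ⟨t, ht, (h t).symm⟩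
        · exact ⟨G.len (E (ν k)) - t, ⟨by linarith [ht.2], by linarith [ht.1]⟩, (h t).symm⟩
      have h1 := G.mem_openEdge_of_mem_edgeSet (hmem k hk t ht) hv
      have h2 := G.eq_of_mem_openEdge_edgeSet h1 (h ▸ hmem j hj s hs)
      have hkj : k = j := hνinj k hk j hj (hEinj h2)
      subst hkj
      have hts : t = s := by
        rcases G.curveFrom_eq_curve (E (ν k)) (u k) with h' | h'
        · refine hE.injOn_curve _ ht hs ?_
          rw [← h', ← h']; exact h
        · have : G.len (E (ν k)) - t = G.len (E (ν k)) - s :=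
              hE.injOn_curve (E (ν k)) ⟨by linarith [ht.2], by linarith [ht.1]⟩ ⟨by linarith [hs.2], by linarith [hs.1]⟩ (by rw [← h', ← h']; exact h)
          linarith
      rw [hts]
  -- every point lies on one of the sides
  have hcurve : ∀ e, ∃ k < m + 3, E (ν k) = e := fun e => by
    obtain ⟨i, rfl⟩ := hEsurj e
    exact ⟨i, i.2, by rw [hνsurj]⟩
  have hsurj : ∀ x, ∃ k < m + 3, ∃ t ∈ Set.Icc 0 (l k), c k t = x := by
    intro x
    by_cases hv : x ∈ G.vertices
    · refine ⟨φ ⟨x, hv⟩, (φ ⟨x, hv⟩).2, 0, ⟨le_rfl, (G.len_pos _).le⟩, ?_⟩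
      rw [(hends _).1]
      simp only [hu, hνsurj]
      exact congrArg Subtype.val (φ.symm_apply_apply ⟨x, hv⟩)
    · obtain ⟨e, t, ht, rfl⟩ := G.exists_mem_openEdge hv
      obtain ⟨k, hk, rfl⟩ := hcurve e
      rcases G.curve_eq_curveFrom (E (ν k)) (u k) with h | h
      · exact ⟨k, hk, t, ⟨ht.1.le, ht.2.le⟩, (h t).symm⟩
      · exact ⟨k, hk, G.len (E (ν k)) - t, ⟨by linarith [ht.2], by simp only [hl]; linarith [ht.1]⟩,
          (h t).symm⟩
  -- A corner has several addresses; by `hwd` the coordinate Θ does not depend on the chosen one.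
  choose κ hκ τ hτ hκτ using hsurj
  set Θ : Γ → AddCircle G.totalLength := fun x => ((S (κ x) + τ x : ℝ) : AddCircle _) with hΘ
  have hΘc : ∀ k < m + 3, ∀ t ∈ Set.Icc 0 (l k), Θ (c k t) = ((S k + t : ℝ) : AddCircle _) :=
    fun k hk t ht => hwd _ (hκ _) _ (hτ _) k hk t ht (hκτ _)
  -- On each edge Θ is the parameter up to translation and reflection, hence 1-Lipschitz; summing
  -- over the segments of a shortest path gives the bound.
  have hlow : ∀ x y, ‖Θ x - Θ y‖ ≤ dist x y := by
    have key : ∀ {x y : Γ} {L : ℝ}, PathLength G.len G.curve x y L → ‖Θ x - Θ y‖ ≤ L := by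
      intro x y L hL
      induction hL with
      | refl x => simp
      | step e a b ha hb z L _ ih =>
        refine (norm_sub_le_norm_sub_add_norm_sub _ (Θ (G.curve e b)) _).trans
          (add_le_add ?_ ih)
        obtain ⟨k, hk, rfl⟩ := hcurve e
        rcases G.curve_eq_curveFrom (E (ν k)) (u k) with h | h
        · rw [h, h, hΘc k hk a ha, hΘc k hk b hb, ← AddCircle.coe_sub, add_sub_add_left_eq_sub]
          exact AddCircle.norm_coe_le_abs hp0 _
        · rw [h, h, hΘc k hk _ ⟨by linarith [ha.2], by linarith [ha.1]⟩,
            hΘc k hk _ ⟨by linarith [hb.2], by linarith [hb.1]⟩, ← AddCircle.coe_sub,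
            add_sub_add_left_eq_sub, sub_sub_sub_cancel_left, abs_sub_comm]
          exact AddCircle.norm_coe_le_abs hp0 _
    exact fun x y => key (G.geodesic x y).1
  have hdist := dist_eq_norm_of_polygon (fun k => G.len_pos _) hu0 (fun k _ => (hends k).1)
    (fun k _ => (hends k).2) (fun k _ a ha b hb => G.dist_curveFrom_le _ _ ha hb)
    (fun x => ⟨κ x, hκ x, τ x, hτ x, hκτ x⟩) hp0 hp hΘc hlow
  have hΘinj : Function.Injective Θ := fun x y h => by
    rw [← dist_eq_zero, hdist, h, sub_self, norm_zero]
  have hΘsurj : Function.Surjective Θ := by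
    intro a
    have : Fact (0 < G.totalLength) := ⟨hp0⟩
    obtain ⟨s, hs, rfl⟩ := AddCircle.eq_coe_Ico a
    -- The first such k is the side that contains the point with coordinate s.
    have hex : ∃ k, s < S (k + 1) := ⟨m + 2, by simp only [hS, hp]; exact hs.2⟩
    classical
    have hk1 := Nat.find_spec hex
    have hkm : Nat.find hex < m + 3 := by
      have := Nat.find_min' hex (m := m + 2) (by simp only [hS, hp]; exact hs.2)
      omega
    set k := Nat.find hex with hk
    have hk0 : S k ≤ s := by
      rcases Nat.eq_zero_or_pos k with h | h
      · rw [h]; simpa [hS] using hs.1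
      · have := Nat.find_min hex (m := k - 1) (by omega)
        rw [show k - 1 + 1 = k by omega] at this
        exact not_lt.1 this
    rw [hSs] at hk1
    exact ⟨c k (s - S k), by
      rw [hΘc k hkm _ ⟨by linarith, by linarith⟩, add_sub_cancel]⟩
  obtain ⟨σ, hσ⟩ := hΘsurj.hasRightInverse
  refine ⟨hp0, fun s => σ (s : AddCircle _), fun x => ?_, fun s t => ?_⟩
  · obtain ⟨s, hs⟩ := QuotientAddGroup.mk_surjective (Θ x)
    exact ⟨s, hΘinj ((hσ _).trans hs)⟩
  · rw [hdist, hσ, hσ, AddCircle.coe_sub]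

/-- A single edge is isometric to an interval. -/
lemma IsSingleEdge.exists_param (h : G.IsSingleEdge) : ∃ L > 0, ∃ γ : ℝ → Γ,
    (∀ x, ∃ t ∈ Set.Icc 0 L, γ t = x) ∧
      ∀ s ∈ Set.Icc 0 L, ∀ t ∈ Set.Icc 0 L, dist (γ s) (γ t) = |s - t| := by
  obtain ⟨hE, h1⟩ := h
  set e : Fin G.numEdges := ⟨0, by omega⟩
  have he : ∀ e', e' = e := fun e' => Fin.ext (by have := e'.2; simp only [e]; omega)
  refine ⟨G.len e, G.len_pos e, G.curve e, fun x => ?_, fun s hs t ht => hE.dist_curve e hs ht⟩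
  -- A path from x to a different point starts with a segment of the only edge, so x lies on it even
  -- if x is a vertex.
  obtain ⟨y, hy⟩ : ∃ y, x ≠ y := by
    by_contra hne
    push Not at hne
    exact hE.no_loop e ((hne _).symm.trans (hne _))
  have hL := (G.geodesic x y).1
  generalize dist x y = L at hL
  cases hL with
  | refl => exact absurd rfl hy
  | step e' a b ha hb z L _ => exact ⟨a, he e' ▸ ha, by rw [he e']⟩

end MetricGraph

/-! ### Arcs of a cycle and cut points of an edge -/

/-- `γ` parametrizes `P` by the circle of circumference `ℓ`, by arc length. -/
structure IsCircleParam {Γ : Type*} [MetricSpace Γ] (P : Set Γ) (ℓ : ℝ) (γ : ℝ → Γ) : Prop where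
  pos : 0 < ℓ
  range_eq : Set.range γ = P
  dist_eq : ∀ s t, dist (γ s) (γ t) = ‖((s - t : ℝ) : AddCircle ℓ)‖

namespace IsCircleParam

variable {Γ : Type*} [MetricSpace Γ] {P : Set Γ} {ℓ : ℝ} {γ : ℝ → Γ}

lemma mem (h : IsCircleParam P ℓ γ) (t : ℝ) : γ t ∈ P := h.range_eq ▸ Set.mem_range_self t

lemma continuous (h : IsCircleParam P ℓ γ) : Continuous γ := by
  refine LipschitzWith.continuous (K := 1) (LipschitzWith.of_dist_le_mul fun x y => ?_)
  rw [NNReal.coe_one, one_mul, h.dist_eq, Real.dist_eq]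
  exact AddCircle.norm_coe_le_abs h.pos _

lemma periodic (h : IsCircleParam P ℓ γ) (t : ℝ) : γ (t + ℓ) = γ t := by
  rw [← dist_eq_zero, h.dist_eq, add_sub_cancel_left, AddCircle.coe_period, norm_zero]

lemma dist_eq_of_le (h : IsCircleParam P ℓ γ) {s t : ℝ} (hst : |s - t| ≤ ℓ / 2) :
    dist (γ s) (γ t) = |s - t| := by
  rw [h.dist_eq, AddCircle.norm_coe_eq_of_le h.pos hst]

lemma dist_eq_min (h : IsCircleParam P ℓ γ) {s t : ℝ} (hst : |s - t| ≤ ℓ) :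
    dist (γ s) (γ t) = min |s - t| (ℓ - |s - t|) := by
  rw [h.dist_eq, ← AddCircle.norm_coe_abs, AddCircle.norm_coe_eq h.pos (abs_nonneg _) hst]

lemma eq_of_abs_lt (h : IsCircleParam P ℓ γ) {s t : ℝ} (hst : |s - t| < ℓ) (he : γ s = γ t) :
    s = t := by
  have h1 := h.dist_eq_min hst.le
  rw [he, dist_self] at h1
  by_contra hne
  have h2 : 0 < |s - t| := abs_pos.2 (sub_ne_zero.2 hne)
  have h3 : 0 < min |s - t| (ℓ - |s - t|) := lt_min h2 (by linarith)
  linarith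

/-- Every point of `P` is a value of the parametrization on a given half open period. -/
lemma exists_mem_Ico (h : IsCircleParam P ℓ γ) (a : ℝ) {x : Γ} (hx : x ∈ P) :
    ∃ t ∈ Set.Ico a (a + ℓ), γ t = x := by
  obtain ⟨t, rfl⟩ := h.range_eq.symm ▸ hx
  have hp : Function.Periodic γ ℓ := h.periodic
  obtain ⟨y, hy, hyt⟩ := hp.exists_mem_Ico h.pos t a
  exact ⟨y, hy, hyt.symm⟩

lemma exists_mem_Ioc (h : IsCircleParam P ℓ γ) (a : ℝ) {x : Γ} (hx : x ∈ P) :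
    ∃ t ∈ Set.Ioc a (a + ℓ), γ t = x := by
  obtain ⟨t, ht, rfl⟩ := h.exists_mem_Ico a hx
  rcases ht.1.eq_or_lt with rfl | h1
  · exact ⟨a + ℓ, ⟨by linarith [h.pos], le_rfl⟩, h.periodic a⟩
  · exact ⟨t, ⟨h1, ht.2.le⟩, rfl⟩

lemma reverse (h : IsCircleParam P ℓ γ) : IsCircleParam P ℓ fun t => γ (-t) where
  pos := h.pos
  range_eq := by
    rw [← h.range_eq]
    exact (Equiv.neg ℝ).surjective.range_comp γ
  dist_eq s t := by
    rw [h.dist_eq, show -s - -t = -(s - t) by ring, AddCircle.coe_neg, norm_neg]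

/-- The arcs of a cycle with gates are cut out by open sets. -/
lemma exists_isOpen (h : IsCircleParam P ℓ γ) {π : Γ → Γ} (hπ : IsGate P π) {w : ℝ} (hw0 : 0 < w)
    (hw : w ≤ ℓ) : ∃ S, IsOpen S ∧ frontier S = {γ 0, γ w} ∧ (∀ t ∈ Set.Icc w ℓ, γ t ∉ S) ∧
      ∀ t ∈ Set.Ioo 0 w, γ t ∈ S := by
  -- W removes the complementary closed arc. Its preimage under the gate map contains with each
  -- point of the open arc everything attached there, so the boundary stays on the cycle.
  set W : Set Γ := (γ '' Set.Icc w ℓ)ᶜ with hW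
  have hWo : IsOpen W := (isCompact_Icc.image h.continuous).isClosed.isOpen_compl
  have hWP : W ∩ P = γ '' Set.Ioo 0 w := by
    ext x
    constructor
    · rintro ⟨hxW, hxP⟩
      obtain ⟨t, ht, rfl⟩ := h.exists_mem_Ioc 0 hxP
      refine ⟨t, ⟨ht.1, lt_of_not_ge fun hwt => hxW ⟨t, ⟨hwt, by linarith [ht.2]⟩, rfl⟩⟩, rfl⟩
    · rintro ⟨t, ht, rfl⟩
      refine ⟨?_, h.mem t⟩
      rintro ⟨s, hs, hst⟩
      have := h.eq_of_abs_lt (by rw [abs_of_nonneg (by linarith [ht.2, hs.1])]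
                                 linarith [hs.2, ht.1]) hst
      linarith [ht.2, hs.1]
  have hcl : closure (γ '' Set.Ioo 0 w) = γ '' Set.Icc 0 w := by
    refine Set.Subset.antisymm ?_ ?_
    · exact closure_minimal (Set.image_mono Set.Ioo_subset_Icc_self)
        (isCompact_Icc.image h.continuous).isClosed
    · rw [← closure_Ioo hw0.ne]
      exact image_closure_subset_closure_image h.continuous
  refine ⟨π ⁻¹' W, hWo.preimage hπ.continuous, ?_, ?_, ?_⟩
  · rw [hπ.frontier_preimage hWo, hWP, hcl, hW, Set.sdiff_compl]
    ext x
    constructor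
    · rintro ⟨⟨s, hs, rfl⟩, t, ht, hst⟩
      rcases eq_or_ne s 0 with rfl | hs0
      · exact Or.inl rfl
      · have hs1 : 0 < s := lt_of_le_of_ne hs.1 hs0.symm
        have := h.eq_of_abs_lt (by rw [abs_of_nonneg (by linarith [hs.2, ht.1])]
                                   linarith [hs.1, ht.2]) hst
        have : s = w := by linarith [hs.2, ht.1]
        exact Or.inr (by rw [this]; rfl)
    · rintro (rfl | rfl)
      · exact ⟨⟨0, ⟨le_rfl, hw0.le⟩, rfl⟩, ℓ, ⟨hw, le_rfl⟩, by rw [← h.periodic 0, zero_add]⟩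
      · exact ⟨⟨w, ⟨hw0.le, le_rfl⟩, rfl⟩, w, ⟨le_rfl, hw⟩, rfl⟩
  · intro t ht hS
    rw [Set.mem_preimage, hπ.self _ (h.mem t)] at hS
    exact hS ⟨t, ht, rfl⟩
  · intro t ht
    rw [Set.mem_preimage, hπ.self _ (h.mem t)]
    exact (hWP.symm ▸ (⟨t, ht, rfl⟩ : γ t ∈ γ '' Set.Ioo 0 w) : γ t ∈ W ∩ P).1

end IsCircleParam

/-- `γ` parametrizes `P` by the interval `[0, L]`, by arc length. -/
structure IsIntervalParam {Γ : Type*} [MetricSpace Γ] (P : Set Γ) (L : ℝ) (γ : ℝ → Γ) : Prop where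
  pos : 0 < L
  image_eq : γ '' Set.Icc 0 L = P
  dist_eq : ∀ s ∈ Set.Icc 0 L, ∀ t ∈ Set.Icc 0 L, dist (γ s) (γ t) = |s - t|

namespace IsIntervalParam

variable {Γ : Type*} [MetricSpace Γ] {P : Set Γ} {L : ℝ} {γ : ℝ → Γ}

lemma continuousOn (h : IsIntervalParam P L γ) : ContinuousOn γ (Set.Icc 0 L) := by
  refine LipschitzOnWith.continuousOn (K := 1) (LipschitzOnWith.of_dist_le_mul fun x hx y hy => ?_)
  rw [NNReal.coe_one, one_mul, Real.dist_eq, h.dist_eq x hx y hy]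

lemma injOn (h : IsIntervalParam P L γ) : Set.InjOn γ (Set.Icc 0 L) := fun x hx y hy he => by
  have := h.dist_eq x hx y hy
  rw [he, dist_self, eq_comm, abs_eq_zero, sub_eq_zero] at this
  exact this

lemma mem (h : IsIntervalParam P L γ) {t : ℝ} (ht : t ∈ Set.Icc 0 L) : γ t ∈ P :=
  h.image_eq ▸ ⟨t, ht, rfl⟩

/-- An interior point of an edge with gates is the boundary of an open set. -/
lemma exists_isOpen (h : IsIntervalParam P L γ) {π : Γ → Γ} (hπ : IsGate P π) {τ : ℝ}
    (hτ : τ ∈ Set.Ioo 0 L) : ∃ S, IsOpen S ∧ frontier S = {γ τ} ∧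
      ∀ t ∈ Set.Icc 0 L, γ t ∈ S ↔ τ < t := by
  have hL := h.pos
  -- On P this is the part of the edge beyond γ τ; the gate map extends the cut to the whole graph.
  set W : Set Γ := {x | τ < dist x (γ 0)} with hW
  have hWo : IsOpen W := isOpen_lt continuous_const (by fun_prop)
  have hd : ∀ t ∈ Set.Icc 0 L, dist (γ t) (γ 0) = t := fun t ht => by
    rw [h.dist_eq t ht 0 ⟨le_rfl, hL.le⟩, sub_zero, abs_of_nonneg ht.1]
  have hm : τ ∈ Set.Icc 0 L := ⟨hτ.1.le, hτ.2.le⟩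
  have hWt : ∀ t ∈ Set.Icc 0 L, γ t ∈ W ↔ τ < t := fun t ht => by
    show τ < dist (γ t) (γ 0) ↔ _
    rw [hd t ht]
  refine ⟨π ⁻¹' W, hWo.preimage hπ.continuous, ?_, fun t ht => ?_⟩
  · rw [hπ.frontier_preimage hWo]
    ext x
    constructor
    · rintro ⟨hx, hxW⟩
      have hxP : x ∈ P := hπ.isClosed.closure_subset_iff.2 Set.inter_subset_right hx
      obtain ⟨t, ht, rfl⟩ := h.image_eq.symm ▸ hxP
      have h1 : closure (W ∩ P) ⊆ {x | τ ≤ dist x (γ 0)} :=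
        closure_minimal (fun y hy => show τ ≤ dist y (γ 0) from le_of_lt hy.1)
          (isClosed_le continuous_const (by fun_prop))
      have h2 : τ ≤ dist (γ t) (γ 0) := h1 hx
      rw [hd t ht] at h2
      rw [hWt t ht] at hxW
      rw [Set.mem_singleton_iff, show t = τ by linarith]
    · rintro rfl
      refine ⟨?_, fun h => lt_irrefl _ ((hWt _ hm).1 h)⟩
      have h1 : γ '' closure (Set.Ioo τ L) ⊆ closure (γ '' Set.Ioo τ L) := by
        refine ContinuousOn.image_closure (h.continuousOn.mono ?_)
        rw [closure_Ioo hτ.2.ne]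
        exact Set.Icc_subset_Icc hm.1 le_rfl
      rw [closure_Ioo hτ.2.ne] at h1
      refine closure_mono ?_ (h1 ⟨τ, ⟨le_rfl, hm.2⟩, rfl⟩)
      rintro _ ⟨t, ht, rfl⟩
      have ht' : t ∈ Set.Icc 0 L := ⟨by linarith [ht.1, hm.1], ht.2.le⟩
      exact ⟨(hWt t ht').2 ht.1, h.mem ht'⟩
  · rw [Set.mem_preimage, hπ.self _ (h.mem ht), hWt t ht]

end IsIntervalParam

/-! ### Flatness for the geodesic metric -/

section Field

variable {Γ : Type*} [MetricSpace Γ] {Ω : Type*} [MeasurableSpace Ω] {μ : Measure Ω}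
  [IsProbabilityMeasure μ] {X : Γ → Ω → ℝ} {r : ℝ → ℝ} {P : Set Γ} {π : Γ → Γ} {γ : ℝ → Γ}

/-- The covariance along a cycle is a Markov kernel. -/
lemma IsMarkovOrderOne.markovKernel_cycle (hM : IsMarkovOrderOne μ X)
    (hX : IsGaussianProcess X μ) (hXm : ∀ s, Measurable (X s))
    (hcov : ∀ s t : Γ, cov[X s, X t; μ] = r (dist s t)) (h0 : 0 < r 0) (hπ : IsGate P π) {ℓ : ℝ}
    (hγ : IsCircleParam P ℓ γ) : MarkovKernel (fun x => r ‖(x : AddCircle ℓ)‖) ℓ := by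
  refine hM.markovKernel hX hXm (γ := γ) hγ.pos hγ.continuous.continuousOn ?_ ?_ ?_
  · intro x _ y _
    rw [hcov, hγ.dist_eq, AddCircle.norm_coe_abs]
  · simpa using h0
  · intro w t hw hwt htℓ
    obtain ⟨S, hS, hf, h1, h2⟩ := hγ.exists_isOpen hπ hw (hwt.trans htℓ)
    exact ⟨S, hS, hf, h1 t ⟨hwt, htℓ⟩, h2⟩

/-- The covariance along an edge with gates is multiplicative. -/
lemma IsMarkovOrderOne.multiplicative_edge (hM : IsMarkovOrderOne μ X)
    (hX : IsGaussianProcess X μ) (hXm : ∀ s, Measurable (X s))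
    (hcov : ∀ s t : Γ, cov[X s, X t; μ] = r (dist s t)) (h0 : 0 < r 0) (hπ : IsGate P π) {L : ℝ}
    (hγ : IsIntervalParam P L γ) : ∀ s ∈ Set.Icc 0 (L / 2), r (2 * s) * r 0 = r s ^ 2 := by
  intro s hs
  have hL := hγ.pos
  rcases hs.1.eq_or_lt with rfl | hs0
  · rw [mul_zero]; ring
  obtain ⟨S, hSo, hfr, hSt⟩ := hγ.exists_isOpen hπ (τ := L / 2) ⟨by linarith, by linarith⟩
  -- The one boundary point is entered twice, with weight 0 on the second copy.
  rw [← Set.pair_eq_singleton] at hfr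
  have hm : L / 2 ∈ Set.Icc 0 L := ⟨by linarith, by linarith⟩
  have m1 : L / 2 + s ∈ Set.Icc 0 L := ⟨by linarith, by linarith [hs.2]⟩
  have m2 : L / 2 - s ∈ Set.Icc 0 L := ⟨by linarith [hs.2], by linarith⟩
  have hcc : ∀ x ∈ Set.Icc 0 L, ∀ y ∈ Set.Icc 0 L, cov[X (γ x), X (γ y); μ] = r |x - y| :=
    fun x hx y hy => by rw [hcov, hγ.dist_eq x hx y hy]
  have e1 : |L / 2 + s - L / 2| = s := by rw [add_sub_cancel_left, abs_of_pos hs0]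
  have e2 : |L / 2 - (L / 2 - s)| = s := by rw [sub_sub_cancel, abs_of_pos hs0]
  have e3 : |L / 2 + s - (L / 2 - s)| = 2 * s := by
    rw [show L / 2 + s - (L / 2 - s) = 2 * s by ring, abs_of_pos (by linarith)]
  have h1 : cov[X (γ (L / 2 + s)), X (γ (L / 2)); μ]
      = r s / r 0 * cov[X (γ (L / 2)), X (γ (L / 2)); μ]
        + 0 * cov[X (γ (L / 2)), X (γ (L / 2)); μ] := by
    rw [hcc _ m1 _ hm, hcc _ hm _ hm, e1, sub_self, abs_zero]
    field_simp
    ring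
  have h2 := hM.cov_eq hX hXm hSo hfr (s := γ (L / 2 + s)) (t := γ (L / 2 - s))
    (subset_closure ((hSt _ m1).2 (by linarith))) (fun h => by linarith [(hSt _ m2).1 h]) h1 h1
  rw [hcc _ m1 _ m2, hcc _ hm _ m2, e2, e3] at h2
  rw [h2]
  field_simp
  ring

/-- With the geodesic metric, a Markov covariance is flat if there are a cycle and an edge. -/
lemma IsMarkovOrderOne.flat_of_cycle_edge (hM : IsMarkovOrderOne μ X)
    (hX : IsGaussianProcess X μ) (hXm : ∀ s, Measurable (X s))
    (hcov : ∀ s t : Γ, cov[X s, X t; μ] = r (dist s t)) (h0 : 0 < r 0) (hπ : IsGate P π) {ℓ : ℝ}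
    (hγ : IsCircleParam P ℓ γ) (hmul : ∃ ε > 0, ∀ s ∈ Set.Icc 0 ε, r (2 * s) * r 0 = r s ^ 2) :
    ∃ ε > 0, ∀ x ∈ Set.Icc 0 ε, r x = r 0 := by
  have hK := hM.markovKernel_cycle hX hXm hcov h0 hπ hγ
  have hp := hγ.pos
  have hn : ∀ x ∈ Set.Icc 0 (ℓ / 2), ‖(x : AddCircle ℓ)‖ = x := fun x hx => by
    rw [AddCircle.norm_coe_eq_of_le hp (by rw [abs_of_nonneg hx.1]; exact hx.2),
      abs_of_nonneg hx.1]
  obtain ⟨ε, hε, hm⟩ := hmul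
  -- With s ≤ ℓ / 4 the distance 2s stays within half of the circumference, where the norm of the
  -- circle is the identity.
  obtain ⟨η, hη, hf⟩ := hK.flat_of_multiplicative (by simp [AddCircle.coe_period]) ⟨min ε (ℓ / 4),
    lt_min hε (by linarith), fun s hs => by
      have h1 := hs.2.trans (min_le_left _ _)
      have h2 := hs.2.trans (min_le_right _ _)
      rw [hn s ⟨hs.1, by linarith⟩, hn (2 * s) ⟨by linarith [hs.1], by linarith⟩,
        hn 0 ⟨le_rfl, by linarith⟩]
      exact hm s ⟨hs.1, h1⟩⟩
  refine ⟨min η (ℓ / 2), lt_min hη (by linarith), fun x hx => ?_⟩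
  have := hf x ⟨hx.1, hx.2.trans (min_le_left _ _)⟩
  rwa [hn x ⟨hx.1, hx.2.trans (min_le_right _ _)⟩, hn 0 ⟨le_rfl, by linarith⟩] at this

/-- With the geodesic metric, a Markov covariance is flat if there are two cycles of different
lengths. -/
lemma IsMarkovOrderOne.flat_of_cycle_cycle (hM : IsMarkovOrderOne μ X)
    (hX : IsGaussianProcess X μ) (hXm : ∀ s, Measurable (X s))
    (hcov : ∀ s t : Γ, cov[X s, X t; μ] = r (dist s t)) (h0 : 0 < r 0) (hπ : IsGate P π) {ℓ : ℝ}
    (hγ : IsCircleParam P ℓ γ) {P' : Set Γ} {π' : Γ → Γ} {γ' : ℝ → Γ} {ℓ' : ℝ}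
    (hπ' : IsGate P' π') (hγ' : IsCircleParam P' ℓ' γ') (hlt : ℓ < ℓ') :
    ∃ ε > 0, ∀ x ∈ Set.Icc 0 ε, r x = r 0 := by
  have hK := hM.markovKernel_cycle hX hXm hcov h0 hπ hγ
  have hK' := hM.markovKernel_cycle hX hXm hcov h0 hπ' hγ'
  have hp := hγ.pos
  have hp' := hγ'.pos
  have hn : ∀ x ∈ Set.Icc 0 (ℓ / 2), ‖(x : AddCircle ℓ)‖ = x := fun x hx => by
    rw [AddCircle.norm_coe_eq_of_le hp (by rw [abs_of_nonneg hx.1]; exact hx.2),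
      abs_of_nonneg hx.1]
  have hn' : ∀ x ∈ Set.Icc 0 (ℓ / 2), ‖(x : AddCircle ℓ')‖ = x := fun x hx => by
    rw [AddCircle.norm_coe_eq_of_le hp' (by rw [abs_of_nonneg hx.1]; linarith [hx.2]),
      abs_of_nonneg hx.1]
  obtain ⟨η, hη, hf⟩ := hK.flat_of_length_lt hK' hlt (by simp [AddCircle.coe_period])
    (fun x _ => by rw [AddCircle.norm_coe_sub_period])
    ⟨ℓ / 2, by linarith, fun x hx => by rw [hn x hx, hn' x hx]⟩
  refine ⟨min η (ℓ / 2), lt_min hη (by linarith), fun x hx => ?_⟩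
  have := hf x ⟨hx.1, hx.2.trans (min_le_left _ _)⟩
  rwa [hn' x ⟨hx.1, hx.2.trans (min_le_right _ _)⟩, hn' 0 ⟨le_rfl, by linarith⟩] at this

end Field

/-! ### The resistance metric on an edge -/

namespace MetricGraph

variable {Γ : Type*} [MetricSpace Γ] (G : MetricGraph Γ)

lemma conductance_comm (u v : G.vertices) : G.conductance u v = G.conductance v u := by
  by_cases h : G.graph.Adj u v
  · rw [conductance, conductance, if_pos h, if_pos h.symm, dist_comm]
  · rw [conductance, conductance, if_neg h, if_neg fun h' => h h'.symm]

lemma conductance_self (u : G.vertices) : G.conductance u u = 0 := by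
  simp [conductance]

lemma conductance_nonneg (u v : G.vertices) : 0 ≤ G.conductance u v := by
  rw [conductance]; split_ifs <;> positivity

lemma HasEuclideanEdges.conductance_pos {G : MetricGraph Γ} {u v : G.vertices}
    (h : G.graph.Adj u v) : 0 < G.conductance u v := by
  have : 0 < dist (u : Γ) v := dist_pos.2 fun e => h.1 (Subtype.ext e)
  rw [conductance, if_pos h]
  positivity

open Classical in
lemma laplacian_mulVec (v₀ : G.vertices) (g : G.vertices → ℝ) (u : G.vertices) :
    (G.laplacian v₀).mulVec g u
      = (if u = v₀ then g u else 0) + ∑ w, G.conductance u w * (g u - g w) := by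
  have h : ∀ w, G.laplacian v₀ u w * g w
      = (if u = w then ((if u = v₀ then 1 else 0) + ∑ w, G.conductance u w) * g u else 0)
        - G.conductance u w * g w := by
    intro w
    rw [laplacian]
    split_ifs with h1 h2
    · subst h1; rw [G.conductance_self]; ring
    · subst h1; rw [G.conductance_self]; ring
    · ring
  simp only [Matrix.mulVec, dotProduct, h, Finset.sum_sub_distrib, Finset.sum_ite_eq,
    Finset.mem_univ, if_true, mul_sub, ← Finset.sum_mul]
  split_ifs <;> ring

/-- A function on the vertices which takes equal values at the ends of every edge is constant. -/
lemma eq_of_forall_edge_ends (g : G.vertices → ℝ)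
    (h : ∀ e, g ⟨G.src e, G.curve_zero_mem e⟩ = g ⟨G.tgt e, G.curve_len_mem e⟩)
    (u v : G.vertices) : g u = g v := by
  classical
  have hch : ∀ x, x ∉ G.vertices → ∃ e, x ∈ G.openEdge e := fun x => G.exists_mem_openEdge
  set F : Γ → ℝ := fun x => if hx : x ∈ G.vertices then g ⟨x, hx⟩ else
    g ⟨G.src (hch x hx).choose, G.curve_zero_mem _⟩ with hF
  have hFv : ∀ w : G.vertices, F w = g w := fun w => by simp [hF, w.2]
  have key : ∀ e, ∀ a ∈ Set.Icc 0 (G.len e), F (G.curve e a) = g ⟨G.src e, G.curve_zero_mem e⟩ := by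
    intro e a ha
    by_cases hx : G.curve e a ∈ G.vertices
    · rcases ha.1.eq_or_lt with rfl | h0
      · exact hFv ⟨G.src e, G.curve_zero_mem e⟩
      rcases ha.2.eq_or_lt with rfl | h1
      · rw [h e]; exact hFv ⟨G.tgt e, G.curve_len_mem e⟩
      exact absurd hx (G.curve_interior e a ⟨h0, h1⟩)
    · have he : (hch _ hx).choose = e :=
        G.eq_of_mem_openEdge_edgeSet (hch _ hx).choose_spec ⟨a, ha, rfl⟩
      simp only [hF, hx, dif_neg, not_false_eq_true, he]
  rw [← hFv, ← hFv]
  exact G.eq_of_forall_edge (fun e a ha b hb => by rw [key e a ha, key e b hb]) _ _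

variable {G}

-- The quadratic form is g(v₀)² plus the energy of g over the edges. If it vanishes, g is constant
-- by connectedness, and the added diagonal entry makes the constant 0.
open Classical in
lemma HasEuclideanEdges.isUnit_laplacian (hG : G.HasEuclideanEdges) (v₀ : G.vertices) :
    IsUnit (G.laplacian v₀) := by
  rw [← Matrix.mulVec_injective_iff_isUnit]
  refine (injective_iff_map_eq_zero (G.laplacian v₀).mulVecLin).2 fun g hg => ?_
  have h0 : ∀ u, (if u = v₀ then g u else 0) + ∑ w, G.conductance u w * (g u - g w) = 0 := by
    intro u
    rw [← G.laplacian_mulVec v₀ g u]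
    exact congrFun hg u
  have h1 : g v₀ ^ 2 + ∑ u, ∑ w, G.conductance u w * (g u - g w) * g u = 0 := by
    have : ∑ u, g u * ((if u = v₀ then g u else 0) + ∑ w, G.conductance u w * (g u - g w)) = 0 :=
      Finset.sum_eq_zero fun u _ => by rw [h0 u, mul_zero]
    rw [← this]
    simp only [mul_add, mul_ite, mul_zero, Finset.sum_add_distrib, Finset.sum_ite_eq',
      Finset.mem_univ, if_true, Finset.mul_sum]
    rw [sq]
    congr 1
    exact Finset.sum_congr rfl fun u _ => Finset.sum_congr rfl fun w _ => by ring
  have h2 : ∑ u, ∑ w, G.conductance u w * (g u - g w) * g u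
      = (∑ u, ∑ w, G.conductance u w * (g u - g w) ^ 2) / 2 := by
    have h3 : ∑ u, ∑ w, G.conductance u w * (g u - g w) * g u
        = -∑ u, ∑ w, G.conductance u w * (g u - g w) * g w := by
      rw [Finset.sum_comm, ← Finset.sum_neg_distrib]
      refine Finset.sum_congr rfl fun u _ => ?_
      rw [← Finset.sum_neg_distrib]
      refine Finset.sum_congr rfl fun w _ => ?_
      rw [G.conductance_comm]; ring
    have h4 : ∑ u, ∑ w, G.conductance u w * (g u - g w) ^ 2
        = ∑ u, ∑ w, G.conductance u w * (g u - g w) * g u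
          - ∑ u, ∑ w, G.conductance u w * (g u - g w) * g w := by
      rw [← Finset.sum_sub_distrib]
      refine Finset.sum_congr rfl fun u _ => ?_
      rw [← Finset.sum_sub_distrib]
      exact Finset.sum_congr rfl fun w _ => by ring
    linarith
  have hnn : ∀ u w, 0 ≤ G.conductance u w * (g u - g w) ^ 2 := fun u w =>
    mul_nonneg (G.conductance_nonneg u w) (sq_nonneg _)
  have h5 : 0 ≤ ∑ u, ∑ w, G.conductance u w * (g u - g w) ^ 2 :=
    Finset.sum_nonneg fun u _ => Finset.sum_nonneg fun w _ => hnn u w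
  have h6 : g v₀ = 0 := by
    have : g v₀ ^ 2 ≤ 0 := by linarith
    exact pow_eq_zero_iff two_ne_zero |>.1 (le_antisymm this (sq_nonneg _))
  have h7 : ∑ u, ∑ w, G.conductance u w * (g u - g w) ^ 2 = 0 := by nlinarith [sq_nonneg (g v₀)]
  have h8 : ∀ u w, G.graph.Adj u w → g u = g w := by
    intro u w hadj
    have a1 := (Finset.sum_eq_zero_iff_of_nonneg fun u _ =>
      Finset.sum_nonneg fun w _ => hnn u w).1 h7 u (Finset.mem_univ _)
    have a2 := (Finset.sum_eq_zero_iff_of_nonneg fun w _ => hnn u w).1 a1 w (Finset.mem_univ _)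
    have a3 := HasEuclideanEdges.conductance_pos hadj
    rcases mul_eq_zero.1 a2 with h | h
    · exact absurd h a3.ne'
    · exact sub_eq_zero.1 (pow_eq_zero_iff two_ne_zero |>.1 h)
  ext u
  rw [Pi.zero_apply, ← h6]
  refine G.eq_of_forall_edge_ends g (fun e => h8 _ _ ⟨fun h => hG.no_loop e ?_, e, rfl⟩) u v₀
  exact congrArg Subtype.val h

variable (G)

/-- `g` is a potential for the unit current from the vertex `a` to the vertex `b`. -/
def IsPotential (a b : G.vertices) (g : G.vertices → ℝ) : Prop :=
  open Classical in ∀ p, ∑ w, G.conductance p w * (g p - g w)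
    = (if p = a then 1 else 0) - (if p = b then 1 else 0)

variable {G}

-- After subtraction of g v₀ the added diagonal entry acts trivially. Thus a potential replaces the
-- inverse of the Laplacian, which never has to be computed.
open Classical in
lemma IsPotential.inv_mulVec (hG : G.HasEuclideanEdges) (v₀ : G.vertices) {a b : G.vertices}
    {g : G.vertices → ℝ} (hg : G.IsPotential a b g) :
    ((G.laplacian v₀)⁻¹).mulVec (Pi.single a 1 - Pi.single b 1) = fun u => g u - g v₀ := by
  have h1 : (G.laplacian v₀).mulVec (fun u => g u - g v₀) = Pi.single a 1 - Pi.single b 1 := by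
    ext u
    rw [laplacian_mulVec]
    simp only [sub_sub_sub_cancel_right, Pi.sub_apply, Pi.single_apply]
    rw [hg u]
    split_ifs with h <;> simp_all
  rw [← h1, Matrix.mulVec_mulVec, Matrix.nonsing_inv_mul _
    ((Matrix.isUnit_iff_isUnit_det _).1 (hG.isUnit_laplacian v₀)), Matrix.one_mulVec]

open Classical in
lemma laplacian_isSymm (v₀ : G.vertices) : (G.laplacian v₀).transpose = G.laplacian v₀ := by
  ext u w
  rw [Matrix.transpose_apply, laplacian, laplacian]
  by_cases h : u = w
  · subst h; rfl
  · rw [if_neg h, if_neg (Ne.symm h), G.conductance_comm]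

open Classical in
lemma covVertexPart_eq (v₀ : G.vertices) (s t : Γ) : G.covVertexPart v₀ s t
    = G.interpWeight s ⬝ᵥ ((G.laplacian v₀)⁻¹).mulVec (G.interpWeight t) := by
  simp only [covVertexPart, dotProduct, Matrix.mulVec, Finset.mul_sum, mul_assoc]

open Classical in
lemma covVertexPart_comm (v₀ : G.vertices) (s t : Γ) :
    G.covVertexPart v₀ s t = G.covVertexPart v₀ t s := by
  rw [covVertexPart_eq, covVertexPart_eq, Matrix.dotProduct_mulVec, ← Matrix.mulVec_transpose,
    Matrix.transpose_nonsing_inv, laplacian_isSymm, dotProduct_comm]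

open Classical in
lemma HasEuclideanEdges.interpWeight_curve (hG : G.HasEuclideanEdges) (e : Fin G.numEdges) {x : ℝ}
    (hx : x ∈ Set.Ioo 0 (G.len e)) : G.interpWeight (G.curve e x)
      = (1 - x / G.len e) • Pi.single (⟨G.src e, G.curve_zero_mem e⟩ : G.vertices) 1
        + (x / G.len e) • Pi.single (⟨G.tgt e, G.curve_len_mem e⟩ : G.vertices) 1 := by
  have hl := G.len_pos e
  have hd : dist (G.curve e x) (G.src e) = x := by
    rw [src, hG.dist_curve e ⟨hx.1.le, hx.2.le⟩ ⟨le_rfl, hl.le⟩, sub_zero, abs_of_pos hx.1]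
  ext v
  rw [interpWeight, if_neg (G.curve_interior e x hx), Finset.sum_eq_single e]
  · rw [if_pos ⟨x, ⟨hx.1.le, hx.2.le⟩, rfl⟩, hd, hG.dist_eq_len e]
    simp only [Pi.add_apply, Pi.smul_apply, Pi.single_apply, smul_eq_mul, Subtype.ext_iff,
      eq_comm]
  · intro e' _ hne
    rw [if_neg]
    exact fun h => hne (G.eq_of_mem_openEdge_edgeSet ⟨x, hx, rfl⟩ h).symm
  · simp

lemma HasEuclideanEdges.sum_covBridge (hG : G.HasEuclideanEdges) (e : Fin G.numEdges) {x y : ℝ}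
    (hx : x ∈ Set.Ioo 0 (G.len e)) (hy : y ∈ Set.Ioo 0 (G.len e)) :
    ∑ e', G.covBridge e' (G.curve e x) (G.curve e y) = min x y - x * y / G.len e := by
  have hl := G.len_pos e
  have hd : ∀ x ∈ Set.Ioo 0 (G.len e), dist (G.curve e x) (G.src e) = x := fun x hx => by
    rw [src, hG.dist_curve e ⟨hx.1.le, hx.2.le⟩ ⟨le_rfl, hl.le⟩, sub_zero, abs_of_pos hx.1]
  rw [Finset.sum_eq_single e]
  · rw [covBridge, if_pos ⟨⟨x, ⟨hx.1.le, hx.2.le⟩, rfl⟩, ⟨y, ⟨hy.1.le, hy.2.le⟩, rfl⟩⟩, hd x hx,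
      hd y hy]
  · intro e' _ hne
    rw [covBridge, if_neg]
    exact fun h => hne (G.eq_of_mem_openEdge_edgeSet ⟨x, hx, rfl⟩ h.1).symm
  · simp

lemma resistanceDist_self (v₀ : G.vertices) (s : Γ) : G.resistanceDist v₀ s s = 0 := by
  rw [resistanceDist]; ring

/-- The resistance metric on an edge. -/
lemma HasEuclideanEdges.exists_resistanceDist_curve (hG : G.HasEuclideanEdges) (v₀ : G.vertices)
    (e : Fin G.numEdges) : ∃ K : ℝ, (∀ x ∈ Set.Ioo 0 (G.len e), ∀ y ∈ Set.Ioo 0 (G.len e),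
      G.resistanceDist v₀ (G.curve e x) (G.curve e y) = |x - y| - K * |x - y| ^ 2) ∧
      ∀ g, G.IsPotential ⟨G.src e, G.curve_zero_mem e⟩ ⟨G.tgt e, G.curve_len_mem e⟩ g →
        K = 1 / G.len e - (g ⟨G.src e, G.curve_zero_mem e⟩ - g ⟨G.tgt e, G.curve_len_mem e⟩)
          / G.len e ^ 2 := by
  classical
  have hl := G.len_pos e
  set a : G.vertices := ⟨G.src e, G.curve_zero_mem e⟩ with ha
  set b : G.vertices := ⟨G.tgt e, G.curve_len_mem e⟩ with hb
  set δ : G.vertices → ℝ := Pi.single a 1 - Pi.single b 1 with hδ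
  -- The effective resistance between the ends of e. The interpolated part of Z contributes (x-y)² R
  -- / len² to the variogram, the bridge |x-y| - (x-y)² / len.
  set R : ℝ := δ ⬝ᵥ ((G.laplacian v₀)⁻¹).mulVec δ with hR
  refine ⟨1 / G.len e - R / G.len e ^ 2, fun x hx y hy => ?_, fun g hg => ?_⟩
  · have hw : G.interpWeight (G.curve e x) - G.interpWeight (G.curve e y)
        = ((y - x) / G.len e) • δ := by
      rw [hG.interpWeight_curve e hx, hG.interpWeight_curve e hy, hδ]
      ext v
      simp only [Pi.sub_apply, Pi.add_apply, Pi.smul_apply, smul_eq_mul]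
      ring
    have hq : G.covVertexPart v₀ (G.curve e x) (G.curve e x)
        + G.covVertexPart v₀ (G.curve e y) (G.curve e y)
        - 2 * G.covVertexPart v₀ (G.curve e x) (G.curve e y) = ((y - x) / G.len e) ^ 2 * R := by
      have h1 : (G.interpWeight (G.curve e x) - G.interpWeight (G.curve e y)) ⬝ᵥ
          ((G.laplacian v₀)⁻¹).mulVec
            (G.interpWeight (G.curve e x) - G.interpWeight (G.curve e y))
          = ((y - x) / G.len e) ^ 2 * R := by
        rw [hw, Matrix.mulVec_smul, smul_dotProduct, dotProduct_smul, hR, smul_eq_mul, smul_eq_mul]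
        ring
      have h2 : (G.interpWeight (G.curve e x) - G.interpWeight (G.curve e y)) ⬝ᵥ
          ((G.laplacian v₀)⁻¹).mulVec
            (G.interpWeight (G.curve e x) - G.interpWeight (G.curve e y))
          = G.covVertexPart v₀ (G.curve e x) (G.curve e x)
            - G.covVertexPart v₀ (G.curve e x) (G.curve e y)
            - (G.covVertexPart v₀ (G.curve e y) (G.curve e x)
            - G.covVertexPart v₀ (G.curve e y) (G.curve e y)) := by
        simp only [covVertexPart_eq, Matrix.mulVec_sub, sub_dotProduct, dotProduct_sub]
        ring
      rw [covVertexPart_comm v₀ (G.curve e y) (G.curve e x)] at h2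
      linarith
    have hmin : x + y - 2 * min x y = |x - y| := by
      rcases le_total x y with h | h
      · rw [min_eq_left h, abs_of_nonpos (by linarith)]; ring
      · rw [min_eq_right h, abs_of_nonneg (by linarith)]; ring
    rw [resistanceDist, covZ, covZ, covZ, hG.sum_covBridge e hx hx, hG.sum_covBridge e hy hy,
      hG.sum_covBridge e hx hy, min_self, min_self, sq_abs]
    have h3 : x - x * x / G.len e + (y - y * y / G.len e) - 2 * (min x y - x * y / G.len e)
        = |x - y| - (x - y) ^ 2 / G.len e := by
      rw [← hmin]; ring
    have h4 : |x - y| - (1 / G.len e - R / G.len e ^ 2) * (x - y) ^ 2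
        = ((y - x) / G.len e) ^ 2 * R + (|x - y| - (x - y) ^ 2 / G.len e) := by
      field_simp
      ring
    rw [h4, ← hq, ← h3]
    ring
  · have : R = g a - g b := by
      have h1 : ((G.laplacian v₀)⁻¹).mulVec δ = fun u => g u - g v₀ := hg.inv_mulVec hG v₀
      rw [hR, h1, hδ, sub_dotProduct, single_dotProduct, single_dotProduct]
      ring
    rw [this]

end MetricGraph

/-! ### The resistance metric on a cycle and on a bridge -/

namespace MetricGraph

variable {Γ : Type*} [MetricSpace Γ] {G : MetricGraph Γ}

lemma eq_src_or_eq_tgt {e : Fin G.numEdges} {x : Γ} (hx : x ∈ G.edgeSet e) (hv : x ∈ G.vertices) :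
    x = G.src e ∨ x = G.tgt e := by
  obtain ⟨t, ht, rfl⟩ := hx
  rcases ht.1.eq_or_lt with rfl | h0
  · exact Or.inl rfl
  rcases ht.2.eq_or_lt with rfl | h1
  · exact Or.inr rfl
  exact absurd hv (G.curve_interior e t ⟨h0, h1⟩)

/-- Two points of an edge at the same distance from an end of the edge are equal. -/
lemma HasEuclideanEdges.eq_of_dist_eq (hG : G.HasEuclideanEdges) {e : Fin G.numEdges} {p x y : Γ}
    (hp : p = G.src e ∨ p = G.tgt e) (hx : x ∈ G.edgeSet e) (hy : y ∈ G.edgeSet e)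
    (h : dist x p = dist y p) : x = y := by
  obtain ⟨s, hs, rfl⟩ := hx
  obtain ⟨t, ht, rfl⟩ := hy
  have hl := (G.len_pos e).le
  rcases hp with rfl | rfl
  · rw [src, hG.dist_curve e hs ⟨le_rfl, hl⟩, hG.dist_curve e ht ⟨le_rfl, hl⟩, sub_zero, sub_zero,
      abs_of_nonneg hs.1, abs_of_nonneg ht.1] at h
    rw [h]
  · rw [tgt, hG.dist_curve e hs ⟨hl, le_rfl⟩, hG.dist_curve e ht ⟨hl, le_rfl⟩,
      abs_of_nonpos (by linarith [hs.2]), abs_of_nonpos (by linarith [ht.2])] at h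
    rw [show s = t by linarith]

/-- A point of an edge at a given distance from an end of the edge. -/
lemma HasEuclideanEdges.exists_dist_eq (hG : G.HasEuclideanEdges) {e : Fin G.numEdges} {p : Γ}
    (hp : p = G.src e ∨ p = G.tgt e) {s : ℝ} (hs : s ∈ Set.Ioo 0 (G.len e)) :
    ∃ x ∈ G.openEdge e, dist x p = s := by
  have hl := (G.len_pos e).le
  rcases hp with rfl | rfl
  · refine ⟨_, ⟨s, hs, rfl⟩, ?_⟩
    rw [src, hG.dist_curve e ⟨hs.1.le, hs.2.le⟩ ⟨le_rfl, hl⟩, sub_zero, abs_of_pos hs.1]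
  · refine ⟨_, ⟨G.len e - s, ⟨by linarith [hs.2], by linarith [hs.1]⟩, rfl⟩, ?_⟩
    rw [tgt, hG.dist_curve e ⟨by linarith [hs.2], by linarith [hs.1]⟩ ⟨hl, le_rfl⟩,
      abs_of_nonpos (by linarith [hs.1])]
    ring

lemma edgeSet_subset_of_openEdge_subset {e : Fin G.numEdges} {A : Set Γ} (hA : IsClosed A)
    (h : G.openEdge e ⊆ A) : G.edgeSet e ⊆ A := by
  rw [edgeSet, ← closure_arc e le_rfl (G.len_pos e) le_rfl]
  exact closure_minimal h hA

/-- The two end points of an edge which does not meet the interior of `P` have the same gate. -/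
lemma gate_src_eq_gate_tgt {P : Set Γ} {π : Γ → Γ} (hπ : IsGate P π) {e : Fin G.numEdges}
    (he : ∀ x ∈ G.openEdge e, x ∉ P) : π (G.src e) = π (G.tgt e) := by
  have hl := (G.len_pos e).le
  refine G.eq_on_edge e hπ.continuous.continuousOn (fun x hx => ?_) ⟨le_rfl, hl⟩ ⟨hl, le_rfl⟩
  have h1 : ContinuousWithinAt (G.curve e) (Set.Ioo 0 (G.len e)) x :=
    ((G.continuousOn_curve e) x ⟨hx.1.le, hx.2.le⟩).mono Set.Ioo_subset_Icc_self
  exact h1.eventually (hπ.eventually_eq (he _ ⟨x, hx, rfl⟩))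

/-- A continuous curve which meets no vertex stays in one open edge. -/
lemma exists_openEdge_of_notMem_vertices {γ : ℝ → Γ} {a b : ℝ} (hab : a < b)
    (hγ : ContinuousOn γ (Set.Ioo a b)) (hv : ∀ t ∈ Set.Ioo a b, γ t ∉ G.vertices) :
    ∃ e, ∀ t ∈ Set.Ioo a b, γ t ∈ G.openEdge e := by
  have hm : (a + b) / 2 ∈ Set.Ioo a b := ⟨by linarith, by linarith⟩
  obtain ⟨e, he⟩ := G.exists_mem_openEdge (hv _ hm)
  refine ⟨e, fun t ht => ?_⟩
  have h := isPreconnected_Ioo.induction₂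
    (fun t t' => ∀ e, γ t ∈ G.openEdge e ↔ γ t' ∈ G.openEdge e) (fun x hx => ?_)
    (fun _ _ _ _ _ _ h h' e => (h e).trans (h' e)) (fun _ _ _ _ h e => (h e).symm) hm ht
  · exact (h e).1 he
  · obtain ⟨e₀, he₀⟩ := G.exists_mem_openEdge (hv x hx)
    filter_upwards [(hγ x hx).eventually ((G.isOpen_openEdge e₀).mem_nhds he₀)] with y hy e
    exact ⟨fun h => G.eq_of_mem_openEdge he₀ h ▸ hy, fun h => G.eq_of_mem_openEdge hy h ▸ he₀⟩

end MetricGraph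

namespace IsCircleParam

variable {Γ : Type*} [MetricSpace Γ] {G : MetricGraph Γ} {P : Set Γ} {ℓ : ℝ} {γ : ℝ → Γ}

/-- An open edge which meets a cycle is contained in the cycle. -/
lemma openEdge_subset (hγ : IsCircleParam P ℓ γ) (hP : IsClosed P) (hG : G.HasEuclideanEdges)
    {e : Fin G.numEdges} {x : Γ} (hx : x ∈ G.openEdge e) (hxP : x ∈ P) : G.openEdge e ⊆ P := by
  have hp := hγ.pos
  obtain ⟨τ, hτ, rfl⟩ := hx
  rintro _ ⟨σ, hσ, rfl⟩
  -- Membership in P is locally constant along the open edge. Outside P this is closedness of P.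
  refine (isPreconnected_Ioo.induction₂ (fun s t => G.curve e s ∈ P ↔ G.curve e t ∈ P)
    (fun s hs => ?_) (fun _ _ _ _ _ _ => Iff.trans) (fun _ _ _ _ => Iff.symm) hτ hσ).1 hxP
  have hc : ContinuousWithinAt (G.curve e) (Set.Ioo 0 (G.len e)) s :=
    ((G.continuousOn_curve e) s ⟨hs.1.le, hs.2.le⟩).mono Set.Ioo_subset_Icc_self
  by_cases hsP : G.curve e s ∈ P
  · obtain ⟨θ, hθ⟩ := hγ.range_eq.symm ▸ hsP
    obtain ⟨ε, hε, hball⟩ := Metric.isOpen_iff.1 (G.isOpen_openEdge e) _ ⟨s, hs, rfl⟩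
    have hab : Filter.Tendsto (fun t => |t - s|) (𝓝[Set.Ioo 0 (G.len e)] s) (𝓝 0) := by
      have : Continuous fun t => |t - s| := by fun_prop
      simpa using (this.tendsto s).mono_left nhdsWithin_le_nhds
    filter_upwards [hab.eventually (Iio_mem_nhds (lt_min hε (by linarith : 0 < ℓ / 2)))] with t ht
    simp only [hsP, true_iff]
    set δ := |t - s| with hδ
    have hδ0 : 0 ≤ δ := abs_nonneg _
    have h1 : δ < ε := ht.trans_le (min_le_left _ _)
    have h2 : δ < ℓ / 2 := ht.trans_le (min_le_right _ _)
    -- The circle has two points at small distance δ from the common point, both in the open edge;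
    -- the edge has at most two such points, so these are the same.
    have key : ∀ η, |η| = δ → ∃ u ∈ Set.Ioo 0 (G.len e), G.curve e u = γ (θ + η) ∧ |u - s| = δ := by
      intro η hη
      have hd : dist (γ (θ + η)) (G.curve e s) = δ := by
        rw [← hθ, hγ.dist_eq_of_le (by rw [add_sub_cancel_left, hη]; exact h2.le),
          add_sub_cancel_left, hη]
      obtain ⟨u, hu, hue⟩ := hball (show γ (θ + η) ∈ Metric.ball _ ε by
        rw [Metric.mem_ball, hd]; exact h1)
      refine ⟨u, hu, hue, ?_⟩
      rw [← hG.dist_curve e ⟨hu.1.le, hu.2.le⟩ ⟨hs.1.le, hs.2.le⟩, hue, hd]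
    obtain ⟨u, _, hu1, hu2⟩ := key δ (abs_of_nonneg hδ0)
    obtain ⟨u', _, hu1', hu2'⟩ := key (-δ) (by rw [abs_neg, abs_of_nonneg hδ0])
    have h3 : t = u ∨ t = u' := by
      rcases hδ0.eq_or_lt with h0 | h0
      · rw [← h0, abs_eq_zero, sub_eq_zero] at hu2
        rw [← h0, eq_comm, abs_eq_zero, sub_eq_zero] at hδ
        exact Or.inl (hδ.trans hu2.symm)
      have hne : u ≠ u' := by
        rintro rfl
        have := hγ.eq_of_abs_lt (s := θ + δ) (t := θ + -δ)
          (by rw [show θ + δ - (θ + -δ) = 2 * δ by ring, abs_of_pos (by linarith)]; linarith)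
          (hu1.symm.trans hu1')
        linarith
      rcases abs_eq_abs.1 hu2 with h | h <;> rcases abs_eq_abs.1 hu2' with h' | h'
      · exact Or.inl (by linarith)
      · exact Or.inl (by linarith)
      · exact Or.inr (by linarith)
      · exact absurd (by linarith) hne
    rcases h3 with rfl | rfl
    · rw [hu1]; exact hγ.mem _
    · rw [hu1']; exact hγ.mem _
  · filter_upwards [hc.eventually (hP.isOpen_compl.mem_nhds hsP)] with t ht
    exact ⟨fun h => absurd h hsP, fun h => absurd h ht⟩

lemma infinite (hγ : IsCircleParam P ℓ γ) : P.Infinite :=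
  (Set.infinite_of_injOn_mapsTo (s := Set.Ico 0 ℓ) (f := γ)
    (fun s hs t ht h => hγ.eq_of_abs_lt (abs_lt.2 ⟨by linarith [hs.1, ht.2], by
      linarith [hs.2, ht.1]⟩) h) (fun t _ => hγ.mem t) (Set.Ico_infinite hγ.pos))

/-- The edge of a cycle which starts at a given vertex in a given direction. -/
lemma exists_arc (hγ : IsCircleParam P ℓ γ) (hG : G.HasEuclideanEdges) {θ : ℝ}
    (hθ : γ θ ∈ G.vertices) : ∃ a ∈ Set.Ioc 0 (ℓ / 2), ∃ e,
      s(G.src e, G.tgt e) = s(γ θ, γ (θ + a)) ∧ ∀ t ∈ Set.Ioo 0 a, γ (θ + t) ∈ G.openEdge e := by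
  have hp := hγ.pos
  -- T contains ℓ, since γ θ is itself a vertex; its least element a is the arc length to the next
  -- vertex.
  set T : Set ℝ := {t ∈ Set.Ioc 0 ℓ | γ (θ + t) ∈ G.vertices} with hT
  have hTf : T.Finite := by
    refine Set.Finite.of_injOn (f := fun t => γ (θ + t)) (t := (G.vertices : Set Γ))
      (fun t ht => ht.2) (fun s hs t ht h => ?_) G.vertices.finite_toSet
    have := hγ.eq_of_abs_lt (s := θ + s) (t := θ + t)
      (by rw [add_sub_add_left_eq_sub]
          exact abs_lt.2 ⟨by linarith [hs.1.1, ht.1.2], by linarith [hs.1.2, ht.1.1]⟩) h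
    linarith
  obtain ⟨a, haT, hmin⟩ := T.exists_min_image id hTf
    ⟨ℓ, ⟨hp, le_rfl⟩, show γ (θ + ℓ) ∈ _ by rwa [hγ.periodic]⟩
  have ha0 : 0 < a := haT.1.1
  have hcont : Continuous fun t => γ (θ + t) := hγ.continuous.comp (by fun_prop)
  obtain ⟨e, he⟩ := MetricGraph.exists_openEdge_of_notMem_vertices (G := G) ha0
    hcont.continuousOn (fun t ht h => by
      have : a ≤ t := hmin t ⟨⟨ht.1, ht.2.le.trans haT.1.2⟩, h⟩
      linarith [ht.2])
  have hcl : ∀ t ∈ Set.Icc 0 a, γ (θ + t) ∈ G.edgeSet e := by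
    intro t ht
    rw [← closure_Ioo ha0.ne] at ht
    exact closure_minimal (s := Set.Ioo 0 a) (t := {t | γ (θ + t) ∈ G.edgeSet e})
      (fun t ht => G.openEdge_subset e (he t ht))
      ((G.isCompact_edgeSet e).isClosed.preimage hcont) ht
  have h0 := hcl 0 ⟨le_rfl, ha0.le⟩
  rw [add_zero] at h0
  have ends0 := G.eq_src_or_eq_tgt h0 hθ
  have ends1 := G.eq_src_or_eq_tgt (hcl a ⟨ha0.le, le_rfl⟩) haT.2
  have ha2 : a ≤ ℓ / 2 := by
    by_contra hlt
    push Not at hlt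
    have hal := haT.1.2
    -- The midpoint of ℓ - a and ℓ / 2. If a > ℓ / 2, then t and ℓ - t are parameters of two points
    -- of the same edge at the same distance from its end γ θ, which is impossible.
    set t := 3 * ℓ / 4 - a / 2 with ht
    have e1 := G.openEdge_subset e (he t ⟨by linarith, by linarith⟩)
    have e2 := G.openEdge_subset e (he (ℓ - t) ⟨by linarith, by linarith⟩)
    have e3 := hG.eq_of_dist_eq ends0 e1 e2 (by
      rw [hγ.dist_eq, hγ.dist_eq, add_sub_cancel_left, add_sub_cancel_left,
        AddCircle.norm_coe_sub_period])
    have := hγ.eq_of_abs_lt (abs_lt.2 ⟨by linarith, by linarith⟩) e3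
    linarith
  refine ⟨a, ⟨ha0, ha2⟩, e, ?_, he⟩
  have hne : γ θ ≠ γ (θ + a) := fun h => by
    have := hγ.eq_of_abs_lt (abs_lt.2 ⟨by linarith, by linarith⟩) h
    linarith
  rcases ends0 with h | h <;> rcases ends1 with h' | h'
  · exact absurd (h.trans h'.symm) hne
  · rw [h, h']
  · rw [h, h', Sym2.eq_swap]
  · exact absurd (h.trans h'.symm) hne

end IsCircleParam

namespace MetricGraph

variable {Γ : Type*} [MetricSpace Γ] {G : MetricGraph Γ}

lemma HasEuclideanEdges.conductance_eq (hG : G.HasEuclideanEdges) {e : Fin G.numEdges}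
    {u w : G.vertices} (h : s(G.src e, G.tgt e) = s((u : Γ), (w : Γ))) :
    G.conductance u w = 1 / dist (u : Γ) w := by
  have hne : u ≠ w := by
    rintro rfl
    rcases Sym2.eq_iff.1 h with ⟨h1, h2⟩ | ⟨h1, h2⟩ <;> exact hG.no_loop e (h1.trans h2.symm)
  rw [conductance, if_pos ⟨hne, e, h⟩]

lemma eq_src_or_eq_tgt_of_eq {e : Fin G.numEdges} {x y : Γ} (h : s(G.src e, G.tgt e) = s(x, y)) :
    x = G.src e ∨ x = G.tgt e := by
  rcases Sym2.eq_iff.1 h with ⟨h1, h2⟩ | ⟨h1, h2⟩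
  · exact Or.inl h1.symm
  · exact Or.inr h2.symm

lemma mem_edgeSet_of_eq {e : Fin G.numEdges} {x y : Γ} (h : s(G.src e, G.tgt e) = s(x, y)) :
    x ∈ G.edgeSet e := by
  rcases eq_src_or_eq_tgt_of_eq h with rfl | rfl
  · exact ⟨0, ⟨le_rfl, (G.len_pos e).le⟩, rfl⟩
  · exact ⟨G.len e, ⟨(G.len_pos e).le, le_rfl⟩, rfl⟩

lemma gate_eq_gate {P : Set Γ} {π : Γ → Γ} (hπ : IsGate P π) {e : Fin G.numEdges} {x y : Γ}
    (h : s(G.src e, G.tgt e) = s(x, y)) (he : ∀ x ∈ G.openEdge e, x ∉ P) : π x = π y := by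
  rcases Sym2.eq_iff.1 h with ⟨rfl, rfl⟩ | ⟨rfl, rfl⟩
  · exact gate_src_eq_gate_tgt hπ he
  · exact (gate_src_eq_gate_tgt hπ he).symm

end MetricGraph

namespace IsCircleParam

variable {Γ : Type*} [MetricSpace Γ] {G : MetricGraph Γ} {P : Set Γ} {ℓ : ℝ} {γ : ℝ → Γ}
  {π : Γ → Γ}

/-- The Laplacian of a function of the gate at a vertex outside of the cycle. -/
lemma sum_conductance_of_notMem (hγ : IsCircleParam P ℓ γ) (hπ : IsGate P π)
    (hG : G.HasEuclideanEdges) {p : G.vertices} (hpP : (p : Γ) ∉ P) (F : Γ → ℝ) :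
    ∑ w, G.conductance p w * (F (π p) - F (π w)) = 0 := by
  refine Finset.sum_eq_zero fun w _ => ?_
  by_cases hadj : G.graph.Adj p w
  · obtain ⟨_, e, he⟩ := hadj
    -- An open edge meeting the cycle lies in it, and so do its ends; an edge at a vertex off the
    -- cycle therefore avoids the cycle in its interior, and its ends share a gate.
    rw [MetricGraph.gate_eq_gate hπ he, sub_self, mul_zero]
    intro x hx hxP
    exact hpP (MetricGraph.edgeSet_subset_of_openEdge_subset hπ.isClosed
      (hγ.openEdge_subset hπ.isClosed hG hx hxP) (MetricGraph.mem_edgeSet_of_eq he))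
  · rw [MetricGraph.conductance, if_neg hadj, zero_mul]

/-- The Laplacian of a function of the gate at a vertex of the cycle. -/
lemma sum_conductance (hγ : IsCircleParam P ℓ γ) (hπ : IsGate P π)
    (hG : G.HasEuclideanEdges) {p : G.vertices} {θ : ℝ} (hp : γ θ = p) :
    ∃ a ∈ Set.Ioc 0 (ℓ / 2), ∃ b ∈ Set.Ioc 0 (ℓ / 2), (∀ t ∈ Set.Ioo 0 a, γ (θ + t) ∉ G.vertices) ∧
      (∀ t ∈ Set.Ioo 0 b, γ (θ - t) ∉ G.vertices) ∧ ∀ F : Γ → ℝ,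
      ∑ w, G.conductance p w * (F (π p) - F (π w))
        = 1 / a * (F (γ θ) - F (γ (θ + a))) + 1 / b * (F (γ θ) - F (γ (θ - b))) := by
  have hl := hγ.pos
  have hθ : γ θ ∈ G.vertices := hp ▸ p.2
  obtain ⟨a, ha, e, he, hea⟩ := hγ.exists_arc hG hθ
  obtain ⟨b, hb, f, hf, hfb⟩ := hγ.reverse.exists_arc (θ := -θ) hG (by rwa [neg_neg])
  have hneg : ∀ t, -(-θ + t) = θ - t := fun t => by ring
  simp only [hneg, neg_neg] at hf hfb
  refine ⟨a, ha, b, hb, fun t ht => G.notMem_vertices_of_mem_openEdge (hea t ht),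
    fun t ht => G.notMem_vertices_of_mem_openEdge (hfb t ht), fun F => ?_⟩
  have hmem : ∀ {e : Fin G.numEdges} {x y : Γ}, s(G.src e, G.tgt e) = s(x, y) → y ∈ G.vertices :=
    fun {e x y} h => by
      rcases MetricGraph.eq_src_or_eq_tgt_of_eq (h.trans Sym2.eq_swap) with rfl | rfl
      · exact G.curve_zero_mem e
      · exact G.curve_len_mem e
  -- If both directions led into one edge, the points at distance t on the two sides of γ θ would
  -- coincide.
  have hef : e ≠ f := by
    rintro rfl
    set t := min a b / 2 with ht
    have hm : 0 < min a b := lt_min ha.1 hb.1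
    have h1 : t < a := by linarith [min_le_left a b]
    have h2 : t < b := by linarith [min_le_right a b]
    have h3 := hG.eq_of_dist_eq (MetricGraph.eq_src_or_eq_tgt_of_eq he)
      (G.openEdge_subset e (hea t ⟨by linarith, h1⟩)) (G.openEdge_subset e (hfb t ⟨by linarith, h2⟩))
      (by rw [hγ.dist_eq, hγ.dist_eq, add_sub_cancel_left, sub_sub_cancel_left, AddCircle.coe_neg,
            norm_neg])
    have := hγ.eq_of_abs_lt (abs_lt.2 ⟨by linarith, by linarith [ha.2, hb.2]⟩) h3
    linarith
  set u : G.vertices := ⟨γ (θ + a), hmem he⟩ with hu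
  set w : G.vertices := ⟨γ (θ - b), hmem hf⟩ with hw
  have huw : u ≠ w := by
    intro h
    have h' : γ (θ + a) = γ (θ - b) := congrArg Subtype.val h
    exact hef (hG.no_multiple _ _ (by rw [he, hf, h']))
  rw [Finset.sum_eq_add u w huw]
  · rw [hp] at he hf
    rw [hG.conductance_eq (u := p) (w := u) he, hG.conductance_eq (u := p) (w := w) hf,
      hπ.self p (hp ▸ hγ.mem θ), hπ.self u (hγ.mem _), hπ.self w (hγ.mem _), ← hp, hu, hw]
    simp only
    rw [hγ.dist_eq_of_le, hγ.dist_eq_of_le, sub_add_cancel_left, abs_neg, abs_of_pos ha.1,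
      sub_sub_cancel, abs_of_pos hb.1]
    · rw [sub_sub_cancel, abs_of_pos hb.1]; exact hb.2
    · rw [sub_add_cancel_left, abs_neg, abs_of_pos ha.1]; exact ha.2
  -- Any other neighbour has the same gate as p: if its edge ran in the cycle, a point of it near p
  -- would lie on e or on f.
  · rintro y _ ⟨hyu, hyw⟩
    by_cases hadj : G.graph.Adj p y
    · obtain ⟨_, e', he'⟩ := hadj
      rw [MetricGraph.gate_eq_gate hπ he', sub_self, mul_zero]
      intro x hx hxP
      have hsub := hγ.openEdge_subset hπ.isClosed hG hx hxP
      set t := min (min a b) (G.len e') / 2 with ht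
      have hm : 0 < min (min a b) (G.len e') := lt_min (lt_min ha.1 hb.1) (G.len_pos _)
      have h1 : t < a := by linarith [min_le_left a b, min_le_left (min a b) (G.len e')]
      have h2 : t < b := by linarith [min_le_right a b, min_le_left (min a b) (G.len e')]
      have h3 : t < G.len e' := by linarith [min_le_right (min a b) (G.len e')]
      obtain ⟨z, hz, hzd⟩ := hG.exists_dist_eq (MetricGraph.eq_src_or_eq_tgt_of_eq he')
        (s := t) ⟨by linarith, h3⟩
      obtain ⟨σ, hσ, rfl⟩ := hγ.exists_mem_Ico (θ - ℓ / 2) (hsub hz)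
      have hσ' : |σ - θ| ≤ ℓ / 2 := abs_le.2 ⟨by linarith [hσ.1], by linarith [hσ.2]⟩
      rw [← hp, hγ.dist_eq_of_le hσ'] at hzd
      have hno : ∀ {e₁ : Fin G.numEdges} {q : G.vertices}, s(G.src e₁, G.tgt e₁) = s(γ θ, (q : Γ)) →
          γ σ ∈ G.openEdge e₁ → y = q := by
        intro e₁ q h hz'
        have := G.eq_of_mem_openEdge hz hz'
        subst this
        rw [he', hp] at h
        exact Subtype.ext (Sym2.congr_right.1 h)
      rcases abs_cases (σ - θ) with ⟨h, _⟩ | ⟨h, _⟩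
      · refine hyu (hno he ?_)
        have := hea t ⟨by linarith, h1⟩
        rwa [show θ + t = σ by linarith] at this
      · refine hyw (hno hf ?_)
        have := hfb t ⟨by linarith, h2⟩
        rwa [show θ - t = σ by linarith] at this
    · rw [MetricGraph.conductance, if_neg hadj, zero_mul]
  · simp
  · simp

/-- The resistance between two vertices of a cycle. -/
lemma isPotential (hγ : IsCircleParam P ℓ γ) (hπ : IsGate P π) (hG : G.HasEuclideanEdges)
    {a b : G.vertices} (ha : (a : Γ) ∈ P) (hb : (b : Γ) ∈ P) {q : ℝ → ℝ}
    (hq : ∀ h, q h = h - h ^ 2 / ℓ) :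
    G.IsPotential a b fun w => (q (dist (π w) b) - q (dist (π w) a)) / 2 := by
  classical
  have hl := hγ.pos
  have hqd : ∀ s t : ℝ, |s - t| ≤ ℓ → q (dist (γ s) (γ t)) = |s - t| - |s - t| ^ 2 / ℓ := by
    intro s t hst
    rw [hγ.dist_eq_min hst, hq]
    rcases min_choice |s - t| (ℓ - |s - t|) with h | h <;> rw [h]
    field_simp
    ring
  -- q h is the effective resistance between points of a circle at distance h, and it is invariant
  -- under h ↦ ℓ - h. The Laplacian at p of the resistance to y is independent of y apart from the
  -- jump 2 at y = p, so m cancels in the difference for a and b.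
  have key : ∀ p : G.vertices, ∃ m, ∀ y : G.vertices, (y : Γ) ∈ P →
      ∑ w, G.conductance p w * (q (dist (π p) y) - q (dist (π w) y))
        = m - if p = y then 2 else 0 := by
    intro p
    by_cases hpP : (p : Γ) ∈ P
    · obtain ⟨θ, hθ⟩ := hγ.range_eq.symm ▸ hpP
      obtain ⟨c, hc, d, hd, h1, h2, h3⟩ := hγ.sum_conductance hπ hG (p := p) hθ
      refine ⟨(c + d) / ℓ, fun y hy => ?_⟩
      obtain ⟨σ, hσ, hσy⟩ := hγ.exists_mem_Ioc (θ - ℓ) hy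
      rw [sub_add_cancel] at hσ
      rw [h3 fun x => q (dist x y), ← hσy]
      have hc0 := hc.1
      have hd0 := hd.1
      have A0 : |θ - σ| = θ - σ := abs_of_nonneg (by linarith [hσ.2])
      have hval0 := hqd θ σ (by rw [A0]; linarith [hσ.1])
      by_cases hpy : p = y
      · have : σ = θ := hγ.eq_of_abs_lt (abs_lt.2 ⟨by linarith [hσ.1], by linarith [hσ.2]⟩)
          (by rw [hσy, hθ, hpy])
        subst this
        have A1 : |σ + c - σ| = c := by rw [add_sub_cancel_left, abs_of_pos hc0]
        have A2 : |σ - d - σ| = d := by rw [sub_sub_cancel_left, abs_neg, abs_of_pos hd0]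
        rw [if_pos hpy, hqd _ _ (by rw [sub_self, abs_zero]; exact hl.le),
          hqd _ _ (by rw [A1]; linarith [hc.2]), hqd _ _ (by rw [A2]; linarith [hd.2]), A1, A2,
          sub_self, abs_zero]
        field_simp
        ring
      · have hne : σ ≠ θ := by
          rintro rfl
          exact hpy (Subtype.ext (hθ.symm.trans hσy))
        have hlt : σ < θ := lt_of_le_of_ne hσ.2 hne
        have hyv : γ σ ∈ G.vertices := hσy ▸ y.2
        -- No vertex lies strictly between p and its neighbours, so θ - d, θ and θ + c lie in one
        -- period starting at σ. There q is a single quadratic polynomial, and its second difference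
        -- gives (c + d) / ℓ.
        have hd' : d ≤ θ - σ := by
          by_contra h
          refine h2 (θ - σ) ⟨by linarith, not_le.1 h⟩ ?_
          rwa [sub_sub_cancel]
        have hc' : c ≤ σ + ℓ - θ := by
          by_contra h
          refine h1 (σ + ℓ - θ) ⟨by linarith [hσ.1], not_le.1 h⟩ ?_
          rwa [add_sub_cancel, hγ.periodic]
        have A1 : |θ + c - σ| = θ + c - σ := abs_of_nonneg (by linarith)
        have A2 : |θ - d - σ| = θ - d - σ := abs_of_nonneg (by linarith)
        rw [if_neg hpy, hval0,
          hqd _ _ (by rw [A1]; linarith), hqd _ _ (by rw [A2]; linarith), A0, A1, A2]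
        field_simp
        ring
    · refine ⟨0, fun y hy => ?_⟩
      rw [hγ.sum_conductance_of_notMem hπ hG hpP fun x => q (dist x y), if_neg, sub_zero]
      rintro rfl
      exact hpP hy
  intro p
  obtain ⟨m, hm⟩ := key p
  have h1 := hm a ha
  have h2 := hm b hb
  have h3 : ∑ w, G.conductance p w * ((q (dist (π p) b) - q (dist (π p) a)) / 2
        - (q (dist (π w) b) - q (dist (π w) a)) / 2)
      = (∑ w, G.conductance p w * (q (dist (π p) b) - q (dist (π w) b))
        - ∑ w, G.conductance p w * (q (dist (π p) a) - q (dist (π w) a))) / 2 := by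
    rw [← Finset.sum_sub_distrib, Finset.sum_div]
    exact Finset.sum_congr rfl fun w _ => by ring
  simp only
  rw [h3, h1, h2]
  split_ifs <;> simp_all

/-- Some edge of the graph lies in the cycle, and the resistance metric on this edge is that of a
circle. -/
lemma exists_edge (hγ : IsCircleParam P ℓ γ) (hπ : IsGate P π) (hG : G.HasEuclideanEdges) :
    ∃ e, ∃ g, G.IsPotential ⟨G.src e, G.curve_zero_mem e⟩ ⟨G.tgt e, G.curve_len_mem e⟩ g ∧
      1 / G.len e - (g ⟨G.src e, G.curve_zero_mem e⟩ - g ⟨G.tgt e, G.curve_len_mem e⟩)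
          / G.len e ^ 2 = 1 / ℓ := by
  -- The vertices of G are unrelated to those of the piece; an infinite set still meets some open
  -- edge of G.
  obtain ⟨x, hxP, hxv⟩ := hγ.infinite.exists_notMem_finset G.vertices
  obtain ⟨e, he⟩ := G.exists_mem_openEdge hxv
  have hsub := MetricGraph.edgeSet_subset_of_openEdge_subset hπ.isClosed
    (hγ.openEdge_subset hπ.isClosed hG he hxP)
  have hl := G.len_pos e
  have hs : G.src e ∈ P := hsub ⟨0, ⟨le_rfl, hl.le⟩, rfl⟩
  have ht : G.tgt e ∈ P := hsub ⟨G.len e, ⟨hl.le, le_rfl⟩, rfl⟩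
  have hp := hγ.pos
  -- The drop of this potential along e is q (len e) = len e - (len e)² / ℓ.
  refine ⟨e, _, hγ.isPotential hπ hG hs ht fun h => rfl, ?_⟩
  simp only
  rw [hπ.self _ hs, hπ.self _ ht, dist_self, dist_self, dist_comm (G.tgt e), hG.dist_eq_len]
  field_simp
  ring

end IsCircleParam

namespace IsIntervalParam

variable {Γ : Type*} [MetricSpace Γ] {G : MetricGraph Γ} {P : Set Γ} {L : ℝ} {γ : ℝ → Γ}
  {π : Γ → Γ}

/-- Some edge of the graph has an interior point which separates the graph, and the resistance
metric on this edge is the geodesic metric. -/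
lemma exists_edge (hγ : IsIntervalParam P L γ) (hπ : IsGate P π) (hG : G.HasEuclideanEdges) :
    ∃ e, ∃ g, G.IsPotential ⟨G.src e, G.curve_zero_mem e⟩ ⟨G.tgt e, G.curve_len_mem e⟩ g ∧
      1 / G.len e - (g ⟨G.src e, G.curve_zero_mem e⟩ - g ⟨G.tgt e, G.curve_len_mem e⟩)
          / G.len e ^ 2 = 0 := by
  classical
  have hL := hγ.pos
  have hinf : (γ '' Set.Ioo 0 L).Infinite :=
    (Set.Ioo_infinite hL).image (hγ.injOn.mono Set.Ioo_subset_Icc_self)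
  obtain ⟨_, ⟨τ, hτ, rfl⟩, hxv⟩ := hinf.exists_notMem_finset G.vertices
  obtain ⟨e, he⟩ := G.exists_mem_openEdge hxv
  obtain ⟨S, hS, hfr, hSt⟩ := hγ.exists_isOpen hπ hτ
  have hl := G.len_pos e
  obtain ⟨ε, hε, hball⟩ := Metric.isOpen_iff.1 (G.isOpen_openEdge e) _ he
  obtain ⟨σ, hσ, hcσ⟩ := he
  have hσ' : σ ∈ Set.Icc 0 (G.len e) := ⟨hσ.1.le, hσ.2.le⟩
  have hτ' : τ ∈ Set.Icc 0 L := ⟨hτ.1.le, hτ.2.le⟩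
  -- A connected part of an edge that avoids the single boundary point γ τ stays on one side of S.
  have hconn : ∀ (e' : Fin G.numEdges) (I : Set ℝ), IsPreconnected I → I ⊆ Set.Icc 0 (G.len e') →
      (∀ t ∈ I, G.curve e' t ≠ γ τ) →
      ∀ s ∈ I, ∀ t ∈ I, G.curve e' s ∈ S → G.curve e' t ∈ S := by
    intro e' I hI hsub hne s hs t ht hsS
    by_contra htS
    have hdich : ∀ u ∈ I, G.curve e' u ∈ S ∪ (closure S)ᶜ := fun u hu => by
      by_contra h
      rw [Set.mem_union, not_or, Set.mem_compl_iff, not_not] at h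
      have : G.curve e' u ∈ frontier S := ⟨h.2, by rw [hS.interior_eq]; exact h.1⟩
      rw [hfr] at this
      exact hne u hu this
    obtain ⟨y, _, hy, hy'⟩ := hI.image _ ((G.continuousOn_curve e').mono hsub) S (closure S)ᶜ hS
      isClosed_closure.isOpen_compl (Set.image_subset_iff.2 hdich) ⟨_, ⟨s, hs, rfl⟩, hsS⟩
      ⟨_, ⟨t, ht, rfl⟩, (hdich t ht).resolve_left htS⟩
    exact hy' (subset_closure hy)
  have hother : ∀ e', e' ≠ e → (G.src e' ∈ S ↔ G.tgt e' ∈ S) := by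
    intro e' hne
    have h := hconn e' _ isPreconnected_Icc subset_rfl fun t ht h => hne
      (G.eq_of_mem_openEdge_edgeSet ⟨σ, hσ, hcσ⟩ ⟨t, ht, h⟩).symm
    have hl := (G.len_pos e').le
    exact ⟨h 0 ⟨le_rfl, hl⟩ _ ⟨hl, le_rfl⟩, h _ ⟨hl, le_rfl⟩ 0 ⟨le_rfl, hl⟩⟩
  have hleft : ∀ s ∈ Set.Ico 0 σ, (G.src e ∈ S ↔ G.curve e s ∈ S) := by
    intro s hs
    have h := hconn e (Set.Ico 0 σ) isPreconnected_Ico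
      (fun t ht => ⟨ht.1, ht.2.le.trans hσ.2.le⟩) (fun t ht h => by
        have := hG.injOn_curve e ⟨ht.1, ht.2.le.trans hσ.2.le⟩ hσ' (h.trans hcσ.symm)
        linarith [ht.2])
    exact ⟨h 0 ⟨le_rfl, hσ.1⟩ s hs, h s hs 0 ⟨le_rfl, hσ.1⟩⟩
  have hright : ∀ s ∈ Set.Ioc σ (G.len e), (G.tgt e ∈ S ↔ G.curve e s ∈ S) := by
    intro s hs
    have h := hconn e (Set.Ioc σ (G.len e)) isPreconnected_Ioc
      (fun t ht => ⟨hσ.1.le.trans ht.1.le, ht.2⟩) (fun t ht h => by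
        have := hG.injOn_curve e ⟨hσ.1.le.trans ht.1.le, ht.2⟩ hσ' (h.trans hcσ.symm)
        linarith [ht.1])
    exact ⟨h _ ⟨hσ.2, le_rfl⟩ s hs, h s hs _ ⟨hσ.2, le_rfl⟩⟩
  -- Near γ τ the curve γ runs inside e and passes from the complement of S into S. If the ends of e
  -- lay on the same side, so would all of e except γ τ.
  have hsep : ¬(G.tgt e ∈ S ↔ G.src e ∈ S) := by
    set δ := min ε (min τ (L - τ)) / 2 with hδ
    have hm : 0 < min ε (min τ (L - τ)) := lt_min hε (lt_min hτ.1 (by linarith [hτ.2]))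
    have h1 : δ < ε := by linarith [min_le_left ε (min τ (L - τ))]
    have h2 : δ < τ := by linarith [min_le_right ε (min τ (L - τ)), min_le_left τ (L - τ)]
    have h3 : δ < L - τ := by linarith [min_le_right ε (min τ (L - τ)), min_le_right τ (L - τ)]
    have hδ0 : 0 < δ := by linarith
    have key : ∀ η, |η| = δ → ∃ u ∈ Set.Ioo 0 (G.len e), G.curve e u = γ (τ + η) ∧ |u - σ| = δ := by
      intro η hη
      have hmem : τ + η ∈ Set.Icc 0 L := by
        have := abs_le.1 hη.le
        exact ⟨by linarith, by linarith⟩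
      have hd : dist (γ (τ + η)) (γ τ) = δ := by
        rw [hγ.dist_eq _ hmem _ hτ', add_sub_cancel_left, hη]
      obtain ⟨u, hu, hue⟩ := hball (show γ (τ + η) ∈ Metric.ball _ ε by
        rw [Metric.mem_ball, hd]; exact h1)
      refine ⟨u, hu, hue, ?_⟩
      rw [← hG.dist_curve e ⟨hu.1.le, hu.2.le⟩ hσ', hue, hcσ, hd]
    obtain ⟨u, hu, hu1, hu2⟩ := key δ (abs_of_pos hδ0)
    obtain ⟨u', hu', hu1', hu2'⟩ := key (-δ) (by rw [abs_neg, abs_of_pos hδ0])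
    have hS1 : G.curve e u ∈ S := by
      rw [hu1, hSt _ ⟨by linarith, by linarith⟩]; linarith
    have hS2 : G.curve e u' ∉ S := by
      rw [hu1', hSt _ ⟨by linarith, by linarith⟩]; linarith
    have hne : u ≠ u' := by
      rintro rfl
      exact hS2 hS1
    intro hiff
    have hall : ∀ s ∈ Set.Ioo 0 (G.len e), s ≠ σ → (G.curve e s ∈ S ↔ G.src e ∈ S) := by
      intro s hs hsσ
      rcases lt_or_gt_of_ne hsσ with h | h
      · exact (hleft s ⟨hs.1.le, h⟩).symm
      · exact (hright s ⟨h, hs.2.le⟩).symm.trans hiff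
    have n1 : u ≠ σ := by rintro rfl; simp at hu2; linarith
    have n2 : u' ≠ σ := by rintro rfl; simp at hu2'; linarith
    exact hS2 ((hall u' hu' n2).2 ((hall u hu n1).1 hS1))
  set a : G.vertices := ⟨G.src e, G.curve_zero_mem e⟩ with ha
  set b : G.vertices := ⟨G.tgt e, G.curve_len_mem e⟩ with hb
  -- All current must cross e, so the potential is constant on either side of the cut, with drop len
  -- e; the effective resistance of e is its length.
  set g : G.vertices → ℝ := fun w => if ((w : Γ) ∈ S ↔ G.src e ∈ S) then G.len e else 0 with hg
  have hga : g a = G.len e := if_pos Iff.rfl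
  have hgb : g b = 0 := if_neg hsep
  have hab : a ≠ b := fun h => hG.no_loop e (congrArg Subtype.val h)
  have hcab : G.conductance a b = 1 / G.len e := by
    rw [hG.conductance_eq (e := e) (u := a) (w := b) rfl]
    exact congrArg _ (hG.dist_eq_len e)
  have hzero : ∀ p w : G.vertices, s((p : Γ), (w : Γ)) ≠ s(G.src e, G.tgt e) →
      G.conductance p w * (g p - g w) = 0 := by
    intro p w hpw
    by_cases hadj : G.graph.Adj p w
    · obtain ⟨_, e', he'⟩ := hadj
      have hne : e' ≠ e := by
        rintro rfl
        exact hpw he'.symm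
      have hiff : (p : Γ) ∈ S ↔ (w : Γ) ∈ S := by
        rcases Sym2.eq_iff.1 he' with ⟨h1, h2⟩ | ⟨h1, h2⟩
        · rw [← h1, ← h2]; exact hother e' hne
        · rw [← h1, ← h2]; exact (hother e' hne).symm
      rw [hg]
      simp only [hiff, sub_self, mul_zero]
    · rw [MetricGraph.conductance, if_neg hadj, zero_mul]
  refine ⟨e, g, fun p => ?_, ?_⟩
  · by_cases hpa : p = a
    · subst hpa
      rw [Finset.sum_eq_single b, hcab, hga, hgb, if_pos rfl, if_neg hab]
      · field_simp
        ring
      · intro w _ hwb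
        refine hzero _ _ fun h => hwb (Subtype.ext (Sym2.congr_right.1 h))
      · simp
    by_cases hpb : p = b
    · subst hpb
      rw [Finset.sum_eq_single a, G.conductance_comm, hcab, hga, hgb, if_neg hpa, if_pos rfl]
      · field_simp
        ring
      · intro w _ hwa
        refine hzero _ _ fun h => hwa (Subtype.ext (Sym2.congr_right.1 (h.trans Sym2.eq_swap)))
      · simp
    · rw [if_neg hpa, if_neg hpb, sub_self]
      refine Finset.sum_eq_zero fun w _ => hzero _ _ fun h => ?_
      rcases Sym2.eq_iff.1 h with ⟨h1, _⟩ | ⟨h1, _⟩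
      · exact hpa (Subtype.ext h1)
      · exact hpb (Subtype.ext h1)
  · rw [hga, hgb]
    field_simp
    ring

end IsIntervalParam

/-! ### Parametrized pieces and the proof of the theorem -/

lemma MetricGraph.IsEuclideanCycle.exists_isCircleParam {Γ : Type*} [MetricSpace Γ] {P : Set Γ}
    {H : MetricGraph P} (hH : H.IsEuclideanCycle) : ∃ γ, IsCircleParam P H.totalLength γ := by
  obtain ⟨hp, γ, hs, hd⟩ := hH.exists_param
  refine ⟨fun t => γ t, hp, ?_, hd⟩
  exact (Set.range_comp Subtype.val γ).trans (by rw [hs.range_eq, Set.image_univ, Subtype.range_coe])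

lemma MetricGraph.IsSingleEdge.exists_isIntervalParam {Γ : Type*} [MetricSpace Γ] {P : Set Γ}
    {H : MetricGraph P} (hH : H.IsSingleEdge) : ∃ L γ, IsIntervalParam P L γ := by
  obtain ⟨L, hL, γ, hs, hd⟩ := hH.exists_param
  refine ⟨L, fun t => γ t, hL, ?_, hd⟩
  ext x
  constructor
  · rintro ⟨t, _, rfl⟩
    exact (γ t).2
  · intro hx
    obtain ⟨t, ht, h⟩ := hs ⟨x, hx⟩
    exact ⟨t, ht, congrArg Subtype.val h⟩

theorem mainTheorem3 {Γ : Type*} [MetricSpace Γ] (G : MetricGraph Γ) (hG : G.HasEuclideanEdges)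
    (k : ℕ) (P : Fin k → Set Γ) (v : Fin k → Γ) (hsum : IsKStepOneSum P v)
    (H : ∀ i, MetricGraph (P i)) (hH : ∀ i, (H i).HasEuclideanEdges)
    (iS iT : Fin k) (hne : iS ≠ iT) (hS : (H iS).IsEuclideanCycle)
    (hT : ((H iT).IsEuclideanCycle ∧ (H iT).totalLength ≠ (H iS).totalLength) ∨
      (H iT).IsSingleEdge)
    (d : Γ → Γ → ℝ) (hd : d = dist ∨ ∃ v₀ : G.vertices, d = G.resistanceDist v₀)
    {Ω : Type*} [MeasurableSpace Ω] (μ : Measure Ω) [IsProbabilityMeasure μ]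
    (X : Γ → Ω → ℝ) (hXm : ∀ s, Measurable (X s)) (hX : IsGaussianProcess X μ)
    (r : ℝ → ℝ) (hr : ContinuousOn r (Set.Ici 0))
    (hcov : ∀ s t : Γ, cov[X s, X t; μ] = r (d s t))
    (hnd : ¬ ∃ c : ℝ, ∀ s t : Γ, cov[X s, X t; μ] = c) :
    ¬ IsMarkovOrderOne μ X := by
  intro hM
  have hself : ∀ s, d s s = 0 := by
    rcases hd with rfl | ⟨v₀, rfl⟩
    · exact dist_self
    · exact G.resistanceDist_self v₀
  -- Otherwise all variances vanish, and by Cauchy-Schwarz the covariance is constantly 0.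
  have h0 : 0 < r 0 := by
    by_contra h0
    refine hnd ⟨0, fun s t => ?_⟩
    have hz : ∀ s, cov[X s, X s; μ] = 0 := fun s => by
      refine le_antisymm ?_ ?_
      · rw [hcov, hself]; exact not_lt.1 h0
      · rw [covariance_self (hXm s).aemeasurable]; exact variance_nonneg _ _
    have := cov_sq_le hX s t
    rw [hz s, zero_mul] at this
    exact pow_eq_zero_iff two_ne_zero |>.1 (le_antisymm this (sq_nonneg _))
  obtain ⟨π, hπ⟩ := hsum.exists_isGate iS
  obtain ⟨π', hπ'⟩ := hsum.exists_isGate iT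
  obtain ⟨γ, hγ⟩ := hS.exists_isCircleParam
  rcases hd with rfl | ⟨v₀, rfl⟩
  · refine hnd (hM.cov_const hX G hcov hself (fun e => ⟨0, fun x hx y hy => ?_⟩) ?_)
    · rw [hG.dist_curve e ⟨hx.1.le, hx.2.le⟩ ⟨hy.1.le, hy.2.le⟩, zero_mul, sub_zero]
    rcases hT with ⟨hT, hlen⟩ | hT
    · obtain ⟨γ', hγ'⟩ := hT.exists_isCircleParam
      rcases lt_or_gt_of_ne hlen with h | h
      · exact hM.flat_of_cycle_cycle hX hXm hcov h0 hπ' hγ' hπ hγ h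
      · exact hM.flat_of_cycle_cycle hX hXm hcov h0 hπ hγ hπ' hγ' h
    · obtain ⟨L, γ', hγ'⟩ := hT.exists_isIntervalParam
      exact hM.flat_of_cycle_edge hX hXm hcov h0 hπ hγ
        ⟨L / 2, half_pos hγ'.pos, hM.multiplicative_edge hX hXm hcov h0 hπ' hγ'⟩
  · choose K hK hKg using hG.exists_resistanceDist_curve v₀
    refine hnd (hM.cov_const hX G hcov hself (fun e => ⟨K e, hK e⟩) ?_)
    have hpos := hγ.pos
    obtain ⟨e, g, hg, hge⟩ := hγ.exists_edge hπ hG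
    have he : K e = 1 / (H iS).totalLength := (hKg e g hg).trans hge
    -- The second piece supplies an edge with a different constant: the inverse of the other length
    -- for a cycle, 0 for a single edge.
    obtain ⟨f, hf0, hfe⟩ : ∃ f, 0 ≤ K f ∧ K e ≠ K f := by
      rcases hT with ⟨hT, hlen⟩ | hT
      · obtain ⟨γ', hγ'⟩ := hT.exists_isCircleParam
        obtain ⟨f, g', hg', hgf⟩ := hγ'.exists_edge hπ' hG
        have hf : K f = 1 / (H iT).totalLength := (hKg f g' hg').trans hgf
        refine ⟨f, by rw [hf]; exact (one_div_pos.2 hγ'.pos).le, ?_⟩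
        rw [he, hf]
        intro h
        rw [one_div, one_div] at h
        exact hlen (inv_injective h).symm
      · obtain ⟨L, γ', hγ'⟩ := hT.exists_isIntervalParam
        obtain ⟨f, g', hg', hgf⟩ := hγ'.exists_edge hπ' hG
        have hf : K f = 0 := (hKg f g' hg').trans hgf
        exact ⟨f, hf.ge, by rw [he, hf]; positivity⟩
    exact (hM.markovKernel_edge hX hXm hG hcov h0 (hK e)).flat_of_ne
      (hM.markovKernel_edge hX hXm hG hcov h0 (hK f)) (by rw [he]; positivity) hf0 hfe hr
      (fun s _ => rfl) (fun s _ => rfl)
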